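/- Let $K$ be a field of characteristic $0$, let $V$ be a finite dimensional $\mathbb Z$-graded vector space over $K$ with an associative, graded commutative product $q(x,y)=xy$ of degree $0$, and let $M$ be a finite dimensional graded module over $(V,q)$ (action of degree $0$), regarded as a bimodule by $a\cdot x=(-1)^{|a||x|}x\cdot a$. *Conventions.* For a graded space $E$, $E[1]$ is $E$ with $\deg x=|x|-1$. To a $k$-linear map $c$ on $E$ corresponds the map $C(x_1,\dots,x_k)=(-1)^{\sum_j (k-j)\deg x_j}c(x_1,\dots,x_k)$ on $E[1]$. For $\sigma\in\mathfrak S_k$, $\varepsilon_x(\sigma)$ (resp. $\varepsilon_{|x|}(\sigma)$) is the sign of $\sigma$ counting only the letters $x_j$ with $\deg x_j$ (resp. $|x_j|$) odd. A $k$-linear map $F$ on $E[1]$ *vanishes on shuffle products* if $\sum_{\sigma}\varepsilon_x(\sigma)F(x_{\sigma^{-1}(1)},\dots,x_{\sigma^{-1}(k)})=0$ for $0<p<k$, the sum being over the $(p,k-p)$-shuffles; a $k$-linear map $c$ on $E$ *vanishes on skew shuffle products* if $\sum_\sigma \varepsilon(\sigma)\varepsilon_{|x|}(\sigma)\,c(x_{\sigma^{-1}(1)},\dots,x_{\sigma^{-1}(k)})=0$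 for the same $p$. For a multilinear form $\Omega$ on $E[1]$ put $\Omega^\tau(x_1,\dots,x_n)=\varepsilon_x(\tau)\,\Omega(x_{\tau^{-1}(1)},\dots,x_{\tau^{-1}(n)})$; $\Omega$ is *cyclic* if it is invariant under the cycle $(1,2,\dots,n)$, and $\Omega^{Cycl}$ is the sum of the $\Omega^\tau$ over the cyclic group generated by that cycle. $\mathcal C_{vsp}(E)$ is the space of cyclic forms $\Omega$ such that $(x_1,\dots,x_k)\mapsto\Omega(x_1,\dots,x_k,y)$ vanishes on shuffle products for every $y$. *Double semidirect product.* Let $W=V\rtimes M$, with $(x,a)(y,b)=(xy,\,x\cdot b+a\cdot y)$, and $\tilde V=W\times W^\star$, with $$\tilde q\big((w,f),(w',f')\big)=(ww',\,w\cdot f'+f\cdot w'),\qquad \tilde b\big((w,f),(w',f')\big)=f(w')+(-1)^{|w||f'|}f'(w),$$ where $(f\cdot w)(z)=f(wz)$ and $(w\cdot f)(z)=(-1)^{|w|(|f|+|z|)}f(zw)$. Let $\tilde B(v,v')=(-1)^{\deg v}\,\tilde b(v,v')$ on $\tilde V[1]$ and let $\tilde Q$ correspond to $\tilde q$. For a $k$-linear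 $Q:\tilde V[1]^k\to\tilde V[1]$ put $\Omega_Q(v_1,\dots,v_{k+1})=\tilde B(Q(v_1,\dots,v_k),v_{k+1})$; $Q$ is *$\tilde B$-quadratic* if $\Omega_Q$ is cyclic. The Pinczon bracket of a $(k+1)$-linear form $\Omega$ and a $(k'+1)$-linear form $\Omega'$ homogeneous of degree $\deg\Omega'$ on $\tilde V[1]$ is $\{\Omega,\Omega'\}=\Theta^{Cycl}$, where $$\Theta(v_1,\dots,v_{k+k'})=(-1)^{\deg\Omega'\,(\deg v_1+\dots+\deg v_k)}\sum_i\Omega(v_1,\dots,v_k,e_i)\,\Omega'(v_{k+1},\dots,v_{k+k'},e'_i)$$ and $(e_i)$, $(e'_i)$ are bases with $\tilde B(e_i,e'_j)=\delta_{ij}$. The Pinczon differential is $d_P\Lambda=\{\Omega_{\tilde Q},\Lambda\}$. *Cochains.* For $e\in\mathbb Z$ and $k\ge0$ let $\mathrm{Harr}^{k,e}$ be the space of $k$-linear maps $c:V^k\to M$ of degree $e$ vanishing on skew shuffle products, with the Harrison differential $$d_{Ha}c(x_1,\dots,x_{k+1})=(-1)^e\Big[(-1)^{e|x_1|}x_1\cdot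 c(x_2,\dots,x_{k+1})+\sum_{r=1}^k(-1)^r c(x_1,\dots,x_rx_{r+1},\dots,x_{k+1})+(-1)^{k+1}c(x_1,\dots,x_k)\cdot x_{k+1}\Big].$$ For $c\in\mathrm{Harr}^{k,e}$, with corresponding map $C$ on $V[1]$, let $C'$ be the map on $\tilde V[1]$ sending $\big(((x_j,a_j),f_j)\big)_{1\le j\le k}$ to $\big((0,C(x_1,\dots,x_k)),0\big)$, and let $\tilde C$ be the unique map with $\Omega_{\tilde C}=(\Omega_{C'})^{Cycl}$. **Proposition.** For all $e\in\mathbb Z$ and $k\ge 0$ (in particular for $e=2-k$, where $\deg\tilde C=1$) and all $c\in\mathrm{Harr}^{k,e}$, the map $\tilde C$ is $\tilde B$-quadratic, vanishes on shuffle products and has degree $e+k-1$. Moreover $d_{Ha}$ maps $\mathrm{Harr}^{k,e}$ linearly to $\mathrm{Harr}^{k+1,e}$ with $d_{Ha}^2=0$; $d_P$ maps linearly the space of $(k+1)$-linear forms of degree $e+k+1$ in $\mathcal C_{vsp}(\tilde V)$ to the space of $(k+2)$-linear forms of degree $e+k+2$ in $\mathcal C_{vsp}(\tilde V)$, with $d_P^2=0$;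 and $\Phi:c\mapsto\tilde C$, identified with $c\mapsto\Omega_{\tilde C}\in\mathcal C_{vsp}(\tilde V)$, is a morphism of complexes: it is linear and $$\{\Omega_{\tilde Q},\Omega_{\tilde C}\}=\Omega_{\widetilde{D}},\qquad\text{where }\widetilde{D}=\Phi(d_{Ha}c),\qquad\text{i.e. } d_P\circ\Phi=\Phi\circ d_{Ha}.$$ -/

import Mathlib

open scoped DirectSum

noncomputable section

namespace Pinczon

/-! ### Graded vector spaces

A graded vector space is a vector space `V` with a family `𝒱 : ℤ → Submodule K V` and an instance
`DirectSum.Decomposition 𝒱`, that is `V = ⨁ n, 𝒱 n`. -/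

section Gradings

variable {K V M : Type*} [Field K] [AddCommGroup V] [Module K V] [AddCommGroup M] [Module K M]

/-- The sign `(-1) ^ ε` of a parity `ε`. -/
def sgn (ε : ZMod 2) : ℤ := if ε = 0 then 1 else -1

/-- The grading of the shifted space `V[1]`: an element of degree `n` in `V` has degree `n - 1`
in `V[1]`. -/
def shift (𝒱 : ℤ → Submodule K V) (n : ℤ) : Submodule K V := 𝒱 (n + 1)

/-- The grading of `V × M`. -/
def prodGrading (𝒱 : ℤ → Submodule K V) (ℳ : ℤ → Submodule K M) (n : ℤ) :
    Submodule K (V × M) := (𝒱 n).prod (ℳ n)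

/-- The grading of the dual space: a form has degree `n` if it vanishes on all the `𝒱 m` with
`m ≠ -n` (scalars have degree `0`). -/
def dualGrading (𝒱 : ℤ → Submodule K V) (n : ℤ) : Submodule K (Module.Dual K V) where
  carrier := {f | ∀ m, m ≠ -n → ∀ x ∈ 𝒱 m, f x = 0}
  add_mem' hf hg m hm x hx := by simp [hf m hm x hx, hg m hm x hx]
  zero_mem' _ _ _ _ := rfl
  smul_mem' a f hf m hm x hx := by simp [hf m hm x hx]

instance (𝒱 : ℤ → Submodule K V) [DirectSum.Decomposition 𝒱] :
    DirectSum.Decomposition (shift 𝒱) :=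
  DirectSum.IsInternal.chooseDecomposition _ <| by
    have h := (DirectSum.isInternal_submodule_iff_iSupIndep_and_iSup_eq_top 𝒱).1
      (DirectSum.Decomposition.isInternal 𝒱)
    refine (DirectSum.isInternal_submodule_iff_iSupIndep_and_iSup_eq_top _).2 ⟨?_, ?_⟩
    · exact h.1.comp (f := fun n : ℤ => n + 1) (add_left_injective 1)
    · rw [← h.2]
      exact (Equiv.addRight (1 : ℤ)).iSup_comp (g := 𝒱)

/-- The projection of `V` onto its homogeneous component of degree `n`. -/
def homProj (𝒱 : ℤ → Submodule K V) [DirectSum.Decomposition 𝒱] (n : ℤ) : V →ₗ[K] V :=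
  (𝒱 n).subtype ∘ₗ DirectSum.component K ℤ (fun n => 𝒱 n) n ∘ₗ
    (DirectSum.decomposeLinearEquiv 𝒱).toLinearMap

lemma homProj_mem (𝒱 : ℤ → Submodule K V) [DirectSum.Decomposition 𝒱] (n : ℤ) (x : V) :
    homProj 𝒱 n x ∈ 𝒱 n := by simp [homProj]

lemma homProj_same (𝒱 : ℤ → Submodule K V) [DirectSum.Decomposition 𝒱] {n : ℤ} {x : V}
    (hx : x ∈ 𝒱 n) : homProj 𝒱 n x = x :=
  DirectSum.decompose_of_mem_same 𝒱 hx

lemma homProj_ne (𝒱 : ℤ → Submodule K V) [DirectSum.Decomposition 𝒱] {m n : ℤ} {x : V}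
    (hx : x ∈ 𝒱 m) (h : m ≠ n) : homProj 𝒱 n x = 0 :=
  DirectSum.decompose_of_mem_ne 𝒱 hx h

lemma isInternal_of_proj (A : ℤ → Submodule K V) (p : ℤ → V →ₗ[K] V)
    (h1 : ∀ n, ∀ x ∈ A n, p n x = x) (h2 : ∀ n m, m ≠ n → ∀ x ∈ A m, p n x = 0)
    (h3 : ⨆ n, A n = ⊤) : DirectSum.IsInternal A := by
  refine (DirectSum.isInternal_submodule_iff_iSupIndep_and_iSup_eq_top A).2 ⟨fun n => ?_, h3⟩
  rw [Submodule.disjoint_def]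
  intro x hx hx'
  have : (⨆ j, ⨆ (_ : j ≠ n), A j) ≤ LinearMap.ker (p n) :=
    iSup₂_le fun m hm x hx => h2 n m hm x hx
  rw [← h1 n x hx]
  exact this hx'

instance (𝒱 : ℤ → Submodule K V) [DirectSum.Decomposition 𝒱]
    (ℳ : ℤ → Submodule K M) [DirectSum.Decomposition ℳ] :
    DirectSum.Decomposition (prodGrading 𝒱 ℳ) :=
  DirectSum.IsInternal.chooseDecomposition _ <| by
    refine isInternal_of_proj _ (fun n => (homProj 𝒱 n).prodMap (homProj ℳ n)) ?_ ?_ ?_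
    · rintro n ⟨x, a⟩ ⟨hx, ha⟩
      exact Prod.ext (homProj_same 𝒱 hx) (homProj_same ℳ ha)
    · rintro n m h ⟨x, a⟩ ⟨hx, ha⟩
      exact Prod.ext (homProj_ne 𝒱 hx h) (homProj_ne ℳ ha h)
    · refine eq_top_iff.2 fun x _ => ?_
      have h1 : ∀ y : V, (y, (0 : M)) ∈ ⨆ n, prodGrading 𝒱 ℳ n := by
        intro y
        induction y using DirectSum.Decomposition.inductionOn 𝒱 with
        | zero => exact Submodule.zero_mem _
        | @homogeneous i m =>
          exact Submodule.mem_iSup_of_mem i ⟨m.2, (ℳ i).zero_mem⟩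
        | add m m' hm hm' => simpa using Submodule.add_mem _ hm hm'
      have h2 : ∀ y : M, ((0 : V), y) ∈ ⨆ n, prodGrading 𝒱 ℳ n := by
        intro y
        induction y using DirectSum.Decomposition.inductionOn ℳ with
        | zero => exact Submodule.zero_mem _
        | @homogeneous i m =>
          exact Submodule.mem_iSup_of_mem i ⟨(𝒱 i).zero_mem, m.2⟩
        | add m m' hm hm' => simpa using Submodule.add_mem _ hm hm'
      simpa using Submodule.add_mem _ (h1 x.1) (h2 x.2)

instance (𝒱 : ℤ → Submodule K V) [DirectSum.Decomposition 𝒱] [FiniteDimensional K V] :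
    DirectSum.Decomposition (dualGrading 𝒱) :=
  DirectSum.IsInternal.chooseDecomposition _ <| by
    refine isInternal_of_proj _
      (fun n => LinearMap.lcomp K K (homProj 𝒱 (-n))) ?_ ?_ ?_
    · intro n f hf
      ext x
      induction x using DirectSum.Decomposition.inductionOn 𝒱 with
      | zero => simp
      | @homogeneous i m =>
        by_cases h : i = -n
        · subst h
          exact congrArg f (homProj_same 𝒱 m.2)
        · rw [hf i h m m.2]
          exact (congrArg f (homProj_ne 𝒱 m.2 h)).trans (map_zero f)
      | add m m' hm hm' => rw [map_add, map_add, hm, hm']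
    · intro n m h f hf
      ext x
      exact hf (-n) (by simpa using h.symm) _ (homProj_mem 𝒱 (-n) x)
    · refine eq_top_iff.2 fun f _ => ?_
      have hfin : {n | 𝒱 n ≠ ⊥}.Finite := WellFoundedGT.finite_ne_bot_of_iSupIndep
        (DirectSum.Decomposition.isInternal 𝒱).submodule_iSupIndep
      have hf : f = ∑ n ∈ hfin.toFinset, f ∘ₗ homProj 𝒱 n := by
        ext x
        induction x using DirectSum.Decomposition.inductionOn 𝒱 with
        | zero => simp
        | @homogeneous i m =>
          rw [LinearMap.sum_apply]
          by_cases h : 𝒱 i = ⊥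
          · have : (m : V) = 0 := by simpa [h] using m.2
            simp [this]
          · rw [Finset.sum_eq_single i]
            · exact (congrArg f (homProj_same 𝒱 m.2)).symm
            · intro j _ hj
              exact (congrArg f (homProj_ne 𝒱 m.2 hj.symm)).trans (map_zero f)
            · intro hi
              exact absurd (hfin.mem_toFinset.2 h) hi
        | add m m' hm hm' => rw [map_add, map_add, hm, hm']
      rw [hf]
      refine Submodule.sum_mem _ fun n _ => Submodule.mem_iSup_of_mem (-n) ?_
      intro m hm x hx
      exact (congrArg f (homProj_ne 𝒱 hx (by simpa using hm))).trans (map_zero f)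

/-- The projection of `V` onto the sum of its homogeneous components of parity `ε`. -/
def parityProj (𝒱 : ℤ → Submodule K V) [DirectSum.Decomposition 𝒱] (ε : ZMod 2) : V →ₗ[K] V :=
  (DirectSum.toModule K ℤ V fun n => if (n : ZMod 2) = ε then (𝒱 n).subtype else 0) ∘ₗ
    (DirectSum.decomposeLinearEquiv 𝒱).toLinearMap

/-- The linear map `x ↦ (-1) ^ (degree of x) x`. -/
def parityInv (𝒱 : ℤ → Submodule K V) [DirectSum.Decomposition 𝒱] : V →ₗ[K] V :=
  parityProj 𝒱 0 - parityProj 𝒱 1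

lemma parityProj_of_mem (𝒱 : ℤ → Submodule K V) [DirectSum.Decomposition 𝒱] (ε : ZMod 2) {n : ℤ}
    {x : V} (hx : x ∈ 𝒱 n) : parityProj 𝒱 ε x = if (n : ZMod 2) = ε then x else 0 := by
  simp only [parityProj, LinearMap.comp_apply, LinearEquiv.coe_coe,
    DirectSum.decomposeLinearEquiv_apply, DirectSum.decompose_of_mem 𝒱 hx]
  erw [DirectSum.toModule_lof]
  split_ifs <;> rfl

lemma parityInv_of_mem (𝒱 : ℤ → Submodule K V) [DirectSum.Decomposition 𝒱] {n : ℤ}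
    {x : V} (hx : x ∈ 𝒱 n) : parityInv 𝒱 x = sgn n • x := by
  rw [parityInv, LinearMap.sub_apply, parityProj_of_mem 𝒱 _ hx, parityProj_of_mem 𝒱 _ hx, sgn]
  obtain h | h : (n : ZMod 2) = 0 ∨ (n : ZMod 2) = 1 := by
    generalize (n : ZMod 2) = ε
    revert ε
    decide
  · simp [h]
  · simp [h]

lemma parityInv_parityInv (𝒱 : ℤ → Submodule K V) [DirectSum.Decomposition 𝒱] (x : V) :
    parityInv 𝒱 (parityInv 𝒱 x) = x := by
  induction x using DirectSum.Decomposition.inductionOn 𝒱 with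
  | zero => simp
  | @homogeneous i m =>
    rw [parityInv_of_mem 𝒱 m.2, map_zsmul, parityInv_of_mem 𝒱 m.2, smul_smul, sgn]
    split_ifs <;> simp
  | add m m' hm hm' => rw [map_add, map_add, hm, hm']

end Gradings

/-! ### Multilinear maps and the Koszul rule -/

section Multilinear

variable {K V W : Type*} [Field K] [AddCommGroup V] [Module K V] [AddCommGroup W] [Module K W]

/-- Multiplication of a multilinear map by a sign depending on the parities of its arguments:
for homogeneous `x i` of degrees `d i`, the value is `s d • f x`. -/
def signed (𝒱 : ℤ → Submodule K V) [DirectSum.Decomposition 𝒱] {k : ℕ}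
    (s : (Fin k → ZMod 2) → ℤ) (f : MultilinearMap K (fun _ : Fin k => V) W) :
    MultilinearMap K (fun _ : Fin k => V) W :=
  ∑ d : Fin k → ZMod 2, s d • f.compLinearMap (fun i => parityProj 𝒱 (d i))

/-- The sign `ε_x(σ)` of `σ` when only the positions of the letters of odd degree are taken into
account, where `d i` is the parity of the degree of `x i`. -/
def koszulSign {k : ℕ} (d : Fin k → ZMod 2) (σ : Equiv.Perm (Fin k)) : ℤ :=
  ∏ i, ∏ j, if i < j ∧ σ j < σ i then sgn (d i * d j) else 1

/-- The action of a permutation on multilinear maps, with the Koszul rule: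
`(f ^ σ) (x₁, …, x_k) = ε_x(σ) f (x_{σ⁻¹(1)}, …, x_{σ⁻¹(k)})`. -/
def permAct (𝒱 : ℤ → Submodule K V) [DirectSum.Decomposition 𝒱] {k : ℕ}
    (σ : Equiv.Perm (Fin k)) (f : MultilinearMap K (fun _ : Fin k => V) W) :
    MultilinearMap K (fun _ : Fin k => V) W :=
  signed 𝒱 (fun d => koszulSign d σ) (f.domDomCongr σ.symm)

open Classical in
/-- The `(p, k - p)` shuffles: permutations increasing on the first `p` and on the last `k - p`
indices. -/
def shuffles (p k : ℕ) : Finset (Equiv.Perm (Fin k)) :=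
  Finset.univ.filter fun σ => ∀ i j : Fin k, i < j →
    ((j : ℕ) < p ∨ p ≤ (i : ℕ)) → σ i < σ j

/-- `f` vanishes on the image of all shuffle products `sh_{p, k - p}` with `0 < p < k`. -/
def VanishesOnShuffles (𝒱 : ℤ → Submodule K V) [DirectSum.Decomposition 𝒱] {k : ℕ}
    (f : MultilinearMap K (fun _ : Fin k => V) W) : Prop :=
  ∀ p, 0 < p → p < k → ∑ σ ∈ shuffles p k, permAct 𝒱 σ f = 0

/-- `f` vanishes on the image of all skew shuffle products, in which each term carries in
addition the signature of the shuffle. -/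
def VanishesOnSkewShuffles (𝒱 : ℤ → Submodule K V) [DirectSum.Decomposition 𝒱] {k : ℕ}
    (f : MultilinearMap K (fun _ : Fin k => V) W) : Prop :=
  ∀ p, 0 < p → p < k → ∑ σ ∈ shuffles p k, (Equiv.Perm.sign σ : ℤ) • permAct 𝒱 σ f = 0

/-- `f` is homogeneous of degree `e`. -/
def HasDegree (𝒱 : ℤ → Submodule K V) (𝒲 : ℤ → Submodule K W) {k : ℕ} (e : ℤ)
    (f : MultilinearMap K (fun _ : Fin k => V) W) : Prop :=
  ∀ (d : Fin k → ℤ) (x : Fin k → V), (∀ i, x i ∈ 𝒱 (d i)) → f x ∈ 𝒲 (∑ i, d i + e)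

section

variable {𝒱 : ℤ → Submodule K V} {𝒲 : ℤ → Submodule K W} {k : ℕ} {e : ℤ}
  {f g : MultilinearMap K (fun _ : Fin k => V) W}

lemma hasDegree_zero : HasDegree 𝒱 𝒲 e (0 : MultilinearMap K (fun _ : Fin k => V) W) :=
  fun _ _ _ => Submodule.zero_mem _

lemma HasDegree.add (hf : HasDegree 𝒱 𝒲 e f) (hg : HasDegree 𝒱 𝒲 e g) :
    HasDegree 𝒱 𝒲 e (f + g) :=
  fun d x hx => Submodule.add_mem _ (hf d x hx) (hg d x hx)

lemma HasDegree.smul (r : K) (hf : HasDegree 𝒱 𝒲 e f) : HasDegree 𝒱 𝒲 e (r • f) :=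
  fun d x hx => Submodule.smul_mem _ r (hf d x hx)

variable [DirectSum.Decomposition 𝒱]

lemma permAct_zero (σ : Equiv.Perm (Fin k)) :
    permAct 𝒱 σ (0 : MultilinearMap K (fun _ : Fin k => V) W) = 0 := by
  ext x; simp [permAct, signed]

lemma permAct_add (σ : Equiv.Perm (Fin k)) :
    permAct 𝒱 σ (f + g) = permAct 𝒱 σ f + permAct 𝒱 σ g := by
  ext x; simp [permAct, signed, Finset.sum_add_distrib]

lemma permAct_smul (r : K) (σ : Equiv.Perm (Fin k)) :
    permAct 𝒱 σ (r • f) = r • permAct 𝒱 σ f := by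
  ext x
  simp only [permAct, signed, _root_.sum_apply, _root_.smul_apply,
    MultilinearMap.compLinearMap_apply, MultilinearMap.domDomCongr_apply, Finset.smul_sum]
  exact Finset.sum_congr rfl fun d _ => smul_comm _ _ _

lemma vanishesOnShuffles_zero :
    VanishesOnShuffles 𝒱 (0 : MultilinearMap K (fun _ : Fin k => V) W) :=
  fun p _ _ => by simp [permAct_zero]

lemma VanishesOnShuffles.add (hf : VanishesOnShuffles 𝒱 f) (hg : VanishesOnShuffles 𝒱 g) :
    VanishesOnShuffles 𝒱 (f + g) :=
  fun p h h' => by simp [permAct_add, Finset.sum_add_distrib, hf p h h', hg p h h']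

lemma VanishesOnShuffles.smul (r : K) (hf : VanishesOnShuffles 𝒱 f) :
    VanishesOnShuffles 𝒱 (r • f) :=
  fun p h h' => by simp [permAct_smul, ← Finset.smul_sum, hf p h h']

lemma vanishesOnSkewShuffles_zero :
    VanishesOnSkewShuffles 𝒱 (0 : MultilinearMap K (fun _ : Fin k => V) W) :=
  fun p _ _ => by simp [permAct_zero]

lemma VanishesOnSkewShuffles.add (hf : VanishesOnSkewShuffles 𝒱 f)
    (hg : VanishesOnSkewShuffles 𝒱 g) : VanishesOnSkewShuffles 𝒱 (f + g) :=
  fun p h h' => by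
    simp only [permAct_add, smul_add, Finset.sum_add_distrib, hf p h h', hg p h h', add_zero]

lemma VanishesOnSkewShuffles.smul (r : K) (hf : VanishesOnSkewShuffles 𝒱 f) :
    VanishesOnSkewShuffles 𝒱 (r • f) :=
  fun p h h' => by
    simp only [permAct_smul, smul_comm _ r, ← Finset.smul_sum, hf p h h', smul_zero]

end

/-- The base field, in degree `0`. -/
def scalarGrading (K : Type*) [Field K] (n : ℤ) : Submodule K K := if n = 0 then ⊤ else ⊥

/-- The map `Q (x₁, …, x_k) = η_k (x₁, …, x_k) q (x₁, …, x_k)` on `V[1]` associated to a map `q`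
on `V`, where `η_k (x₁, …, x_k) = (-1) ^ (∑ j, (k - j) deg x_j)` with the degrees of `V[1]`. -/
def shiftMap (𝒱 : ℤ → Submodule K V) [DirectSum.Decomposition 𝒱] {k : ℕ}
    (q : MultilinearMap K (fun _ : Fin k => V) W) : MultilinearMap K (fun _ : Fin k => V) W :=
  q.compLinearMap (fun j => parityInv (shift 𝒱) ^ (k - (j + 1 : ℕ)))

/-- A bilinear map as a multilinear map in two variables. -/
def bilinear (q : V →ₗ[K] V →ₗ[K] W) : MultilinearMap K (fun _ : Fin 2 => V) W :=
  MultilinearMap.mk' (fun x => q (x 0) (x 1))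
    (by intro x i a b; fin_cases i <;> simp [Function.update])
    (by intro x i r a; fin_cases i <;> simp [Function.update])

lemma contractNth_update {k : ℕ} (q : V →ₗ[K] V →ₗ[K] V) (r : Fin k) (l : Fin (k + 1))
    (x : Fin (k + 1) → V) :
    ∃ (i : Fin k) (L : V →ₗ[K] V), ∀ v,
      Fin.contractNth r.castSucc (fun a b => q a b) (Function.update x l v) =
        Function.update (Fin.contractNth r.castSucc (fun a b => q a b) x) i (L v) := by
  by_cases h1 : (l : ℕ) < r
  · refine ⟨⟨l, by omega⟩, LinearMap.id, fun v => ?_⟩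
    ext j
    simp only [Fin.contractNth, Function.update_apply, Fin.ext_iff, Fin.val_castSucc, Fin.val_succ,
      LinearMap.id_apply]
    grind
  by_cases h2 : (l : ℕ) = r
  · refine ⟨r, q.flip (x r.succ), fun v => ?_⟩
    ext j
    simp only [Fin.contractNth, Function.update_apply, Fin.ext_iff, Fin.val_castSucc, Fin.val_succ,
      LinearMap.flip_apply]
    grind
  by_cases h3 : (l : ℕ) = r + 1
  · refine ⟨r, q (x r.castSucc), fun v => ?_⟩
    ext j
    simp only [Fin.contractNth, Function.update_apply, Fin.ext_iff, Fin.val_castSucc, Fin.val_succ]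
    grind
  · refine ⟨⟨l - 1, by omega⟩, LinearMap.id, fun v => ?_⟩
    ext j
    simp only [Fin.contractNth, Function.update_apply, Fin.ext_iff, Fin.val_castSucc, Fin.val_succ,
      LinearMap.id_apply]
    grind

/-- `(x₁, …, x_{k+1}) ↦ c (x₁, …, x_r x_{r+1}, …, x_{k+1})` (here `r` starts from `0`). -/
def contractAt {k : ℕ} (q : V →ₗ[K] V →ₗ[K] V) (r : Fin k)
    (c : MultilinearMap K (fun _ : Fin k => V) W) :
    MultilinearMap K (fun _ : Fin (k + 1) => V) W :=
  MultilinearMap.mk' (fun x => c (Fin.contractNth r.castSucc (fun a b => q a b) x))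
    (by
      intro x l a b
      obtain ⟨i, L, h⟩ := contractNth_update q r l x
      simp [h])
    (by
      intro x l t a
      obtain ⟨i, L, h⟩ := contractNth_update q r l x
      simp [h])

end Multilinear

/-! ### Cyclic forms and the Pinczon bracket

In this section `E` stands for the shifted space `V[1]`, with its grading `ℰ`. -/

section Cyclic

variable {K E : Type*} [Field K] [AddCommGroup E] [Module K E]

/-- `Ω (x_{k+1}, x₁, …, x_k) = Ω (x₁, …, x_{k+1})`, with the Koszul rule. -/
def IsCyclic (ℰ : ℤ → Submodule K E) [DirectSum.Decomposition ℰ] {k : ℕ}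
    (Ω : MultilinearMap K (fun _ : Fin (k + 1) => E) K) : Prop :=
  permAct ℰ (finRotate (k + 1)) Ω = Ω

/-- `Ω ^ Cycl`, the sum of the `Ω ^ τ` for `τ` in the cyclic group generated by the cycle
`(1, 2, …, n + 1)`, that is the group of the translations of `Fin (n + 1) = ℤ / (n + 1)`. -/
def cyclicSum (ℰ : ℤ → Submodule K E) [DirectSum.Decomposition ℰ] {n : ℕ}
    (Ω : MultilinearMap K (fun _ : Fin (n + 1) => E) K) :
    MultilinearMap K (fun _ : Fin (n + 1) => E) K :=
  ∑ a : Fin (n + 1), permAct ℰ (Equiv.addRight a) Ω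

/-- `(ι_y Ω) (x₁, …, x_k) = Ω (x₁, …, x_k, y)`. -/
def contractLast {k : ℕ} (y : E) (Ω : MultilinearMap K (fun _ : Fin (k + 1) => E) K) :
    MultilinearMap K (fun _ : Fin k => E) K :=
  (LinearMap.applyₗ y).compMultilinearMap Ω.curryRight

/-- `(x₁, …, x_{k+k'}) ↦ α (x₁, …, x_k) β (x_{k+1}, …, x_{k+k'})`, without any sign. -/
def tensorForm {k k' n : ℕ} (h : k + k' = n) (α : MultilinearMap K (fun _ : Fin k => E) K)
    (β : MultilinearMap K (fun _ : Fin k' => E) K) : MultilinearMap K (fun _ : Fin n => E) K :=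
  ((LinearMap.mul' K K).compMultilinearMap (α.domCoprod β)).domDomCongr
    (finSumFinEquiv.trans (finCongr h))

/-- The form `Ω_Q (x₁, …, x_{k+1}) = B (Q (x₁, …, x_k), x_{k+1})`. -/
def formOf (B : LinearMap.BilinForm K E) {k : ℕ} (Q : MultilinearMap K (fun _ : Fin k => E) E) :
    MultilinearMap K (fun _ : Fin (k + 1) => E) K :=
  (B.compMultilinearMap Q).uncurryRight

/-- The map `Q` such that `Ω_Q = Ω`, for a nondegenerate `B`. -/
def mapOf [FiniteDimensional K E] (B : LinearMap.BilinForm K E) (hB : B.Nondegenerate) {k : ℕ}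
    (Ω : MultilinearMap K (fun _ : Fin (k + 1) => E) K) :
    MultilinearMap K (fun _ : Fin k => E) E :=
  (B.toDual hB).symm.toLinearMap.compMultilinearMap Ω.curryRight

lemma formOf_mapOf [FiniteDimensional K E] (B : LinearMap.BilinForm K E) (hB : B.Nondegenerate)
    {k : ℕ} (Ω : MultilinearMap K (fun _ : Fin (k + 1) => E) K) :
    formOf B (mapOf B hB Ω) = Ω := by
  ext x
  simp [formOf, mapOf]

lemma mapOf_formOf [FiniteDimensional K E] (B : LinearMap.BilinForm K E) (hB : B.Nondegenerate)
    {k : ℕ} (Q : MultilinearMap K (fun _ : Fin k => E) E) :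
    mapOf B hB (formOf B Q) = Q := by
  ext x
  refine (B.toDual hB).injective ?_
  ext y
  simp [formOf, mapOf, LinearMap.BilinForm.toDual_def]

/-- `Q` is `B`-quadratic if `Ω_Q` is cyclic. -/
def IsQuadratic (ℰ : ℤ → Submodule K E) [DirectSum.Decomposition ℰ]
    (B : LinearMap.BilinForm K E) {k : ℕ} (Q : MultilinearMap K (fun _ : Fin k => E) E) : Prop :=
  IsCyclic ℰ (formOf B Q)

/-- The space of cyclic forms of arity `k + 1` and degree `f` that vanish on shuffle products, in
the sense that all the maps `(x₁, …, x_k) ↦ Ω (x₁, …, x_k, y)` do. -/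
def cyclicVsp (ℰ : ℤ → Submodule K E) [DirectSum.Decomposition ℰ] (f : ℤ) (k : ℕ) :
    Submodule K (MultilinearMap K (fun _ : Fin (k + 1) => E) K) where
  carrier := {Ω | HasDegree ℰ (scalarGrading K) f Ω ∧ IsCyclic ℰ Ω ∧
    ∀ y, VanishesOnShuffles ℰ (contractLast y Ω)}
  add_mem' {Ω Ω'} h h' := ⟨h.1.add h'.1,
    by simpa only [IsCyclic, permAct_add] using congrArg₂ (· + ·) h.2.1 h'.2.1,
    fun y => by
      have : contractLast y (Ω + Ω') = contractLast y Ω + contractLast y Ω' := by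
        ext x; simp [contractLast]
      rw [this]
      exact (h.2.2 y).add (h'.2.2 y)⟩
  zero_mem' := ⟨hasDegree_zero, permAct_zero _, fun y => by
      have : contractLast y (0 : MultilinearMap K (fun _ : Fin (k + 1) => E) K) = 0 := by
        ext x; simp [contractLast]
      rw [this]
      exact vanishesOnShuffles_zero⟩
  smul_mem' r Ω h := ⟨h.1.smul r,
    by simpa only [IsCyclic, permAct_smul] using congrArg (r • ·) h.2.1,
    fun y => by
      have : contractLast y (r • Ω) = r • contractLast y Ω := by
        ext x; simp [contractLast]
      rw [this]
      exact (h.2.2 y).smul r⟩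

/-- The Pinczon bracket associated to `B`,
`{Ω, Ω'} = (∑ i, ι_{e i} Ω ⊗ ι_{e' i} Ω') ^ Cycl`, for `Ω` of arity `k + 1` and `Ω'` of arity
`k' + 1` and degree `f'`, where `(e i)`, `(e' i)` are bases such that `B (e i, e' j) = δ_ij`
(the sum does not depend on the choice of such bases). The Koszul rule gives the sign
`(-1) ^ (f' * (deg x₁ + ⋯ + deg x_k))` in front of
`∑ i, Ω (x₁, …, x_k, e i) Ω' (x_{k+1}, …, x_{k+k'}, e' i)`. -/
def pinczonBracket [FiniteDimensional K E] (ℰ : ℤ → Submodule K E) [DirectSum.Decomposition ℰ]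
    (B : LinearMap.BilinForm K E) (hB : B.Nondegenerate) {k k' n : ℕ} (h : k + k' = n + 1)
    (Ω : MultilinearMap K (fun _ : Fin (k + 1) => E) K) (f' : ℤ)
    (Ω' : MultilinearMap K (fun _ : Fin (k' + 1) => E) K) :
    MultilinearMap K (fun _ : Fin (n + 1) => E) K :=
  let e' := Module.finBasis K E
  let e := B.dualBasis hB e'
  cyclicSum ℰ <|
    signed ℰ (fun d => sgn ((f' : ZMod 2) * ∑ j : Fin (n + 1), if (j : ℕ) < k then d j else 0)) <|
      ∑ i, tensorForm h (contractLast (e i) Ω) (contractLast (e' i) Ω')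

end Cyclic

/-! ### Commutative algebras, modules and the Harrison complex -/

section Harrison

variable {K V M : Type*} [Field K] [AddCommGroup V] [Module K V] [AddCommGroup M] [Module K M]

/-- `q` is a graded commutative and associative product of degree `0` on `V`. -/
structure IsCommAlgebra (𝒱 : ℤ → Submodule K V) (q : V →ₗ[K] V →ₗ[K] V) : Prop where
  degree : ∀ i j, ∀ x ∈ 𝒱 i, ∀ y ∈ 𝒱 j, q x y ∈ 𝒱 (i + j)
  assoc : ∀ x y z, q (q x y) z = q x (q y z)
  comm : ∀ i j, ∀ x ∈ 𝒱 i, ∀ y ∈ 𝒱 j, q x y = sgn ((i : ZMod 2) * j) • q y x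

/-- `lact` is a graded module structure on `M` over the algebra `(V, q)`, of degree `0`. -/
structure IsAlgebraModule (𝒱 : ℤ → Submodule K V) (ℳ : ℤ → Submodule K M)
    (q : V →ₗ[K] V →ₗ[K] V) (lact : V →ₗ[K] M →ₗ[K] M) : Prop where
  degree : ∀ i j, ∀ x ∈ 𝒱 i, ∀ a ∈ ℳ j, lact x a ∈ ℳ (i + j)
  assoc : ∀ x y a, lact (q x y) a = lact x (lact y a)

/-- The right action `a · x = (-1) ^ (|a| |x|) x · a` on a module, viewed as a bimodule. -/
def rightAct (𝒱 : ℤ → Submodule K V) [DirectSum.Decomposition 𝒱]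
    (ℳ : ℤ → Submodule K M) [DirectSum.Decomposition ℳ] (lact : V →ₗ[K] M →ₗ[K] M) :
    M →ₗ[K] V →ₗ[K] M :=
  lact.flip.compl₂ (parityProj 𝒱 0) +
    (lact.flip.comp (parityInv ℳ)).compl₂ (parityProj 𝒱 1)

/-- `(x₁, …, x_{k+1}) ↦ x₁ · c (x₂, …, x_{k+1})`. -/
def leftActOn (lact : V →ₗ[K] M →ₗ[K] M) {k : ℕ} (c : MultilinearMap K (fun _ : Fin k => V) M) :
    MultilinearMap K (fun _ : Fin (k + 1) => V) M :=
  LinearMap.uncurryLeft (M := fun _ : Fin (k + 1) => V)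
    { toFun := fun x => (lact x).compMultilinearMap c
      map_add' := fun x y => by ext; simp
      map_smul' := fun r x => by ext; simp }

/-- `(x₁, …, x_{k+1}) ↦ c (x₁, …, x_k) · x_{k+1}`. -/
def rightActOn (ract : M →ₗ[K] V →ₗ[K] M) {k : ℕ} (c : MultilinearMap K (fun _ : Fin k => V) M) :
    MultilinearMap K (fun _ : Fin (k + 1) => V) M :=
  MultilinearMap.uncurryRight (M := fun _ : Fin (k + 1) => V) (ract.compMultilinearMap c)

/-- The coboundary of a cochain `c` of arity `k` and degree `e`,
`(d c) (x₁, …, x_{k+1}) = (-1) ^ e ((-1) ^ (e |x₁|) x₁ · c (x₂, …, x_{k+1})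
  + ∑_{r=1}^{k} (-1) ^ r c (x₁, …, x_r x_{r+1}, …, x_{k+1})
  + (-1) ^ (k+1) c (x₁, …, x_k) · x_{k+1})`.
On cochains vanishing on skew shuffle products it is the Harrison coboundary. The global sign
`(-1) ^ e` is the one for which `d c` corresponds on `V[1]` to the graded commutator `[Q, C]`; it
disappears when `V` and `M` are concentrated in degree `0`. -/
def harrisonD (𝒱 : ℤ → Submodule K V) [DirectSum.Decomposition 𝒱]
    (ℳ : ℤ → Submodule K M) [DirectSum.Decomposition ℳ] (q : V →ₗ[K] V →ₗ[K] V)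
    (lact : V →ₗ[K] M →ₗ[K] M) (e : ℤ) {k : ℕ}
    (c : MultilinearMap K (fun _ : Fin k => V) M) :
    MultilinearMap K (fun _ : Fin (k + 1) => V) M :=
  sgn e • (signed 𝒱 (fun d => sgn ((e : ZMod 2) * d 0)) (leftActOn lact c)
    + ∑ r : Fin k, sgn ((r : ℕ) + 1) • contractAt q r c
    + sgn (k + 1) • rightActOn (rightAct 𝒱 ℳ lact) c)

/-- The Harrison cochains of arity `k` and degree `e` of `V` with values in `M`. -/
def harrisonCochains (𝒱 : ℤ → Submodule K V) [DirectSum.Decomposition 𝒱]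
    (ℳ : ℤ → Submodule K M) (e : ℤ) (k : ℕ) :
    Submodule K (MultilinearMap K (fun _ : Fin k => V) M) where
  carrier := {c | HasDegree 𝒱 ℳ e c ∧ VanishesOnSkewShuffles 𝒱 c}
  add_mem' h h' := ⟨h.1.add h'.1, h.2.add h'.2⟩
  zero_mem' := ⟨hasDegree_zero, vanishesOnSkewShuffles_zero⟩
  smul_mem' r _ h := ⟨h.1.smul r, h.2.smul r⟩

end Harrison

/-! ### The double semidirect product -/

section Double

variable {K W : Type*} [Field K] [AddCommGroup W] [Module K W]

/-- The grading of `W × W*`. -/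
abbrev doubleGrading (𝒲 : ℤ → Submodule K W) : ℤ → Submodule K (W × Module.Dual K W) :=
  prodGrading 𝒲 (dualGrading 𝒲)

/-- The right action `(f · w) (z) = f (w z)` of an algebra on its dual. -/
def dualRight (qW : W →ₗ[K] W →ₗ[K] W) :
    Module.Dual K W →ₗ[K] W →ₗ[K] Module.Dual K W :=
  LinearMap.mk₂ K (fun f w => f ∘ₗ qW w)
    (fun _ _ _ => LinearMap.add_comp _ _ _) (fun _ _ _ => LinearMap.smul_comp _ _ _)
    (fun f w w' => by ext; simp) (fun r f w => by ext; simp)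

/-- The left action of an algebra on its dual, `(w · f) (z) = (-1) ^ (|w| (|f| + |z|)) f (z w)`.
Since `f (z w) = 0` unless `|f| + |z| + |w| = 0`, the sign is `(-1) ^ |w|`. -/
def dualLeft (𝒲 : ℤ → Submodule K W) [DirectSum.Decomposition 𝒲] (qW : W →ₗ[K] W →ₗ[K] W) :
    W →ₗ[K] Module.Dual K W →ₗ[K] Module.Dual K W :=
  LinearMap.mk₂ K (fun w f => f ∘ₗ qW.flip (parityInv 𝒲 w))
    (fun w w' f => by ext; simp) (fun r w f => by ext; simp)
    (fun _ _ _ => LinearMap.add_comp _ _ _) (fun _ _ _ => LinearMap.smul_comp _ _ _)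

/-- The product `(w, f) (w', f') = (w w', w · f' + f · w')` on `W × W*`. -/
def doubleMul (𝒲 : ℤ → Submodule K W) [DirectSum.Decomposition 𝒲] (qW : W →ₗ[K] W →ₗ[K] W) :
    (W × Module.Dual K W) →ₗ[K] (W × Module.Dual K W) →ₗ[K] (W × Module.Dual K W) :=
  LinearMap.mk₂ K
    (fun v v' => (qW v.1 v'.1, dualLeft 𝒲 qW v.1 v'.2 + dualRight qW v.2 v'.1))
    (fun v v' v'' => by ext <;> simp; abel) (fun r v v' => by ext <;> simp)
    (fun v v' v'' => by ext <;> simp; abel) (fun r v v' => by ext <;> simp)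

/-- The form `b ((w, f), (w', f')) = f (w') + (-1) ^ (|w| |f'|) f' (w)` on `W × W*`. Since
`f' (w) = 0` unless `|w| + |f'| = 0`, the sign is `(-1) ^ |w|`. -/
def doubleForm (𝒲 : ℤ → Submodule K W) [DirectSum.Decomposition 𝒲] :
    LinearMap.BilinForm K (W × Module.Dual K W) :=
  LinearMap.mk₂ K (fun v v' => v.2 v'.1 + v'.2 (parityInv 𝒲 v.1))
    (fun v v' v'' => by simp; abel) (fun r v v' => by simp [mul_add])
    (fun v v' v'' => by simp; abel) (fun r v v' => by simp [mul_add])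

variable [FiniteDimensional K W]

/-- The form `B (v, v') = (-1) ^ (deg v) b (v, v')` on `(W × W*)[1]`. -/
def doubleSymp (𝒲 : ℤ → Submodule K W) [DirectSum.Decomposition 𝒲] :
    LinearMap.BilinForm K (W × Module.Dual K W) :=
  (doubleForm 𝒲).comp (parityInv (shift (doubleGrading 𝒲))) LinearMap.id

lemma doubleSymp_nondegenerate (𝒲 : ℤ → Submodule K W) [DirectSum.Decomposition 𝒲] :
    (doubleSymp 𝒲).Nondegenerate := by
  have hB : ∀ v v', doubleSymp 𝒲 (parityInv (shift (doubleGrading 𝒲)) v) v' =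
      v.2 v'.1 + v'.2 (parityInv 𝒲 v.1) := fun v v' => by
    simp only [doubleSymp, LinearMap.BilinForm.comp_apply, parityInv_parityInv,
      LinearMap.id_apply]
    rfl
  constructor
  · intro v hv
    obtain ⟨u, rfl⟩ : ∃ u, parityInv (shift (doubleGrading 𝒲)) u = v :=
      ⟨_, parityInv_parityInv _ v⟩
    have h2 : u.2 = 0 := by
      ext w
      simpa using (hB u (w, 0)).symm.trans (hv _)
    have h1 : parityInv 𝒲 u.1 = 0 := by
      refine (Module.forall_dual_apply_eq_zero_iff K _).1 fun f => ?_
      simpa using (hB u (0, f)).symm.trans (hv _)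
    have h1' : u.1 = 0 := by rw [← parityInv_parityInv 𝒲 u.1, h1, map_zero]
    rw [show u = 0 from Prod.ext h1' h2, map_zero]
  · intro v hv
    have h1 : v.1 = 0 := by
      refine (Module.forall_dual_apply_eq_zero_iff K _).1 fun f => ?_
      simpa using (hB (0, f) v).symm.trans (hv _)
    have h2 : v.2 = 0 := by
      ext w
      have := (hB (parityInv 𝒲 w, 0) v).symm.trans (hv _)
      rw [parityInv_parityInv] at this
      simpa using this
    exact Prod.ext h1 h2

end Double

section Semidirect

variable {K V M : Type*} [Field K] [AddCommGroup V] [Module K V] [AddCommGroup M] [Module K M]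

/-- The product `(x, a) (y, b) = (x y, x · b + a · y)` of the semidirect product `W = V ⋊ M`. -/
def semidirectMul (𝒱 : ℤ → Submodule K V) [DirectSum.Decomposition 𝒱]
    (ℳ : ℤ → Submodule K M) [DirectSum.Decomposition ℳ] (q : V →ₗ[K] V →ₗ[K] V)
    (lact : V →ₗ[K] M →ₗ[K] M) : (V × M) →ₗ[K] (V × M) →ₗ[K] (V × M) :=
  LinearMap.mk₂ K (fun w w' => (q w.1 w'.1, lact w.1 w'.2 + rightAct 𝒱 ℳ lact w.2 w'.1))
    (fun v v' v'' => by ext <;> simp; abel) (fun r v v' => by ext <;> simp)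
    (fun v v' v'' => by ext <;> simp; abel) (fun r v v' => by ext <;> simp)

/-- The space `Ṽ = W × W*` of the double semidirect product, with `W = V × M`. -/
abbrev Tilde (K V M : Type*) [Field K] [AddCommGroup V] [Module K V] [AddCommGroup M]
    [Module K M] : Type _ := (V × M) × Module.Dual K (V × M)

/-- The grading of `Ṽ[1]`. -/
abbrev tildeGrading (𝒱 : ℤ → Submodule K V) (ℳ : ℤ → Submodule K M) :
    ℤ → Submodule K (Tilde K V M) := shift (doubleGrading (prodGrading 𝒱 ℳ))

variable [FiniteDimensional K V] [FiniteDimensional K M]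

/-- The symplectic form `B̃` on `Ṽ[1]`. -/
abbrev tildeSymp (𝒱 : ℤ → Submodule K V) [DirectSum.Decomposition 𝒱]
    (ℳ : ℤ → Submodule K M) [DirectSum.Decomposition ℳ] :
    LinearMap.BilinForm K (Tilde K V M) := doubleSymp (prodGrading 𝒱 ℳ)

/-- The map `Q̃` on `Ṽ[1]` associated to the product `q̃` of `Ṽ`. -/
def tildeQ (𝒱 : ℤ → Submodule K V) [DirectSum.Decomposition 𝒱]
    (ℳ : ℤ → Submodule K M) [DirectSum.Decomposition ℳ] (q : V →ₗ[K] V →ₗ[K] V)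
    (lact : V →ₗ[K] M →ₗ[K] M) :
    MultilinearMap K (fun _ : Fin 2 => Tilde K V M) (Tilde K V M) :=
  shiftMap (doubleGrading (prodGrading 𝒱 ℳ))
    (bilinear (doubleMul (prodGrading 𝒱 ℳ) (semidirectMul 𝒱 ℳ q lact)))

/-- The map `C' ((x₁, a₁, g₁, h₁), …, (x_k, a_k, g_k, h_k)) = (0, C (x₁, …, x_k), 0, 0)`
on `Ṽ[1]`, where `C` is the map on `V[1]` associated to `c`. -/
def tildePre (𝒱 : ℤ → Submodule K V) [DirectSum.Decomposition 𝒱] {k : ℕ}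
    (c : MultilinearMap K (fun _ : Fin k => V) M) :
    MultilinearMap K (fun _ : Fin k => Tilde K V M) (Tilde K V M) :=
  (LinearMap.inl K (V × M) (Module.Dual K (V × M)) ∘ₗ LinearMap.inr K V M).compMultilinearMap
    ((shiftMap 𝒱 c).compLinearMap fun _ =>
      LinearMap.fst K V M ∘ₗ LinearMap.fst K (V × M) (Module.Dual K (V × M)))

/-- The map `C̃` on `Ṽ[1]` such that `Ω_C̃ = (Ω_C') ^ Cycl`. -/
def tildeC (𝒱 : ℤ → Submodule K V) [DirectSum.Decomposition 𝒱]
    (ℳ : ℤ → Submodule K M) [DirectSum.Decomposition ℳ] {k : ℕ}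
    (c : MultilinearMap K (fun _ : Fin k => V) M) :
    MultilinearMap K (fun _ : Fin k => Tilde K V M) (Tilde K V M) :=
  mapOf (tildeSymp 𝒱 ℳ) (doubleSymp_nondegenerate _)
    (cyclicSum (tildeGrading 𝒱 ℳ) (formOf (tildeSymp 𝒱 ℳ) (tildePre 𝒱 c)))

/-- The Pinczon coboundary `Λ ↦ {Ω_Q̃, Λ}` of forms of arity `k + 1` and degree `f` on `Ṽ[1]`. -/
def pinczonD (𝒱 : ℤ → Submodule K V) [DirectSum.Decomposition 𝒱]
    (ℳ : ℤ → Submodule K M) [DirectSum.Decomposition ℳ] (q : V →ₗ[K] V →ₗ[K] V)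
    (lact : V →ₗ[K] M →ₗ[K] M) (f : ℤ) {k : ℕ}
    (Λ : MultilinearMap K (fun _ : Fin (k + 1) => Tilde K V M) K) :
    MultilinearMap K (fun _ : Fin (k + 1 + 1) => Tilde K V M) K :=
  pinczonBracket (tildeGrading 𝒱 ℳ) (tildeSymp 𝒱 ℳ) (doubleSymp_nondegenerate _)
    (show 2 + k = (k + 1) + 1 by omega) (formOf (tildeSymp 𝒱 ℳ) (tildeQ 𝒱 ℳ q lact)) f Λ

end Semidirect

end Pinczon

end

noncomputable section

namespace Pinczon

/-! ### Signs -/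

/-! A multilinear map is determined by its values on words of homogeneous letters. Through `ev`,
forms become functions on words, with three operations: the signed shuffle sum `sh`, the cyclic sum
`cyc` of the signed rotations `rot`, and the bar differential `bar` of an odd product `Q` of
letters.

The Pinczon differential. Contracting with dual bases replaces the bracket with `Ω_Q̃` by
substitution of a product: up to a sign, `d_P Λ` is the cyclic sum of `Λ (Q (a, b), …)`
(`ev_pinczonD`). Multiplying the first two letters in every rotation of a cyclic word is the same as
multiplying all neighbours and then summing cyclically, so `d_P (cyc F) = ± cyc (bar F)`
(`SuppLen.cyc_mulHead_cyc`). Associativity gives `bar² = 0`. In characteristic `0` every cyclic form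
is a cyclic sum, and `d_P² = 0` follows.

Shuffles. On a cyclic form, `d_P` is `bar` plus one term that multiplies the last letter by the
first one. Commutativity makes `bar` a derivation of the shuffle product (`sh_bar`), and the
products involving the last letter cancel in pairs (`shVanish_bar_add_rot`). That `Ω_C̃` itself
vanishes on shuffles is clear when the last letter lies in `M*`. A letter of `M*` at another place
is rotated to the end, which exchanges the two parts of the other shuffled word around the last
letter; vanishing survives this exchange (`ShVanish.splitSum_eq_zero`, `sh_eq_zero_of_rot_eq`).

The chain map. Before the cyclic sum, the form of `d_Ha c` is `± bar` of the form of `c` plus a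
difference `L - rot L`, where `L` comes from the left action (`preForm_harrisonD`). The cyclic sum
kills `L - rot L`.

The Harrison side. The map `c ↦ Ω_C̃` is injective, and `c` is a Harrison cochain exactly when
`Ω_C̃` lies in `cyclicVsp`. Stability under `d_Ha`, its linearity on cochains and `d_Ha² = 0` are
therefore pulled back from `d_P`. -/

lemma sgn_add (x y : ZMod 2) : sgn (x + y) = sgn x * sgn y := by
  revert x y; decide

lemma sgn_mul_self (x : ZMod 2) : sgn x * sgn x = 1 := by
  revert x; decide

lemma sgn_sum {ι : Type*} (s : Finset ι) (f : ι → ZMod 2) :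
    sgn (∑ i ∈ s, f i) = ∏ i ∈ s, sgn (f i) := by
  classical
  induction s using Finset.induction_on with
  | empty => rfl
  | insert a s ha ih => rw [Finset.sum_insert ha, Finset.prod_insert ha, sgn_add, ih]

/-- The sign `(-1) ^ x` in a commutative ring. -/
def eps (K : Type*) [CommRing K] (x : ZMod 2) : K := (sgn x : K)

/-- Types whose elements have a parity. -/
class HasParity (L : Type*) where
  /-- The parity of a letter. -/
  par : L → ZMod 2

open HasParity (par)

/-- Induction on pairs of words, removing the first letter of one of them. -/
lemma word_induction {K L : Type*} {P : (List L → K) → List L → List L → Prop}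
    (hl : ∀ F v, P F [] v) (hr : ∀ F u, P F u [])
    (hc : ∀ F a u b v, (∀ G, P G u (b :: v)) → (∀ G, P G (a :: u) v) → P F (a :: u) (b :: v))
    (F : List L → K) (u v : List L) : P F u v := by
  induction u generalizing F v with
  | nil => exact hl F v
  | cons a u ihu =>
    induction v generalizing F with
    | nil => exact hr F _
    | cons b v ihv => exact hc F a u b v (fun G => ihu G _) ihv

section Words

variable {K L : Type*} [CommRing K]

@[simp] lemma eps_zero : eps K 0 = 1 := by simp [eps, sgn]

@[simp] lemma eps_one : eps K 1 = -1 := by simp [eps, sgn]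

lemma eps_add (x y : ZMod 2) : eps K (x + y) = eps K x * eps K y := by
  simp [eps, sgn_add]

@[simp] lemma eps_mul_self (x : ZMod 2) : eps K x * eps K x = 1 := by
  rw [eps, ← Int.cast_mul, sgn_mul_self, Int.cast_one]

/-! ### Words and signed shuffles -/

variable [HasParity L]

/-- The parity of a word. -/
def wpar (w : List L) : ZMod 2 := (w.map par).sum

@[simp] lemma wpar_nil : wpar ([] : List L) = 0 := rfl

@[simp] lemma wpar_cons (a : L) (w : List L) : wpar (a :: w) = par a + wpar w := by simp [wpar]

@[simp] lemma wpar_append (u v : List L) : wpar (u ++ v) = wpar u + wpar v := by simp [wpar]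

lemma wpar_perm {u v : List L} (h : u.Perm v) : wpar u = wpar v := (h.map _).sum_eq

/-- The sum of the values of `F` on the signed shuffles of the words `u` and `v`. -/
def sh : (List L → K) → List L → List L → K
  | F, [], v => F v
  | F, a :: u, [] => F (a :: u)
  | F, a :: u, b :: v => sh (fun w => F (a :: w)) u (b :: v) +
      eps K (par b * wpar (a :: u)) * sh (fun w => F (b :: w)) (a :: u) v
termination_by _ u v => u.length + v.length

@[simp] lemma sh_nil_left (F : List L → K) (v : List L) : sh F [] v = F v := by
  rw [sh]

@[simp] lemma sh_nil_right (F : List L → K) (u : List L) : sh F u [] = F u := by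
  cases u <;> rw [sh]

lemma sh_cons_cons (F : List L → K) (a b : L) (u v : List L) :
    sh F (a :: u) (b :: v) = sh (fun w => F (a :: w)) u (b :: v) +
      eps K (par b * wpar (a :: u)) * sh (fun w => F (b :: w)) (a :: u) v := by
  rw [sh]

lemma sh_congr {F G : List L → K} {u v : List L}
    (h : ∀ w, w.Perm (u ++ v) → F w = G w) : sh F u v = sh G u v := by
  refine word_induction (P := fun F u v => ∀ G, (∀ w, w.Perm (u ++ v) → F w = G w) →
    sh F u v = sh G u v) ?_ ?_ ?_ F u v G h
  · intro F v G h
    simpa using h v (by simp)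
  · intro F u G h
    simpa using h u (by simp)
  · intro F a u b v h1 h2 G h
    rw [sh_cons_cons, sh_cons_cons, h1 _ _ fun w hw => h (a :: w) (by simpa using hw),
      h2 _ _ fun w hw => h (b :: w) ((hw.cons b).trans List.perm_middle.symm)]

lemma sh_add (F G : List L → K) (u v : List L) :
    sh (fun w => F w + G w) u v = sh F u v + sh G u v := by
  refine word_induction (P := fun F u v => ∀ G : List L → K,
    sh (fun w => F w + G w) u v = sh F u v + sh G u v) ?_ ?_ ?_ F u v G
  · simp
  · simp
  · intro F a u b v h1 h2 G
    simp only [sh_cons_cons, h1, h2]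
    ring

lemma sh_mul_left (c : K) (F : List L → K) (u v : List L) :
    sh (fun w => c * F w) u v = c * sh F u v := by
  refine word_induction (P := fun F u v => sh (fun w => c * F w) u v = c * sh F u v) ?_ ?_ ?_ F u v
  · simp
  · simp
  · intro F a u b v h1 h2
    simp only [sh_cons_cons, h1, h2]
    ring

lemma sh_zero (u v : List L) : sh (fun _ => (0 : K)) u v = 0 := by
  simpa using sh_mul_left (0 : K) (fun _ => 0) u v

lemma sh_eq_zero {F : List L → K} {u v : List L} (h : ∀ w, w.Perm (u ++ v) → F w = 0) :
    sh F u v = 0 := (sh_congr h).trans (sh_zero u v)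

/-- All shuffles of two words have the same parity, so a factor depending only on the parity is a
constant. -/
lemma sh_mul_wpar (g : ZMod 2 → K) (F : List L → K) (u v : List L) :
    sh (fun w => g (wpar w) * F w) u v = g (wpar u + wpar v) * sh F u v := by
  rw [← sh_mul_left]
  exact sh_congr fun w hw => by rw [wpar_perm hw, wpar_append]

lemma sh_comm (F : List L → K) (u v : List L) :
    sh F u v = eps K (wpar u * wpar v) * sh F v u := by
  refine word_induction (P := fun F u v => sh F u v = eps K (wpar u * wpar v) * sh F v u)
    ?_ ?_ ?_ F u v
  · simp
  · simp
  · intro F a u b v h1 h2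
    rw [sh_cons_cons, sh_cons_cons, h1, h2]
    simp only [wpar_cons, add_mul, mul_add, eps_add]
    rw [mul_comm (par b) (par a), mul_comm (par b) (wpar u)]
    linear_combination (-eps K (wpar u * par b) * eps K (wpar u * wpar v) *
      sh (fun w => F (a :: w)) (b :: v) u) * (eps_mul_self (K := K) (par a * par b) +
        eps K (par a * par b) * eps K (par a * par b) * eps_mul_self (K := K) (par a * wpar v))
  
end Words

section Cuts

variable {K L : Type*} [CommRing K]

/-! ### Sums over the ways to cut a word -/

/-- The sum of `G x z` over the pairs of words with `x ++ z = w`. -/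
def splitSum : (List L → List L → K) → List L → K
  | G, [] => G [] []
  | G, a :: w => G [] (a :: w) + splitSum (fun x z => G (a :: x) z) w

lemma splitSum_congr {G H : List L → List L → K} {w : List L}
    (h : ∀ x z, x ++ z = w → G x z = H x z) : splitSum G w = splitSum H w := by
  induction w generalizing G H with
  | nil => exact h _ _ rfl
  | cons a w ih =>
    rw [splitSum, splitSum, h _ _ rfl, ih fun x z hx => h _ _ (congrArg (a :: ·) hx)]

lemma splitSum_add (G H : List L → List L → K) (w : List L) :
    splitSum (fun x z => G x z + H x z) w = splitSum G w + splitSum H w := by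
  induction w generalizing G H with
  | nil => rfl
  | cons a w ih => simp only [splitSum, ih]; ring

lemma splitSum_mul_left (c : K) (G : List L → List L → K) (w : List L) :
    splitSum (fun x z => c * G x z) w = c * splitSum G w := by
  induction w generalizing G with
  | nil => rfl
  | cons a w ih => simp only [splitSum, ih]; ring

/-- Both sides run over the ways to cut the word into three pieces. -/
lemma splitSum_coassoc (G : List L → List L → List L → K) (w : List L) :
    splitSum (fun x z => splitSum (fun x1 x2 => G x1 x2 z) x) w =
      splitSum (fun x y => splitSum (fun y1 y2 => G x y1 y2) y) w := by
  induction w generalizing G with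
  | nil => rfl
  | cons a w ih => simp only [splitSum, splitSum_add, ih]; ring

lemma splitSum_concat (G : List L → List L → K) (w : List L) (b : L) :
    splitSum G (w ++ [b]) = splitSum (fun x z => G x (z ++ [b])) w + G (w ++ [b]) [] := by
  induction w generalizing G with
  | nil => rfl
  | cons a w ih => simp only [splitSum, List.cons_append, ih]; ring

lemma splitSum_right {G : List L → List L → K} {w : List L}
    (h : ∀ x z, z ≠ [] → G x z = 0) : splitSum G w = G w [] := by
  induction w generalizing G with
  | nil => rfl
  | cons a w ih =>
    rw [splitSum, h _ _ (by simp), ih fun x z hz => h _ _ hz, zero_add]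

lemma splitSum_ends {G : List L → List L → K} {w : List L} (hw : w ≠ [])
    (h : ∀ x z, x ++ z = w → x ≠ [] → z ≠ [] → G x z = 0) :
    splitSum G w = G [] w + G w [] := by
  obtain ⟨a, w, rfl⟩ := List.exists_cons_of_ne_nil hw
  rw [splitSum]
  congr 1
  refine Eq.trans ?_ (splitSum_right (G := fun x z => if z = [] then G (a :: x) z else 0) ?_)
  · refine splitSum_congr fun x z hx => ?_
    split_ifs with hz
    · rfl
    · exact h _ _ (congrArg (a :: ·) hx) (by simp) hz
  · intro x z hz; simp [hz]

end Cuts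

/-! ### Shuffles of three words and shuffles around a marked letter -/

section Words

variable {K L : Type*} [CommRing K] [HasParity L]

/-- Two independent shuffles, in two different arguments, form a double sum whose order is
irrelevant. -/
lemma sh_swap (H : List L → List L → K) (p q u v : List L) :
    sh (fun r => sh (fun t => H r t) u v) p q = sh (fun t => sh (fun r => H r t) p q) u v := by
  refine word_induction (K := K) (P := fun _ u v => ∀ H : List L → List L → K,
    sh (fun r => sh (fun t => H r t) u v) p q = sh (fun t => sh (fun r => H r t) p q) u v)
    ?_ ?_ ?_ 0 u v H
  · simp
  · simp
  · intro _ a u b v h1 h2 H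
    simp only [sh_cons_cons, sh_add, sh_mul_left]
    rw [h1 0, h2 0]

/-- The first letter of a shuffle of three words comes from one of the three. In this expansion the
second and third words play visibly symmetric roles, as the induction for `sh_right_comm` needs. -/
lemma sh_triple (G : List L → K) (a b c : L) (q w z : List L) :
    sh (fun t => sh G t (c :: z)) (a :: q) (b :: w) =
      sh (fun t => sh (fun s => G (a :: s)) t (c :: z)) q (b :: w) +
      eps K (par b * wpar (a :: q)) *
        sh (fun t => sh (fun s => G (b :: s)) t (c :: z)) (a :: q) w +
      eps K (par c * (wpar (a :: q) + wpar (b :: w))) *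
        sh (fun t => sh (fun s => G (c :: s)) t z) (a :: q) (b :: w) := by
  have e (x : L) (X : List L → K) (u v : List L) :
      sh (fun t => eps K (par c * (par x + wpar t)) * X t) u v =
        eps K (par c * (par x + (wpar u + wpar v))) * sh X u v :=
    sh_mul_wpar (fun y => eps K (par c * (par x + y))) X u v
  rw [sh_cons_cons]
  simp only [sh_cons_cons G, sh_add, wpar_cons, e]
  rw [sh_cons_cons (fun t => sh (fun s => G (c :: s)) t z)]
  simp only [wpar_cons, mul_add, eps_add]
  ring

/-- Associativity and graded commutativity of the shuffle product, combined into one identity. -/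
lemma sh_right_comm (G : List L → K) (q w z : List L) :
    sh (fun t => sh G t z) q w = eps K (wpar w * wpar z) * sh (fun t => sh G t w) q z := by
  induction q generalizing G w z with
  | nil => simpa using sh_comm G w z
  | cons a q ihq =>
    induction w generalizing G z with
    | nil => simp
    | cons b w ihw =>
      induction z generalizing G with
      | nil => simp
      | cons c z ihz =>
        rw [sh_triple, sh_triple, ihq, ihw, ihz]
        simp only [wpar_cons, mul_add, add_mul, eps_add]
        rw [mul_comm (par c) (par b), mul_comm (par c) (wpar w)]
        have h1 := eps_mul_self (K := K) (par b * par c)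
        have h2 := eps_mul_self (K := K) (par b * wpar z)
        have h3 := eps_mul_self (K := K) (wpar w * par c)
        linear_combination (exp := 1) (-eps K (wpar w * wpar z) * eps K (par b * par a) *
          eps K (par b * wpar q) * eps K (wpar w * par c) *
          sh (fun t ↦ sh (fun s ↦ G (b :: s)) t w) (a :: q) (c :: z)) * 
          (h1 + eps K (par b * par c) * eps K (par b * par c) * h2)

lemma sh_splitSum (G : List L → List L → List L → K) (u v w : List L) :
    sh (fun t => splitSum (fun x z => G t x z) w) u v =
      splitSum (fun x z => sh (fun t => G t x z) u v) w := by
  induction w generalizing G with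
  | nil => rfl
  | cons a w ih => simp only [splitSum, sh_add, ih]

/-- The shuffles are sorted by the part `v1` of `v` that comes before the marked letter `y`. The
sign is that of `v1` passing `y` and `s`. -/
lemma sh_insert (F : List L → K) (p s v : List L) (y : L) :
    sh F (p ++ y :: s) v = splitSum (fun v1 v2 => eps K (wpar v1 * (par y + wpar s)) *
      sh (fun t => sh (fun r => F (t ++ y :: r)) s v2) p v1) v := by
  induction p generalizing F v with
  | nil =>
    induction v generalizing F with
    | nil => simp [splitSum]
    | cons b v ih =>
      rw [List.nil_append] at ih ⊢
      rw [sh_cons_cons, ih, splitSum, ← splitSum_mul_left]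
      simp only [sh_nil_left, wpar_nil, wpar_cons, zero_mul, eps_zero, one_mul, List.nil_append,
        List.cons_append, add_mul, eps_add, mul_assoc]
  | cons a p ihp =>
    induction v generalizing F with
    | nil => simp [splitSum]
    | cons b v ih =>
      rw [List.cons_append] at ih ⊢
      rw [sh_cons_cons, ih, ihp, splitSum, splitSum, ← splitSum_mul_left]
      simp only [sh_nil_right, sh_cons_cons _ a b, wpar_nil, wpar_cons, wpar_append,
        List.cons_append, mul_add, splitSum_add]
      rw [add_assoc]
      congr 2
      rw [splitSum_mul_left]
      rw [← splitSum_mul_left]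
      refine splitSum_congr fun x z _ => ?_
      simp only [add_mul, eps_add]
      ring

/-- The recursion of `sh` read from the right. It comes from `sh_insert` with `a` marked: either
nothing follows `a`, or the last letter is `b`. -/
lemma sh_concat_concat (F : List L → K) (u v : List L) (a b : L) :
    sh F (u ++ [a]) (v ++ [b]) =
      eps K (par a * wpar (v ++ [b])) * sh (fun w => F (w ++ [a])) u (v ++ [b]) +
      sh (fun w => F (w ++ [b])) (u ++ [a]) v := by
  rw [sh_insert, sh_insert, splitSum_concat]
  simp only [sh_nil_left, wpar_nil, add_zero]
  rw [add_comm, mul_comm (par a)]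
  simp

/-- `F` vanishes on the signed shuffles of nonempty words. -/
def ShVanish (F : List L → K) : Prop := ∀ u v : List L, u ≠ [] → v ≠ [] → sh F u v = 0

/-- If `F` vanishes on shuffles, the shuffles of a word `v` around the two sides of a letter `y`
also cancel when `v` is cut and its two parts exchanged. -/
lemma ShVanish.splitSum_eq_zero {F : List L → K} (hF : ShVanish F) (y : L) (p q w : List L)
    (hw : w ≠ []) :
    splitSum (fun w1 w2 => eps K (wpar w2 * (wpar w1 + wpar q + par y)) *
      sh (fun r => sh (fun t => F (r ++ y :: t)) q w1) p w2) w = 0 := by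
  induction hn : w.length using Nat.strong_induction_on generalizing q w with
  | _ n ih =>
  subst hn
  set H : List L → List L → List L → List L → K :=
    fun p1 w2 q1 w1 => sh (fun r => sh (fun t => F (r ++ y :: t)) q1 w1) p1 w2 with hH
  -- The hypothesis for the words `p y q'` and `w'`, sorted by the position of `y`.
  have hY (q' w' : List L) (hw' : w' ≠ []) :
      splitSum (fun w2 w3 => eps K (wpar w2 * (par y + wpar q')) * H p w2 q' w3) w' = 0 := by
    have := hF (p ++ y :: q') w' (by simp) hw'
    rwa [sh_insert] at this
  -- Cut `w` into `w1 w2 w3`, put `w2` before `y` and both `w1` and `w3` after it. The claim results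
  -- from grouping these cuts in the two possible ways.
  have key := splitSum_coassoc (fun w1 w2 w3 => eps K (wpar w2 * (par y + wpar q + wpar w1)) *
    sh (fun q' => H p w2 q' w3) q w1) w
  -- With `w2 w3` grouped, `hY` kills every nonempty `w2 w3`; what is left has all of `w` after `y`.
  have hR : splitSum (fun w1 w' => splitSum (fun w2 w3 =>
      eps K (wpar w2 * (par y + wpar q + wpar w1)) * sh (fun q' => H p w2 q' w3) q w1) w') w =
      sh (fun q' => H p [] q' []) q w := by
    rw [splitSum_right]
    · simp [splitSum]
    · intro w1 w' hw'
      refine Eq.trans ?_ ((sh_congr (u := q) (v := w1) fun q' _ => hY q' w' hw').trans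
        (sh_zero _ _))
      rw [sh_splitSum]
      refine splitSum_congr fun w2 w3 _ => ?_
      rw [sh_mul_wpar (fun x => eps K (wpar w2 * (par y + x))) (fun q' => H p w2 q' w3), add_assoc]
  have hA (w1 w2 w3 : List L) : sh (fun q' => H p w2 q' w3) q w1 =
      eps K (wpar w1 * wpar w3) * sh (fun q' => H p w2 q' w1) q w3 := by
    simp only [hH]
    rw [sh_swap (fun q' r => sh (fun t => F (r ++ y :: t)) q' w3),
      sh_swap (fun q' r => sh (fun t => F (r ++ y :: t)) q' w1), ← sh_mul_left]
    simp only [sh_right_comm _ q w1 w3]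
  -- With `w1 w2` grouped, `hA` exchanges the roles of `w1` and `w3`, and the inner sum becomes the
  -- claim for the shorter word `w1 w2`, with `q` replaced by its shuffles with `w3`.
  have hL : splitSum (fun w'' w3 => splitSum (fun w1 w2 =>
      eps K (wpar w2 * (par y + wpar q + wpar w1)) * sh (fun q' => H p w2 q' w3) q w1) w'') w =
      splitSum (fun w'' w3 => eps K (wpar w3 * wpar w'') * sh (fun q' => splitSum (fun w1 w2 =>
        eps K (wpar w2 * (wpar w1 + wpar q' + par y)) * H p w2 q' w1) w'') q w3) w := by
    refine splitSum_congr fun w'' w3 _ => ?_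
    rw [sh_splitSum, ← splitSum_mul_left]
    refine splitSum_congr fun w1 w2 h => ?_
    rw [sh_mul_wpar (fun x => eps K (wpar w2 * (wpar w1 + x + par y)))
      (fun q' => H p w2 q' w1), hA, ← h]
    simp only [wpar_append, mul_add, eps_add]
    rw [mul_comm (wpar w3) (wpar w1), mul_comm (wpar w3) (wpar w2)]
    linear_combination (-eps K (wpar w2 * wpar w1) * eps K (wpar w2 * wpar q) *
      eps K (wpar w2 * par y) * eps K (wpar w1 * wpar w3) * sh (fun q' => H p w2 q' w1) q w3) *
      eps_mul_self (K := K) (wpar w2 * wpar w3)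
  -- By induction only the two extreme cuts survive on the left. The one with `w1 w2` empty equals
  -- the right side; the one with `w3` empty is the claim.
  rw [hL, hR, splitSum_ends hw] at key
  · simpa [splitSum] using key
  · intro x z hx hx0 hz0
    rw [sh_eq_zero, mul_zero]
    intro q' _
    refine ih x.length ?_ q' x hx0 rfl
    rw [← hx, List.length_append]
    have := List.length_pos_iff.2 hz0
    omega

end Words

/-! ### The bar differential -/

section Bar

variable {K L : Type*} [CommRing K]

/-- Multiplication of the first two letters. -/
def mulHead (Q : L → L → L) (F : List L → K) : List L → K
  | a :: b :: t => F (Q a b :: t)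
  | _ => 0

@[simp] lemma mulHead_nil (Q : L → L → L) (F : List L → K) : mulHead Q F [] = 0 := rfl

@[simp] lemma mulHead_singleton (Q : L → L → L) (F : List L → K) (a : L) :
    mulHead Q F [a] = 0 := rfl

@[simp] lemma mulHead_cons (Q : L → L → L) (F : List L → K) (a b : L) (t : List L) :
    mulHead Q F (a :: b :: t) = F (Q a b :: t) := rfl

lemma mulHead_add (Q : L → L → L) (F G : List L → K) (w : List L) :
    mulHead Q (fun t => F t + G t) w = mulHead Q F w + mulHead Q G w := by
  rcases w with _ | ⟨a, _ | ⟨b, w⟩⟩ <;> simp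

lemma mulHead_mul_left (Q : L → L → L) (c : K) (F : List L → K) (w : List L) :
    mulHead Q (fun t => c * F t) w = c * mulHead Q F w := by
  rcases w with _ | ⟨a, _ | ⟨b, w⟩⟩ <;> simp

variable [HasParity L]

/-- The sum over the pairs of consecutive letters of the values of `F` on the word in which they
are multiplied, with the Koszul rule for a product of odd degree. -/
def bar (Q : L → L → L) : (List L → K) → List L → K
  | _, [] => 0
  | F, a :: w => mulHead Q F (a :: w) + eps K (par a) * bar Q (fun t => F (a :: t)) w

variable (Q : L → L → L)

@[simp] lemma bar_nil (F : List L → K) : bar Q F [] = 0 := rfl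

lemma bar_cons (F : List L → K) (a : L) (w : List L) :
    bar Q F (a :: w) = mulHead Q F (a :: w) + eps K (par a) * bar Q (fun t => F (a :: t)) w := rfl

lemma bar_add (F G : List L → K) (w : List L) :
    bar Q (fun t => F t + G t) w = bar Q F w + bar Q G w := by
  induction w generalizing F G with
  | nil => simp
  | cons a w ih => simp only [bar_cons, mulHead_add, ih]; ring

lemma bar_mul_left (c : K) (F : List L → K) (w : List L) :
    bar Q (fun t => c * F t) w = c * bar Q F w := by
  induction w generalizing F with
  | nil => simp
  | cons a w ih => simp only [bar_cons, mulHead_mul_left, ih]; ring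

/-- The product of letters has odd degree. -/
def OddMul : Prop := ∀ a b : L, par (Q a b) = par a + par b + 1

/-- The product of letters is commutative as far as `F` can see. -/
def CommOn (F : List L → K) : Prop :=
  ∀ s t a b, F (s ++ Q a b :: t) = -(eps K (par a * par b) * F (s ++ Q b a :: t))

/-- The product of letters is associative as far as `F` can see. -/
def AssocOn (F : List L → K) : Prop :=
  ∀ s t a b c, F (s ++ Q (Q a b) c :: t) = -(eps K (par a) * F (s ++ Q a (Q b c) :: t))

variable {Q}

lemma CommOn.cons {F : List L → K} (h : CommOn Q F) (a : L) : CommOn Q (fun t => F (a :: t)) :=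
  fun s => h (a :: s)

lemma CommOn.concat {F : List L → K} (h : CommOn Q F) (y : L) :
    CommOn Q (fun t => F (t ++ [y])) :=
  fun s t a b => by simpa using h s (t ++ [y]) a b

lemma AssocOn.cons {F : List L → K} (h : AssocOn Q F) (a : L) : AssocOn Q (fun t => F (a :: t)) :=
  fun s => h (a :: s)

lemma mulHead_mul_wpar (hQ : OddMul Q) (g : ZMod 2 → K) (F : List L → K) (w : List L) :
    mulHead Q (fun t => g (wpar t) * F t) w = g (wpar w + 1) * mulHead Q F w := by
  rcases w with _ | ⟨a, _ | ⟨b, w⟩⟩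
  · simp
  · simp
  · simp only [mulHead_cons, wpar_cons, hQ a b]
    congr 2
    ring

lemma bar_mul_wpar (hQ : OddMul Q) (g : ZMod 2 → K) (F : List L → K) (w : List L) :
    bar Q (fun t => g (wpar t) * F t) w = g (wpar w + 1) * bar Q F w := by
  induction w generalizing F g with
  | nil => simp
  | cons a w ih =>
    simp only [bar_cons, mulHead_mul_wpar hQ]
    have := ih (fun x => g (par a + x)) (fun t => F (a :: t))
    simp only [wpar_cons]
    rw [this, add_assoc]
    ring

/-- Disjoint products cancel in pairs because `Q` is odd; overlapping products cancel by
associativity. The induction leaves only the terms that involve the first letter. -/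
lemma bar_bar (hQ : OddMul Q) {F : List L → K} (hF : AssocOn Q F) (w : List L) :
    bar Q (bar Q F) w = 0 := by
  induction w generalizing F with
  | nil => rfl
  | cons a w ih =>
    rw [bar_cons]
    simp only [bar_cons Q F a, bar_add, bar_mul_left, ih (hF.cons a)]
    rcases w with _ | ⟨b, _ | ⟨c, w⟩⟩
    · simp
    · simp [bar_cons]
    · have h := hF [] w a b c
      simp only [List.nil_append] at h
      simp only [mulHead_cons, bar_cons, hQ a b, h, eps_add, eps_one]
      ring

/-- The part of the shuffles of `u` and `v` that start in `u`, with the first letter multiplied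
by `x`. -/
def mulLeftPart (Q : L → L → L) (x : L) (F : List L → K) (u v : List L) : K :=
  match u with
  | [] => 0
  | c :: u => sh (fun w => F (Q x c :: w)) u v

/-- The part of the shuffles of `u` and `v` that start in `v`, with the first letter multiplied
by `x`. -/
def mulRightPart (Q : L → L → L) (x : L) (F : List L → K) (u v : List L) : K :=
  match v with
  | [] => 0
  | d :: v => eps K (par d * wpar u) * sh (fun w => F (Q x d :: w)) u v

lemma sh_mulHead (F : List L → K) (x : L) (u v : List L) :
    sh (fun w => mulHead Q F (x :: w)) u v = mulLeftPart Q x F u v + mulRightPart Q x F u v := by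
  rcases u with _ | ⟨c, u⟩ <;> rcases v with _ | ⟨d, v⟩ <;>
    simp [mulLeftPart, mulRightPart, sh_cons_cons]

/-- Once the first two letters of the left word are multiplied, their product either starts the
shuffle or comes after `b`. The extra `1` in the sign is the degree of `Q`. -/
lemma mulHead_sh_left (hQ : OddMul Q) (F : List L → K) (a b : L) (u v : List L) :
    mulHead Q (fun u' => sh F u' (b :: v)) (a :: u) = mulLeftPart Q a F u (b :: v) +
      eps K (par b * (par a + wpar u + 1)) *
        mulHead Q (fun u' => sh (fun w => F (b :: w)) u' v) (a :: u) := by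
  rcases u with _ | ⟨c, u⟩
  · simp [mulLeftPart]
  · simp only [mulHead_cons, mulLeftPart, sh_cons_cons, wpar_cons, hQ a c]
    congr 3
    ring

lemma mulHead_sh_right (hQ : OddMul Q) (F : List L → K) (a b : L) (u v : List L) :
    mulHead Q (fun v' => sh F (a :: u) v') (b :: v) =
      mulHead Q (fun v' => sh (fun w => F (a :: w)) u v') (b :: v) +
      eps K ((par b + 1) * (par a + wpar u)) * mulRightPart Q b F (a :: u) v := by
  rcases v with _ | ⟨d, v⟩
  · simp [mulRightPart]
  · simp only [mulHead_cons, mulRightPart, sh_cons_cons, wpar_cons, hQ b d, ← mul_assoc,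
      ← eps_add]
    congr 3
    ring

/-- The bar differential is a derivation for the shuffle product. -/
lemma sh_bar (hQ : OddMul Q) {F : List L → K} (hF : CommOn Q F) (u v : List L) :
    sh (bar Q F) u v = bar Q (fun u' => sh F u' v) u +
      eps K (wpar u) * bar Q (fun v' => sh F u v') v := by
  refine word_induction (P := fun F u v => CommOn Q F → sh (bar Q F) u v =
    bar Q (fun u' => sh F u' v) u + eps K (wpar u) * bar Q (fun v' => sh F u v') v)
    ?_ ?_ ?_ F u v hF
  · simp
  · simp
  · intro F a u b v h1 h2 hF
    have hc : sh (fun w => F (Q a b :: w)) u v =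
        -(eps K (par a * par b) * sh (fun w => F (Q b a :: w)) u v) := by
      rw [← neg_mul, ← sh_mul_left]
      exact sh_congr fun w _ => by simpa using hF [] w a b
    have hr (x : L) (X : List L → K) (w : List L) :
        bar Q (fun t => eps K (par b * (par x + wpar t)) * X t) w =
          eps K (par b * (par x + (wpar w + 1))) * bar Q X w :=
      bar_mul_wpar hQ (fun y => eps K (par b * (par x + y))) X w
    have e1 : bar Q (fun u' => sh F u' (b :: v)) (a :: u) = mulLeftPart Q a F u (b :: v) +
        eps K (par a) * bar Q (fun u' => sh (fun t => F (a :: t)) u' (b :: v)) u +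
        eps K (par b * (par a + wpar u + 1)) *
          bar Q (fun u' => sh (fun w => F (b :: w)) u' v) (a :: u) := by
      rw [bar_cons, bar_cons, mulHead_sh_left hQ]
      simp only [sh_cons_cons F a b, bar_add, wpar_cons, hr, ← add_assoc]
      ring
    have e2 : bar Q (fun v' => sh F (a :: u) v') (b :: v) =
        bar Q (fun v' => sh (fun w => F (a :: w)) u v') (b :: v) +
        eps K ((par b + 1) * (par a + wpar u)) * mulRightPart Q b F (a :: u) v +
        eps K (par b * (par a + wpar u) + par b) *
          bar Q (fun v' => sh (fun t => F (b :: t)) (a :: u) v') v := by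
      rw [bar_cons, bar_cons, mulHead_sh_right hQ]
      simp only [sh_cons_cons F a b, bar_add, bar_mul_left, wpar_cons, eps_add]
      ring
    -- Products of a letter of one word by a letter of the other have no counterpart in the
    -- derivation formula. Here the products `Q a b` and `Q b a` are seen to cancel, which is where
    -- commutativity enters.
    have e3 : mulRightPart Q a F u (b :: v) =
        -(eps K (par b * wpar u) * (eps K (par a * par b) * mulLeftPart Q b F (a :: u) v)) := by
      rw [mulRightPart, hc, mulLeftPart, mul_neg]
    rw [sh_cons_cons]
    simp only [bar_cons Q F, sh_add, sh_mul_left, h1 _ (hF.cons a), h2 _ (hF.cons b), sh_mulHead]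
    rw [e1, e2, e3]
    simp only [mul_add, add_mul, eps_add, wpar_cons, mul_one, one_mul]
    rw [mul_comm (par a) (par b)]
    have h := eps_mul_self (K := K) (par b)
    have ha := eps_mul_self (K := K) (par a)
    have hu := eps_mul_self (K := K) (wpar u)
    linear_combination (exp := 1) (-eps K (par b * par a) * eps K (par b * wpar u) *
      mulRightPart Q b F (a :: u) v) * (ha + eps K (par a) * eps K (par a) * hu)

end Bar

/-! ### Rotations -/

section Rotation

variable {K L : Type*} [CommRing K]

/-- `F` vanishes on the words that are not of length `n`. -/
def SuppLen (n : ℕ) (F : List L → K) : Prop := ∀ w, w.length ≠ n → F w = 0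

lemma SuppLen.ext {n : ℕ} {F G : List L → K} (hF : SuppLen n F) (hG : SuppLen n G)
    (h : ∀ w, w.length = n → F w = G w) : F = G := by
  funext w
  by_cases hw : w.length = n
  · exact h w hw
  · rw [hF w hw, hG w hw]

variable [HasParity L]

/-- The signed rotation that moves the last letter of a word to the front. -/
def rot : (List L → K) →ₗ[K] (List L → K) where
  toFun F w := match w.reverse with
    | [] => F []
    | c :: w' => eps K (par c * wpar w'.reverse) * F (c :: w'.reverse)
  map_add' F G := by
    funext w
    simp only [Pi.add_apply]
    split <;> ring
  map_smul' c F := by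
    funext w
    simp only [Pi.smul_apply, smul_eq_mul, RingHom.id_apply]
    split <;> ring

@[simp] lemma rot_concat (F : List L → K) (w : List L) (c : L) :
    rot F (w ++ [c]) = eps K (par c * wpar w) * F (c :: w) := by
  simp [rot]

lemma SuppLen.rot {n : ℕ} {F : List L → K} (h : SuppLen n F) : SuppLen n (rot F) := by
  intro w hw
  induction w using List.reverseRecOn with
  | nil => exact h _ hw
  | append_singleton w c => rw [rot_concat, h _ (by simpa using hw), mul_zero]

lemma SuppLen.rot_pow {n : ℕ} {F : List L → K} (h : SuppLen n F) (i : ℕ) :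
    SuppLen n ((Pinczon.rot ^ i : Module.End K (List L → K)) F) := by
  induction i with
  | zero => exact h
  | succ i ih => rw [pow_succ']; exact ih.rot

lemma rot_pow_append (F : List L → K) (u v : List L) :
    (rot ^ v.length : Module.End K (List L → K)) F (u ++ v) =
      eps K (wpar u * wpar v) * F (v ++ u) := by
  induction v using List.reverseRecOn generalizing u with
  | nil => simp
  | append_singleton v c ih =>
    rw [List.length_append, List.length_singleton, pow_succ', ← List.append_assoc,
      Module.End.mul_apply, rot_concat, ← List.cons_append, ih]
    simp only [wpar_cons, wpar_append, wpar_nil, add_zero, mul_add, add_mul, eps_add,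
      List.append_assoc, List.singleton_append]
    rw [mul_comm (par c) (wpar u)]
    linear_combination (eps K (wpar u * par c) * eps K (wpar u * wpar v) * F (v ++ c :: u)) *
      eps_mul_self (K := K) (par c * wpar v)

/-- The restriction to a single length is what makes `rot` of finite order. -/
lemma SuppLen.rot_pow_self {n : ℕ} {F : List L → K} (h : SuppLen n F) :
    (Pinczon.rot ^ n : Module.End K (List L → K)) F = F := by
  refine (h.rot_pow n).ext h ?_
  rintro w rfl
  simpa using rot_pow_append F [] w

/-- The sum of the first `n` signed rotations. -/
def cyc (n : ℕ) : Module.End K (List L → K) := ∑ i ∈ Finset.range n, rot ^ i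

lemma cyc_apply (n : ℕ) (F : List L → K) :
    cyc n F = ∑ i ∈ Finset.range n, (rot ^ i : Module.End K (List L → K)) F := by
  simp [cyc]

lemma SuppLen.cyc {n : ℕ} {F : List L → K} (h : SuppLen n F) (m : ℕ) :
    SuppLen n (cyc m F) := by
  intro w hw
  rw [cyc_apply, Finset.sum_apply]
  exact Finset.sum_eq_zero fun i _ => h.rot_pow i w hw

lemma SuppLen.rot_cyc {n : ℕ} {F : List L → K} (h : SuppLen n F) :
    Pinczon.rot (Pinczon.cyc n F) = Pinczon.cyc n F := by
  rw [cyc_apply, map_sum]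
  have := Finset.sum_range_succ' (fun i => (Pinczon.rot ^ i : Module.End K (List L → K)) F) n
  rw [Finset.sum_range_succ, h.rot_pow_self, pow_zero, Module.End.one_apply] at this
  refine Eq.trans ?_ (add_right_cancel this).symm
  exact Finset.sum_congr rfl fun i _ => by rw [pow_succ', Module.End.mul_apply]

lemma SuppLen.cyc_rot {n : ℕ} {F : List L → K} (h : SuppLen n F) :
    Pinczon.cyc n (Pinczon.rot F) = Pinczon.cyc n F := by
  rw [← h.rot_cyc, cyc_apply, cyc_apply, map_sum]
  refine Finset.sum_congr rfl fun i _ => ?_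
  rw [← Module.End.mul_apply, ← Module.End.mul_apply, ← pow_succ, ← pow_succ']

lemma SuppLen.cyc_rot_pow {n : ℕ} {F : List L → K} (h : SuppLen n F) (i : ℕ) :
    Pinczon.cyc n ((Pinczon.rot ^ i : Module.End K (List L → K)) F) = Pinczon.cyc n F := by
  induction i with
  | zero => rfl
  | succ i ih => rw [pow_succ', Module.End.mul_apply, (h.rot_pow i).cyc_rot, ih]

lemma rot_pow_of_rot_eq {F : List L → K} (h : rot F = F) (i : ℕ) :
    (rot ^ i : Module.End K (List L → K)) F = F := by
  induction i with
  | zero => rfl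
  | succ i ih => rw [pow_succ', Module.End.mul_apply, ih, h]

/-- In characteristic `0` this writes a cyclic function as a multiple of its own cyclic sum. -/
lemma cyc_of_rot_eq {F : List L → K} (h : rot F = F) (n : ℕ) : cyc n F = (n : K) • F := by
  rw [cyc_apply, Finset.sum_congr rfl fun i _ => rot_pow_of_rot_eq h i, Finset.sum_const,
    Finset.card_range, Nat.cast_smul_eq_nsmul]

/-! ### The terms of the bar differential -/

/-- The `i`-th term of the bar differential. -/
def mulAt (Q : L → L → L) : ℕ → (List L → K) →ₗ[K] (List L → K)
  | 0 => { toFun := mulHead Q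
           map_add' := fun F G => funext fun w => mulHead_add Q F G w
           map_smul' := fun c F => funext fun w => mulHead_mul_left Q c F w }
  | i + 1 =>
    { toFun := fun F w => match w with
        | [] => 0
        | a :: w => eps K (par a) * mulAt Q i (fun t => F (a :: t)) w
      map_add' := fun F G => by
        funext w
        cases w with
        | nil => simp
        | cons a w =>
          have := congrFun (map_add (mulAt Q i) (fun t => F (a :: t)) (fun t => G (a :: t))) w
          simp only [Pi.add_apply] at this ⊢
          rw [← mul_add, ← this]
          rfl
      map_smul' := fun c F => by
        funext w
        cases w with
        | nil => simp
        | cons a w =>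
          have := congrFun (map_smul (mulAt Q i) c (fun t => F (a :: t))) w
          simp only [Pi.smul_apply, smul_eq_mul, RingHom.id_apply] at this ⊢
          rw [mul_left_comm, ← this]
          rfl }

variable {Q : L → L → L}

lemma mulAt_zero (F : List L → K) : mulAt Q 0 F = mulHead Q F := by
  rw [mulAt]; rfl

@[simp] lemma mulAt_succ_nil (i : ℕ) (F : List L → K) : mulAt Q (i + 1) F [] = 0 := by
  rw [mulAt]; rfl

@[simp] lemma mulAt_succ_cons (i : ℕ) (F : List L → K) (a : L) (w : List L) :
    mulAt Q (i + 1) F (a :: w) = eps K (par a) * mulAt Q i (fun t => F (a :: t)) w := by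
  rw [mulAt]; rfl

lemma mulAt_of_length_le (i : ℕ) (F : List L → K) (w : List L) (h : w.length ≤ i + 1) :
    mulAt Q i F w = 0 := by
  induction i generalizing F w with
  | zero =>
    rw [mulAt_zero]
    rcases w with _ | ⟨a, _ | ⟨b, w⟩⟩ <;> simp at h ⊢
  | succ i ih =>
    rcases w with _ | ⟨a, w⟩
    · simp
    · rw [mulAt_succ_cons, ih _ _ (by simpa using h), mul_zero]

lemma bar_eq_sum (F : List L → K) (w : List L) :
    bar Q F w = ∑ i ∈ Finset.range w.length, mulAt Q i F w := by
  induction w generalizing F with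
  | nil => rfl
  | cons a w ih =>
    rw [bar_cons, ih, List.length_cons, Finset.sum_range_succ', Finset.mul_sum, add_comm]
    simp [mulAt_zero]

lemma SuppLen.mulAt {n : ℕ} {F : List L → K} (h : SuppLen n F) (i : ℕ) :
    SuppLen (n + 1) (mulAt Q i F) := by
  induction i generalizing n F with
  | zero =>
    rw [mulAt_zero]
    rintro (_ | ⟨a, _ | ⟨b, w⟩⟩) hw
    · rfl
    · rfl
    · exact h _ (by simpa using hw)
  | succ i ih =>
    rintro (_ | ⟨a, w⟩) hw
    · simp
    · rw [mulAt_succ_cons]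
      rcases n with _ | n
      · have : (fun t => F (a :: t)) = 0 := funext fun t => h _ (by simp)
        rw [this, map_zero, Pi.zero_apply, mul_zero]
      · rw [ih (n := n) (fun t ht => h _ (by simpa using ht)) w (by simpa using hw), mul_zero]

lemma SuppLen.bar {n : ℕ} {F : List L → K} (h : SuppLen n F) : SuppLen (n + 1) (bar Q F) := by
  intro w hw
  rw [bar_eq_sum]
  exact Finset.sum_eq_zero fun i _ => h.mulAt i w hw

lemma SuppLen.bar_eq {n : ℕ} {F : List L → K} (h : SuppLen n F) :
    Pinczon.bar Q F = ∑ i ∈ Finset.range n, Pinczon.mulAt Q i F := by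
  refine h.bar.ext (fun w hw => ?_) fun w hw => ?_
  · rw [Finset.sum_apply]
    exact Finset.sum_eq_zero fun i _ => h.mulAt i w hw
  · rw [bar_eq_sum, hw, Finset.sum_range_succ, Finset.sum_apply, mulAt_of_length_le n _ _ hw.le,
      add_zero]

lemma mulAt_concat (i : ℕ) (F : List L → K) (w : List L) (c : L) (h : i + 2 ≤ w.length) :
    mulAt Q i F (w ++ [c]) = mulAt Q i (fun t => F (t ++ [c])) w := by
  induction i generalizing F w with
  | zero => rcases w with _ | ⟨a, _ | ⟨b, w⟩⟩ <;> simp [mulAt_zero] at h ⊢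
  | succ i ih =>
    rcases w with _ | ⟨a, w⟩
    · simp at h
    · rw [List.cons_append, mulAt_succ_cons, mulAt_succ_cons, ih _ _ (by simpa using h)]
      rfl

lemma mulAt_mul_wpar (hQ : OddMul Q) (g : ZMod 2 → K) (i : ℕ) (F : List L → K) (w : List L) :
    mulAt Q i (fun t => g (wpar t) * F t) w = g (wpar w + 1) * mulAt Q i F w := by
  induction i generalizing F w g with
  | zero => simp only [mulAt_zero, mulHead_mul_wpar hQ]
  | succ i ih =>
    rcases w with _ | ⟨a, w⟩
    · simp
    · have := ih (fun x => g (par a + x)) (fun t => F (a :: t)) w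
      simp only [mulAt_succ_cons, wpar_cons]
      rw [this, add_assoc]
      ring

/-- Rotating a word shifts the position of the product by one. The bound on `i` keeps the product
away from the junction between the last and first letters. -/
lemma SuppLen.mulAt_rot (hQ : OddMul Q) {n i : ℕ} {F : List L → K} (h : SuppLen n F)
    (hi : i + 1 < n) :
    Pinczon.mulAt Q i (Pinczon.rot F) = Pinczon.rot (Pinczon.mulAt Q (i + 1) F) := by
  refine (h.rot.mulAt i).ext (h.mulAt _).rot fun w hw => ?_
  induction w using List.reverseRecOn with
  | nil => simp at hw
  | append_singleton w c =>
    have hw' : w.length = n := by simpa using hw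
    rw [mulAt_concat _ _ _ _ (by omega)]
    simp only [rot_concat, mulAt_succ_cons]
    rw [mulAt_mul_wpar hQ (fun x => eps K (par c * x)), mul_add, eps_add, mul_one, mul_assoc]

lemma SuppLen.mulAt_rot_pow (hQ : OddMul Q) {n i j : ℕ} {F : List L → K} (h : SuppLen n F)
    (hi : i + j < n) :
    Pinczon.mulAt Q i ((Pinczon.rot ^ j : Module.End K (List L → K)) F) =
      (Pinczon.rot ^ j : Module.End K (List L → K)) (Pinczon.mulAt Q (i + j) F) := by
  induction j generalizing i with
  | zero => rfl
  | succ j ih =>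
    rw [pow_succ', Module.End.mul_apply, (h.rot_pow j).mulAt_rot hQ (by omega),
      ih (by omega), Module.End.mul_apply, show i + 1 + j = i + (j + 1) by ring]

/-- The multiplication of two letters in all the rotations of a cyclic word. -/
lemma SuppLen.cyc_mulHead_cyc (hQ : OddMul Q) {n : ℕ} {F : List L → K} (h : SuppLen n F) :
    Pinczon.cyc (n + 1) (mulHead Q (Pinczon.cyc n F)) =
      Pinczon.cyc (n + 1) (Pinczon.bar Q F) := by
  rw [← mulAt_zero, Pinczon.cyc_apply n, map_sum, map_sum, h.bar_eq, map_sum]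
  refine Finset.sum_congr rfl fun i hi => ?_
  -- The head product of the `i`-th rotation is the `i`-th rotation of the product at place `i`; the
  -- outer cyclic sum absorbs that rotation.
  rw [h.mulAt_rot_pow hQ (by simpa using hi), (h.mulAt _).cyc_rot_pow, zero_add]

/-- A cyclic word of length `n + 1` has `n + 1` pairs of neighbours: `n` inside the word, which make
up `bar`, and the last letter followed by the first, which is the term `rot (mulHead Q F)`. -/
lemma SuppLen.cyc_mulHead_of_rot_eq (hQ : OddMul Q) {n : ℕ} (hn : n ≠ 0) {F : List L → K}
    (h : SuppLen n F) (hF : Pinczon.rot F = F) :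
    Pinczon.cyc (n + 1) (mulHead Q F) =
      Pinczon.bar Q F + Pinczon.rot (mulHead Q F) := by
  obtain ⟨n, rfl⟩ := Nat.exists_eq_succ_of_ne_zero hn
  have h0 (i : ℕ) (hi : i < n + 1) : Pinczon.mulAt Q 0 F =
      (Pinczon.rot ^ i : Module.End K (List L → K)) (Pinczon.mulAt Q i F) := by
    have := h.mulAt_rot_pow hQ (i := 0) (j := i) (by omega)
    rwa [zero_add, rot_pow_of_rot_eq hF] at this
  have h1 (j : ℕ) (hj : j < n + 1) : Pinczon.mulAt Q j F =
      (Pinczon.rot ^ (n - j + 2) : Module.End K (List L → K)) (Pinczon.mulAt Q 0 F) := by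
    rw [h0 j hj, ← Module.End.mul_apply, ← pow_add, show n - j + 2 + j = n + 1 + 1 by omega,
      (h.mulAt j).rot_pow_self]
  -- Inserting one more `rot` moves the exponents to the range from `1` to `n + 2`. Exponent `1` is
  -- the wrap-around term, and the others match `h1` in reverse order.
  rw [h.bar_eq, ← mulAt_zero, ← (h.mulAt 0).rot_cyc, cyc_apply, map_sum, Finset.sum_range_succ',
    pow_zero, Module.End.one_apply]
  congr 1
  rw [← Finset.sum_range_reflect]
  refine Finset.sum_congr rfl fun j hj => ?_
  have hj' : j < n + 1 := by simpa using hj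
  rw [h1 j hj', ← Module.End.mul_apply, ← pow_succ', show n + 1 - 1 - j + 1 + 1 = n - j + 2 by omega]

end Rotation

/-! ### Shuffles and cyclic functions -/

section CyclicShuffles

variable {K L : Type*} [CommRing K] [HasParity L] {Q : L → L → L}

/-- A product of neighbours either avoids the last letter `y` or multiplies it by its neighbour `a`.
-/
lemma bar_concat_concat (F : List L → K) (w : List L) (a y : L) :
    bar Q F (w ++ [a] ++ [y]) = bar Q (fun t => F (t ++ [y])) (w ++ [a]) +
      eps K (wpar w) * F (w ++ [Q a y]) := by
  induction w generalizing F with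
  | nil => simp [bar_cons]
  | cons b w ih =>
    rw [List.cons_append, List.cons_append, bar_cons, ih, bar_cons, wpar_cons, eps_add]
    rcases w with _ | ⟨c, w⟩
    · simp
      ring
    · simp
      ring

lemma bar_congr {F G : List L → K} (h : ∀ w, w ≠ [] → F w = G w) (w : List L) :
    bar Q F w = bar Q G w := by
  rcases w with _ | ⟨a, w⟩
  · rfl
  · rw [bar_cons, bar_cons, funext fun t => h (a :: t) (by simp)]
    rcases w with _ | ⟨b, w⟩
    · rfl
    · rw [mulHead_cons, mulHead_cons, h _ (by simp)]

lemma bar_eq_zero {F : List L → K} (h : ∀ w, w ≠ [] → F w = 0) (w : List L) : bar Q F w = 0 := by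
  rw [bar_congr (G := fun _ => 0 * 0) (by simpa using h), bar_mul_left, zero_mul]

lemma rot_eq_concat {F : List L → K} (h : rot F = F) (w : List L) (c : L) :
    F (w ++ [c]) = eps K (par c * wpar w) * F (c :: w) := by
  rw [← rot_concat, h]

/-- The bar differential followed by one rotation preserves the cyclic functions such that
`w ↦ F (w ++ [y])` vanishes on shuffles for all `y`. -/
lemma shVanish_bar_add_rot (hQ : OddMul Q) {F : List L → K} (hc : CommOn Q F) (hr : rot F = F)
    (hF : ∀ y, ShVanish fun w => F (w ++ [y])) (y : L) :
    ShVanish fun w => bar Q F (w ++ [y]) + rot (mulHead Q F) (w ++ [y]) := by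
  intro u v hu hv
  set P : L → List L → K := fun c w => F (w ++ [c]) with hP
  have hP0 (c : L) (u v : List L) (hu : u ≠ []) (hv : v ≠ []) : sh (P c) u v = 0 := hF c u v hu hv
  have hcomm (c : L) (w : List L) : P (Q c y) w = -(eps K (par c * par y) * P (Q y c) w) := by
    simpa [hP] using hc w [] c y
  -- The part of `bar` in which `y` is multiplied by the letter before it.
  set last : List L → K := fun w => bar Q F (w ++ [y]) - bar Q (P y) w with hlast
  have e1 (w : List L) (a : L) : last (w ++ [a]) = eps K (wpar w) * P (Q a y) w := by
    simp only [hlast]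
    rw [bar_concat_concat, add_sub_cancel_left]
  have e2 (a : L) (w : List L) : rot (mulHead Q F) (a :: w ++ [y]) =
      eps K (par y * par a + (par a + 1) * wpar w) * P (Q y a) w := by
    simp only [hP]
    rw [rot_concat, rot_eq_concat hr, mulHead_cons, hQ y a]
    simp only [wpar_cons, mul_add, add_mul, eps_add, one_mul]
    linear_combination (-eps K (par y * par a) * eps K (par y * wpar w) * F (Q y a :: w)) *
      (eps_mul_self (K := K) (wpar w) + eps K (wpar w) * eps K (wpar w) *
        eps_mul_self (K := K) (par a * wpar w))
  have hsplit : sh (fun w => bar Q F (w ++ [y]) + rot (mulHead Q F) (w ++ [y])) u v =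
      sh last u v + sh (fun w => rot (mulHead Q F) (w ++ [y])) u v := by
    -- The products avoiding `y` give a derivation of the shuffle product, and each resulting term
    -- is again a shuffle of nonempty words.
    have h0 : sh (bar Q (P y)) u v = 0 := by
      rw [sh_bar hQ (hc.concat y), bar_eq_zero fun w hw => hP0 y w v hw hv,
        bar_eq_zero fun w hw => hP0 y u w hu hw, mul_zero, add_zero]
    rw [← add_zero (sh last u v + _), ← h0, ← sh_add, ← sh_add]
    refine sh_congr fun w _ => ?_
    simp only [hlast]
    ring
  obtain ⟨a, u', rfl⟩ := List.exists_cons_of_ne_nil hu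
  obtain ⟨b, v', rfl⟩ := List.exists_cons_of_ne_nil hv
  obtain ⟨u₁, a₁, hu₁⟩ : ∃ u₁ a₁, a :: u' = u₁ ++ [a₁] :=
    ⟨_, _, (List.dropLast_append_getLast hu).symm⟩
  obtain ⟨v₁, b₁, hv₁⟩ : ∃ v₁ b₁, b :: v' = v₁ ++ [b₁] :=
    ⟨_, _, (List.dropLast_append_getLast hv).symm⟩
  -- In `last` the neighbour of `y` is the last letter of the shuffle, so the shuffle is expanded
  -- from the right. In the rotated term it is the first letter, so `hrot` expands from the left.
  have hl : sh last (a :: u') (b :: v') =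
      eps K (par a₁ * wpar (b :: v') + wpar u₁ + wpar (b :: v')) *
        sh (P (Q a₁ y)) u₁ (b :: v') +
      eps K (wpar (a :: u') + wpar v₁) * sh (P (Q b₁ y)) (a :: u') v₁ := by
    rw [hu₁, hv₁, sh_concat_concat]
    simp only [e1, sh_mul_wpar (eps K)]
    simp only [eps_add]
    ring
  have hrot : sh (fun w => rot (mulHead Q F) (w ++ [y])) (a :: u') (b :: v') =
      eps K (par y * par a + (par a + 1) * (wpar u' + wpar (b :: v'))) *
        sh (P (Q y a)) u' (b :: v') +
      eps K (par b * wpar (a :: u') + par y * par b +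
        (par b + 1) * (wpar (a :: u') + wpar v')) * sh (P (Q y b)) (a :: u') v' := by
    rw [sh_cons_cons]
    simp only [e2]
    rw [sh_mul_wpar (fun x => eps K (par y * par a + (par a + 1) * x)),
      sh_mul_wpar (fun x => eps K (par y * par b + (par b + 1) * x))]
    simp only [eps_add]
    ring
  -- If `u` has at least two letters, both terms are shuffles of nonempty words and vanish. If `u`
  -- is one letter, both shuffles reduce to `v` and cancel by commutativity of `Q`.
  have hU : eps K (par a₁ * wpar (b :: v') + wpar u₁ + wpar (b :: v')) *
        sh (P (Q a₁ y)) u₁ (b :: v') +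
      eps K (par y * par a + (par a + 1) * (wpar u' + wpar (b :: v'))) *
        sh (P (Q y a)) u' (b :: v') = 0 := by
    rcases List.eq_nil_or_concat' u' with rfl | ⟨u₂, a₂, rfl⟩
    · obtain ⟨rfl, rfl⟩ : u₁ = [] ∧ a₁ = a := by
        cases u₁ <;> simp_all
      rw [sh_nil_left, sh_nil_left, hcomm]
      simp only [wpar_nil, add_zero, zero_add, add_mul, one_mul, eps_add, mul_comm (par y)]
      ring
    · obtain ⟨rfl, rfl⟩ : u₁ = a :: u₂ ∧ a₁ = a₂ := by
        rw [← List.cons_append] at hu₁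
        simpa [eq_comm] using List.append_inj' hu₁ rfl
      rw [hP0 _ _ _ (by simp) hv, hP0 _ _ _ (by simp) hv]
      ring
  have hV : eps K (wpar (a :: u') + wpar v₁) * sh (P (Q b₁ y)) (a :: u') v₁ +
      eps K (par b * wpar (a :: u') + par y * par b +
        (par b + 1) * (wpar (a :: u') + wpar v')) * sh (P (Q y b)) (a :: u') v' = 0 := by
    rcases List.eq_nil_or_concat' v' with rfl | ⟨v₂, b₂, rfl⟩
    · obtain ⟨rfl, rfl⟩ : v₁ = [] ∧ b₁ = b := by
        cases v₁ <;> simp_all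
      rw [sh_nil_right, sh_nil_right, hcomm]
      generalize wpar (a :: u') = x
      simp only [wpar_nil, add_zero, add_mul, one_mul, eps_add, mul_comm (par y)]
      linear_combination (eps K (par b₁ * par y) * eps K x * P (Q y b₁) (a :: u')) *
        eps_mul_self (K := K) (par b₁ * x)
    · obtain ⟨rfl, rfl⟩ : v₁ = b :: v₂ ∧ b₁ = b₂ := by
        rw [← List.cons_append] at hv₁
        simpa [eq_comm] using List.append_inj' hv₁ rfl
      rw [hP0 _ _ _ hu (by simp), hP0 _ _ _ hu (by simp)]
      ring
  rw [hsplit, hl, hrot]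
  linear_combination hU + hV

/-- Cyclic functions that vanish on shuffles of the letters before a given last letter `a` also do
so for the last letters `y` such that `a` occurs in one of the shuffled words. -/
lemma sh_eq_zero_of_rot_eq {F : List L → K} (hr : rot F = F) {a : L}
    (ha : ShVanish fun w => F (w ++ [a])) (u₁ u₂ v : List L) (hv : v ≠ []) (y : L) :
    sh (fun w => F (w ++ [y])) (u₁ ++ a :: u₂) v = 0 := by
  have key := ha.splitSum_eq_zero y u₂ u₁ v hv
  -- The sign inserted here compares the two expansions. It depends on `v` but not on its cut into
  -- `v1` and `v2`, so it can be taken out of the sum.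
  rw [sh_insert, ← mul_zero (eps K (wpar u₁ * wpar u₂ + wpar u₁ * par y + par a * wpar u₂ +
    par a * wpar v + par a * par y + par y * wpar v)), ← key, ← splitSum_mul_left]
  refine splitSum_congr fun v1 v2 h => ?_
  -- Rotating `a` to the end exchanges what surrounds it: `v1`, which was before `a`, is now after
  -- `y`, and `v2` is before `y`. This is the configuration of `key`.
  have hF (t r : List L) : F (t ++ a :: r ++ [y]) =
      eps K ((wpar t + par a) * (wpar r + par y)) * F (r ++ y :: t ++ [a]) := by
    have := rot_pow_append F (t ++ [a]) (r ++ [y])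
    rw [rot_pow_of_rot_eq hr] at this
    simpa using this
  simp only [hF]
  have e (t : List L) : sh (fun r => eps K ((wpar t + par a) * (wpar r + par y)) *
      F (r ++ y :: t ++ [a])) u₂ v2 = eps K ((wpar t + par a) * (wpar u₂ + wpar v2 + par y)) *
        sh (fun r => F (r ++ y :: t ++ [a])) u₂ v2 :=
    sh_mul_wpar (fun x => eps K ((wpar t + par a) * (x + par y))) _ _ _
  simp only [e]
  rw [sh_mul_wpar (fun x => eps K ((x + par a) * (wpar u₂ + wpar v2 + par y)))
    (fun t => sh (fun r => F (r ++ y :: t ++ [a])) u₂ v2),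
    sh_swap (fun t r => F (r ++ y :: t ++ [a])), ← mul_assoc, ← mul_assoc, ← eps_add, ← eps_add,
    ← h, wpar_append]
  congr 2
  generalize wpar v1 = x1
  generalize wpar v2 = x2
  generalize wpar u₁ = x3
  generalize wpar u₂ = x4
  generalize par a = x5
  generalize par y = x6
  revert x1 x2 x3 x4 x5 x6
  decide

end CyclicShuffles

/-! ### Multilinear maps as functions on words of homogeneous letters -/

section Letters

variable {K E A : Type*} [Field K] [AddCommGroup E] [Module K E] [AddCommGroup A] [Module K A]

/-- Arguments are freed one at a time: `s` is the set of indices whose arguments are no longer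
required to lie in `S`. -/
lemma multilinear_eq_zero_of_span {k : ℕ} {f : MultilinearMap K (fun _ : Fin k => E) A} {S : Set E}
    (hS : Submodule.span K S = ⊤) (h : ∀ x : Fin k → E, (∀ i, x i ∈ S) → f x = 0) : f = 0 := by
  have key (s : Finset (Fin k)) : ∀ x : Fin k → E, (∀ i, i ∉ s → x i ∈ S) → f x = 0 := by
    induction s using Finset.induction_on with
    | empty => exact fun x hx => h x fun i => hx i (Finset.notMem_empty i)
    | insert j s hj ih =>
      intro x hx
      have : Submodule.span K S ≤ LinearMap.ker (f.toLinearMap x j) := by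
        refine Submodule.span_le.2 fun y hy => ?_
        refine ih _ fun i hi => ?_
        by_cases hij : i = j
        · subst hij; simpa using hy
        · rw [Function.update_of_ne hij]
          exact hx i (by simp [hij, hi])
      rw [hS] at this
      simpa using this (Submodule.mem_top (x := x j))
  ext x
  exact key Finset.univ x fun i hi => absurd (Finset.mem_univ i) hi

/-- Homogeneous elements. -/
structure Letter (ℰ : ℤ → Submodule K E) where
  /-- The degree. -/
  deg : ℤ
  /-- The element. -/
  val : E
  mem : val ∈ ℰ deg

variable {ℰ : ℤ → Submodule K E}

instance : HasParity (Letter ℰ) := ⟨fun a => (a.deg : ZMod 2)⟩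

lemma par_def (a : Letter ℰ) : par a = (a.deg : ZMod 2) := rfl

/-- The value of a `k`-linear map on a word of length `k`, and `0` on the other words. -/
def ev {k : ℕ} (f : MultilinearMap K (fun _ : Fin k => E) A) (w : List (Letter ℰ)) : A :=
  if h : w.length = k then f fun i => (w.get (i.cast h.symm)).val else 0

lemma ev_ofFn {k : ℕ} (f : MultilinearMap K (fun _ : Fin k => E) A) (X : Fin k → Letter ℰ) :
    ev f (List.ofFn X) = f fun i => (X i).val := by
  simp [ev]

lemma ev_of_length_ne {k : ℕ} (f : MultilinearMap K (fun _ : Fin k => E) A) {w : List (Letter ℰ)}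
    (h : w.length ≠ k) : ev f w = 0 := by
  simp [ev, h]

lemma suppLen_ev {k : ℕ} (f : MultilinearMap K (fun _ : Fin k => E) K) :
    SuppLen k (ev f : List (Letter ℰ) → K) := fun _ h => ev_of_length_ne f h

lemma exists_ofFn_eq {L : Type*} {k : ℕ} {w : List L} (h : w.length = k) :
    ∃ X : Fin k → L, List.ofFn X = w := by
  subst h
  exact ⟨w.get, List.ofFn_get w⟩

lemma ev_cons {k : ℕ} (f : MultilinearMap K (fun _ : Fin (k + 1) => E) A) (a : Letter ℰ)
    (w : List (Letter ℰ)) : ev f (a :: w) = ev (f.curryLeft a.val) w := by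
  by_cases h : w.length = k
  · obtain ⟨X, rfl⟩ := exists_ofFn_eq h
    rw [← List.ofFn_cons, ev_ofFn, ev_ofFn, MultilinearMap.curryLeft_apply]
    congr 1
    ext i
    cases i using Fin.cases <;> simp
  · rw [ev_of_length_ne _ h, ev_of_length_ne _ (by simpa using h)]

lemma ofFn_snoc {L : Type*} {k : ℕ} (X : Fin k → L) (a : L) :
    List.ofFn (Fin.snoc X a : Fin (k + 1) → L) = List.ofFn X ++ [a] := by
  rw [List.ofFn_succ', List.concat_eq_append]
  simp

lemma ev_concat {k : ℕ} (f : MultilinearMap K (fun _ : Fin (k + 1) => E) A) (a : Letter ℰ)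
    (w : List (Letter ℰ)) :
    ev f (w ++ [a]) = ev (f.curryRight) w a.val := by
  by_cases h : w.length = k
  · obtain ⟨X, rfl⟩ := exists_ofFn_eq h
    rw [← ofFn_snoc, ev_ofFn, ev_ofFn, MultilinearMap.curryRight_apply]
    congr 1
    ext i
    cases i using Fin.lastCases <;> simp
  · rw [ev_of_length_ne _ h, ev_of_length_ne _ (by simpa using h), LinearMap.zero_apply]

lemma ev_add {k : ℕ} (f g : MultilinearMap K (fun _ : Fin k => E) A) (w : List (Letter ℰ)) :
    ev (f + g) w = ev f w + ev g w := by
  unfold ev; split_ifs <;> simp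

lemma ev_smul {k : ℕ} (r : K) (f : MultilinearMap K (fun _ : Fin k => E) A)
    (w : List (Letter ℰ)) : ev (r • f) w = r • ev f w := by
  unfold ev; split_ifs <;> simp

lemma ev_zsmul {k : ℕ} (r : ℤ) (f : MultilinearMap K (fun _ : Fin k => E) A)
    (w : List (Letter ℰ)) : ev (r • f) w = r • ev f w := by
  unfold ev; split_ifs <;> simp

lemma ev_sum {ι : Type*} (s : Finset ι) {k : ℕ}
    (f : ι → MultilinearMap K (fun _ : Fin k => E) A) (w : List (Letter ℰ)) :
    ev (∑ i ∈ s, f i) w = ∑ i ∈ s, ev (f i) w := by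
  unfold ev; split_ifs <;> simp

lemma ev_comp {B : Type*} [AddCommGroup B] [Module K B] {k : ℕ} (h : A →ₗ[K] B)
    (f : MultilinearMap K (fun _ : Fin k => E) A) (w : List (Letter ℰ)) :
    ev (h.compMultilinearMap f) w = h (ev f w) := by
  unfold ev; split_ifs <;> simp

/-- Multilinear maps only see letters through their values, and linearly so. -/
lemma ev_replace {k : ℕ} (f : MultilinearMap K (fun _ : Fin k => E) A)
    {a b : Letter ℰ} (c : K) (hab : a.val = c • b.val) (s t : List (Letter ℰ)) :
    ev f (s ++ a :: t) = c • ev f (s ++ b :: t) := by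
  induction s generalizing k with
  | nil =>
    rcases k with _ | k
    · rw [ev_of_length_ne _ (by simp), ev_of_length_ne _ (by simp), smul_zero]
    · rw [List.nil_append, List.nil_append, ev_cons, ev_cons, hab, map_smul, ev_smul]
  | cons x s ih =>
    rcases k with _ | k
    · rw [ev_of_length_ne _ (by simp), ev_of_length_ne _ (by simp), smul_zero]
    · rw [List.cons_append, List.cons_append, ev_cons, ev_cons, ih]

variable [DirectSum.Decomposition ℰ]

lemma span_homogeneous : Submodule.span K {x : E | ∃ n, x ∈ ℰ n} = ⊤ := by
  refine eq_top_iff.2 fun x _ => ?_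
  induction x using DirectSum.Decomposition.inductionOn ℰ with
  | zero => exact Submodule.zero_mem _
  | @homogeneous i m => exact Submodule.subset_span ⟨i, m.2⟩
  | add m m' hm hm' => exact Submodule.add_mem _ (hm trivial) (hm' trivial)

/-- Homogeneous elements span, so identities of multilinear maps may be checked on words of letters.
-/
lemma eq_zero_of_ev {k : ℕ} {f : MultilinearMap K (fun _ : Fin k => E) A}
    (h : ∀ w : List (Letter ℰ), ev f w = 0) : f = 0 := by
  refine multilinear_eq_zero_of_span (span_homogeneous (ℰ := ℰ)) fun x hx => ?_
  choose d hd using hx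
  simpa [ev_ofFn] using h (List.ofFn fun i => ⟨d i, x i, hd i⟩)

lemma ev_injective {k : ℕ} {f g : MultilinearMap K (fun _ : Fin k => E) A}
    (h : ∀ w : List (Letter ℰ), ev f w = ev g w) : f = g := by
  rw [← sub_eq_zero]
  refine eq_zero_of_ev (ℰ := ℰ) fun w => ?_
  rw [sub_eq_add_neg, ← neg_one_smul K g, ev_add, ev_smul, h]
  simp

/-- On homogeneous arguments the parity projections kill every summand except the one indexed by the
actual parities. -/
lemma signed_apply {k : ℕ} (s : (Fin k → ZMod 2) → ℤ)
    (f : MultilinearMap K (fun _ : Fin k => E) A) (X : Fin k → Letter ℰ) :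
    signed ℰ s f (fun i => (X i).val) = s (fun i => par (X i)) • f fun i => (X i).val := by
  rw [signed, _root_.sum_apply, Finset.sum_eq_single (fun i => par (X i))]
  · simp only [_root_.smul_apply, MultilinearMap.compLinearMap_apply]
    congr 2
    funext i
    rw [parityProj_of_mem _ _ (X i).mem, if_pos (par_def _).symm]
  · intro d _ hd
    obtain ⟨i, hi⟩ := Function.ne_iff.1 hd
    simp only [_root_.smul_apply, MultilinearMap.compLinearMap_apply]
    rw [f.map_coord_zero i, smul_zero]
    rw [parityProj_of_mem _ _ (X i).mem, if_neg (by rw [← par_def]; exact hi.symm)]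
  · simp

lemma permAct_apply {k : ℕ} (σ : Equiv.Perm (Fin k))
    (f : MultilinearMap K (fun _ : Fin k => E) A) (X : Fin k → Letter ℰ) :
    permAct ℰ σ f (fun i => (X i).val) =
      koszulSign (fun i => par (X i)) σ • f fun i => (X (σ.symm i)).val := by
  rw [permAct, signed_apply]
  rfl

lemma permAct_comp {B : Type*} [AddCommGroup B] [Module K B] {k : ℕ} (σ : Equiv.Perm (Fin k))
    (h : A →ₗ[K] B) (f : MultilinearMap K (fun _ : Fin k => E) A) :
    permAct ℰ σ (h.compMultilinearMap f) = h.compMultilinearMap (permAct ℰ σ f) := by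
  ext x
  simp [permAct, signed]

end Letters

/-! ### Rotations of multilinear forms -/

section RotationForms

variable {K E : Type*} [Field K] [AddCommGroup E] [Module K E] {ℰ : ℤ → Submodule K E}

lemma sgn_prod_prod {ι κ : Type*} (s : Finset ι) (t : Finset κ) (f : ι → ZMod 2)
    (g : κ → ZMod 2) : ∏ i ∈ s, ∏ j ∈ t, sgn (f i * g j) =
      sgn ((∑ i ∈ s, f i) * ∑ j ∈ t, g j) := by
  simp only [← sgn_sum, Finset.sum_mul_sum]

lemma wpar_ofFn {L : Type*} [HasParity L] {k : ℕ} (X : Fin k → L) :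
    wpar (List.ofFn X) = ∑ i, par (X i) := by
  simp [wpar, List.map_ofFn, List.sum_ofFn]

/-- The inversions of a translation by `a` are the pairs with one index among the first `k + 1 - a`
and the other among the last `a`: one block passes the other. -/
lemma koszulSign_addRight {k : ℕ} (d : Fin (k + 1) → ZMod 2) (a : Fin (k + 1)) :
    koszulSign d (Equiv.addRight a) =
      sgn ((∑ i : Fin (k + 1), if (i : ℕ) < k + 1 - a then d i else 0) *
        ∑ j : Fin (k + 1), if (j : ℕ) < k + 1 - a then 0 else d j) := by
  rw [← sgn_prod_prod, koszulSign]
  refine Finset.prod_congr rfl fun i _ => Finset.prod_congr rfl fun j _ => ?_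
  have h : (i < j ∧ Equiv.addRight a j < Equiv.addRight a i) ↔
      ((i : ℕ) < k + 1 - a ∧ ¬ (j : ℕ) < k + 1 - a) := by
    simp only [Equiv.coe_addRight, Fin.lt_def, Fin.val_add]
    have hi := i.2
    have hj := j.2
    have ha := a.2
    rcases lt_or_ge ((i : ℕ) + a) (k + 1) with h1 | h1 <;>
      rcases lt_or_ge ((j : ℕ) + a) (k + 1) with h2 | h2
    · rw [Nat.mod_eq_of_lt h1, Nat.mod_eq_of_lt h2]; omega
    · rw [Nat.mod_eq_of_lt h1, Nat.mod_eq_sub_mod h2, Nat.mod_eq_of_lt (by omega)]; omega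
    · rw [Nat.mod_eq_sub_mod h1, Nat.mod_eq_of_lt h2, Nat.mod_eq_of_lt (by omega)]; omega
    · rw [Nat.mod_eq_sub_mod h1, Nat.mod_eq_sub_mod h2, Nat.mod_eq_of_lt (by omega),
        Nat.mod_eq_of_lt (by omega)]; omega
  simp only [h]
  split_ifs with h1 h2 h3 h4 <;> simp_all [sgn]

variable [DirectSum.Decomposition ℰ]

lemma wpar_take_ofFn {L : Type*} [HasParity L] {k : ℕ} (X : Fin k → L) (m : ℕ) :
    wpar ((List.ofFn X).take m) = ∑ i : Fin k, if (i : ℕ) < m then par (X i) else 0 := by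
  induction k generalizing m with
  | zero => simp
  | succ k ih =>
    rcases m with _ | m
    · simp
    · rw [List.ofFn_succ, List.take_succ_cons, wpar_cons, ih, Fin.sum_univ_succ]
      simp

lemma wpar_drop_ofFn {L : Type*} [HasParity L] {k : ℕ} (X : Fin k → L) (m : ℕ) :
    wpar ((List.ofFn X).drop m) = ∑ i : Fin k, if (i : ℕ) < m then 0 else par (X i) := by
  induction k generalizing m with
  | zero => simp
  | succ k ih =>
    rcases m with _ | m
    · simp [wpar_ofFn, Fin.sum_univ_succ]
    · rw [List.ofFn_succ, List.drop_succ_cons, ih, Fin.sum_univ_succ]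
      simp

lemma ev_permAct_addRight {k : ℕ} (f : MultilinearMap K (fun _ : Fin (k + 1) => E) K)
    (a : Fin (k + 1)) :
    (ev (permAct ℰ (Equiv.addRight a) f) : List (Letter ℰ) → K) =
      (rot ^ (a : ℕ) : Module.End K (List (Letter ℰ) → K)) (ev f) := by
  refine (suppLen_ev _).ext ((suppLen_ev f).rot_pow _) fun w hw => ?_
  obtain ⟨X, rfl⟩ := exists_ofFn_eq hw
  have e := List.take_append_drop (k + 1 - a) (List.ofFn X)
  have hl : ((List.ofFn X).drop (k + 1 - a)).length = a := by
    simp only [List.length_drop, List.length_ofFn]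
    have := a.2
    omega
  have h := rot_pow_append (ev f) ((List.ofFn X).take (k + 1 - a))
    ((List.ofFn X).drop (k + 1 - a))
  rw [hl, e] at h
  rw [h, ev_ofFn, permAct_apply, koszulSign_addRight, wpar_take_ofFn, wpar_drop_ofFn,
    zsmul_eq_mul, ← eps]
  congr 1
  have h2 : List.drop (k + 1 - a) (List.ofFn X) ++ List.take (k + 1 - a) (List.ofFn X) =
      List.ofFn fun i => X ((Equiv.addRight a).symm i) := by
    rw [← List.rotate_eq_drop_append_take (by simp)]
    refine List.ext_getElem (by simp) fun i h1 h2 => ?_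
    rw [List.getElem_rotate, List.getElem_ofFn, List.getElem_ofFn]
    congr 1
    simp only [List.length_ofFn, Equiv.addRight_symm, Equiv.coe_addRight]
    rw [Fin.ext_iff, ← sub_eq_add_neg, Fin.sub_def]
    simp only
    congr 1
    omega
  rw [h2, ev_ofFn]

lemma ev_cyclicSum {k : ℕ} (f : MultilinearMap K (fun _ : Fin (k + 1) => E) K) :
    (ev (cyclicSum ℰ f) : List (Letter ℰ) → K) = cyc (k + 1) (ev f) := by
  funext w
  rw [cyclicSum, ev_sum, cyc_apply, Finset.sum_apply, Finset.sum_range]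
  exact Finset.sum_congr rfl fun a _ => congrFun (ev_permAct_addRight f a) w

lemma ev_permAct_finRotate {k : ℕ} (f : MultilinearMap K (fun _ : Fin (k + 1) => E) K) :
    (ev (permAct ℰ (finRotate (k + 1)) f) : List (Letter ℰ) → K) = rot (ev f) := by
  have h : finRotate (k + 1) = Equiv.addRight 1 := by
    ext i; simp
  rw [h, ev_permAct_addRight]
  rcases k with _ | k
  -- In `Fin 1` one has `1 = 0`, so the left side is the zeroth power of `rot`; on one-letter words
  -- `rot` is the identity as well.
  · simp only [Fin.val_eq_zero, pow_zero, Module.End.one_apply]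
    refine (suppLen_ev _).ext (suppLen_ev f).rot fun w hw => ?_
    obtain ⟨a, rfl⟩ := List.length_eq_one_iff.1 hw
    simpa using (rot_concat (ev f) [] a).symm
  · simp

lemma isCyclic_iff {k : ℕ} (f : MultilinearMap K (fun _ : Fin (k + 1) => E) K) :
    IsCyclic ℰ f ↔ rot (ev f : List (Letter ℰ) → K) = ev f := by
  rw [← ev_permAct_finRotate]
  exact ⟨fun h => by rw [h], fun h => ev_injective (ℰ := ℰ) (congrFun h)⟩

end RotationForms

/-! ### Shuffle permutations and shuffles of words -/

section ShufflePerms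

/-- The permutation that sends `a` to `0` and permutes the other indices according to `τ`. -/
def insertPerm {k : ℕ} (a : Fin (k + 1)) (τ : Equiv.Perm (Fin k)) : Equiv.Perm (Fin (k + 1)) :=
  (finSuccEquiv' a).trans (τ.optionCongr.trans (finSuccEquiv' 0).symm)

variable {k : ℕ}

@[simp] lemma insertPerm_self (a : Fin (k + 1)) (τ : Equiv.Perm (Fin k)) :
    insertPerm a τ a = 0 := by
  simp [insertPerm]

@[simp] lemma insertPerm_succAbove (a : Fin (k + 1)) (τ : Equiv.Perm (Fin k)) (i : Fin k) :
    insertPerm a τ (a.succAbove i) = (τ i).succ := by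
  simp [insertPerm]

@[simp] lemma insertPerm_symm_zero (a : Fin (k + 1)) (τ : Equiv.Perm (Fin k)) :
    (insertPerm a τ).symm 0 = a := by
  rw [Equiv.symm_apply_eq, insertPerm_self]

@[simp] lemma insertPerm_symm_succ (a : Fin (k + 1)) (τ : Equiv.Perm (Fin k)) (i : Fin k) :
    (insertPerm a τ).symm i.succ = a.succAbove (τ.symm i) := by
  rw [Equiv.symm_apply_eq, insertPerm_succAbove, Equiv.apply_symm_apply]

lemma insertPerm_bijective : Function.Bijective
    fun x : Fin (k + 1) × Equiv.Perm (Fin k) => insertPerm x.1 x.2 := by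
  rw [Fintype.bijective_iff_injective_and_card]
  refine ⟨?_, by simp [Fintype.card_perm, Nat.factorial_succ]⟩
  rintro ⟨a, τ⟩ ⟨b, υ⟩ h
  simp only at h
  obtain rfl : a = b := by rw [← insertPerm_symm_zero a τ, h, insertPerm_symm_zero]
  refine Prod.ext rfl (Equiv.ext fun i => ?_)
  refine Fin.succ_injective _ ?_
  rw [← insertPerm_succAbove a, ← insertPerm_succAbove a, h]

lemma ofFn_insertPerm_symm {L : Type*} (X : Fin (k + 1) → L) (a : Fin (k + 1)) (τ : Equiv.Perm (Fin k)) :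
    (List.ofFn fun i => X ((insertPerm a τ).symm i)) =
      X a :: List.ofFn fun i => X (a.succAbove (τ.symm i)) := by
  rw [List.ofFn_succ]
  simp

lemma mem_shuffles {p : ℕ} {σ : Equiv.Perm (Fin k)} : σ ∈ shuffles p k ↔
    ∀ i j : Fin k, i < j → ((j : ℕ) < p ∨ p ≤ (i : ℕ)) → σ i < σ j := by
  simp [shuffles]

lemma insertPerm_zero_mem_shuffles {p : ℕ} {τ : Equiv.Perm (Fin k)} :
    insertPerm 0 τ ∈ shuffles (p + 1) (k + 1) ↔ τ ∈ shuffles p k := by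
  have h (i : Fin k) : insertPerm 0 τ i.succ = (τ i).succ := insertPerm_succAbove 0 τ i
  simp only [mem_shuffles]
  constructor
  · intro H i j hij hp
    have := H i.succ j.succ (by simpa using hij) (by simpa using hp)
    rwa [h, h, Fin.succ_lt_succ_iff] at this
  · intro H i j
    cases j using Fin.cases with
    | zero => intro hij; simp at hij
    | succ j =>
      cases i using Fin.cases with
      | zero => intro _ _; rw [insertPerm_self, h]; exact Fin.succ_pos _
      | succ i =>
        intro hij hp
        rw [h, h, Fin.succ_lt_succ_iff]
        exact H i j (by simpa using hij) (by simpa using hp)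

lemma val_succAbove (a : Fin (k + 1)) (i : Fin k) :
    ((a.succAbove i : Fin (k + 1)) : ℕ) = if (i : ℕ) < a then (i : ℕ) else i + 1 := by
  simp only [Fin.succAbove, Fin.lt_def, Fin.val_castSucc]
  split_ifs <;> rfl

lemma insertPerm_mem_shuffles {a : Fin (k + 1)} {τ : Equiv.Perm (Fin k)} :
    insertPerm a τ ∈ shuffles a (k + 1) ↔ τ ∈ shuffles a k := by
  simp only [mem_shuffles]
  constructor
  · intro H i j hij hp
    have := H (a.succAbove i) (a.succAbove j) (by simpa using hij) (by
      rw [val_succAbove, val_succAbove]; split_ifs <;> omega)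
    rwa [insertPerm_succAbove, insertPerm_succAbove, Fin.succ_lt_succ_iff] at this
  · intro H i j hij hp
    rcases Fin.eq_self_or_eq_succAbove a i with rfl | ⟨i, rfl⟩
    · rcases Fin.eq_self_or_eq_succAbove i j with rfl | ⟨j, rfl⟩
      · exact absurd hij (lt_irrefl _)
      · rw [insertPerm_self, insertPerm_succAbove]
        exact Fin.succ_pos _
    · rcases Fin.eq_self_or_eq_succAbove a j with rfl | ⟨j, rfl⟩
      · rw [Fin.lt_def] at hij
        omega
      · rw [insertPerm_succAbove, insertPerm_succAbove, Fin.succ_lt_succ_iff]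
        refine H i j (by simpa using hij) ?_
        rw [val_succAbove, val_succAbove] at hp
        split_ifs at hp <;> omega

/-- A shuffle must start with the first letter of one of its two words, that is with index `0` or
`p`. This matches the two terms in the recursion of `sh`. -/
lemma eq_of_insertPerm_mem_shuffles {p : ℕ} {a : Fin (k + 1)} {τ : Equiv.Perm (Fin k)}
    (h : insertPerm a τ ∈ shuffles p (k + 1)) : a = 0 ∨ (a : ℕ) = p := by
  rw [mem_shuffles] at h
  by_contra! hc
  rcases lt_or_gt_of_ne hc.2 with h1 | h1
  · have := h 0 a (Fin.pos_of_ne_zero hc.1) (Or.inl h1)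
    simp at this
  · have := h ⟨p, h1.trans a.2⟩ a h1 (Or.inr le_rfl)
    simp at this

/-- Bringing the letter `a` to the front creates inversions exactly with the letters before it; the
remaining inversions are those of `τ`. -/
lemma koszulSign_insertPerm (d : Fin (k + 1) → ZMod 2) (a : Fin (k + 1))
    (τ : Equiv.Perm (Fin k)) : koszulSign d (insertPerm a τ) =
      sgn (d a * ∑ i : Fin k, if (i : ℕ) < a then d (a.succAbove i) else 0) *
        koszulSign (fun i => d (a.succAbove i)) τ := by
  have h1 : ∀ j, (if a < j ∧ insertPerm a τ j < insertPerm a τ a then sgn (d a * d j) else 1)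
      = 1 := fun j => if_neg (by simp)
  have h2 (i : Fin k) : a.succAbove i < a ↔ (i : ℕ) < a := by
    rw [Fin.lt_def, val_succAbove]; split_ifs <;> omega
  rw [koszulSign, Fin.prod_univ_succAbove _ a, Finset.prod_congr rfl fun j _ => h1 j,
    Finset.prod_const_one, one_mul]
  simp only [Fin.prod_univ_succAbove _ a, Finset.prod_mul_distrib, insertPerm_self,
    insertPerm_succAbove, Fin.succ_pos, and_true, Fin.succAbove_lt_succAbove_iff,
    Fin.succ_lt_succ_iff, h2]
  congr 1
  rw [Finset.mul_sum, sgn_sum]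
  refine Finset.prod_congr rfl fun i _ => ?_
  split_ifs
  · rw [mul_comm]
  · simp [sgn]

variable {K L : Type*} [CommRing K] [HasParity L]

lemma take_ofFn_succAbove {L : Type*} (X : Fin (k + 1) → L) (a : Fin (k + 1)) :
    (List.ofFn fun i => X (a.succAbove i)).take a = (List.ofFn X).take a := by
  have ha := a.2
  refine List.ext_getElem (by simp; omega) fun i h1 h2 => ?_
  simp only [List.getElem_take, List.getElem_ofFn]
  congr 1
  rw [Fin.ext_iff, val_succAbove, if_pos]
  simp at h2 ⊢
  omega

lemma drop_ofFn_succAbove {L : Type*} (X : Fin (k + 1) → L) (a : Fin (k + 1)) :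
    (List.ofFn X).drop a = X a :: (List.ofFn fun i => X (a.succAbove i)).drop a := by
  have ha := a.2
  refine List.ext_getElem (by simp; omega) fun i h1 h2 => ?_
  rcases i with _ | i
  · simp only [List.getElem_drop, List.getElem_ofFn, List.getElem_cons_zero, add_zero]
  · simp only [List.getElem_drop, List.getElem_ofFn, List.getElem_cons_succ]
    congr 1
    rw [Fin.ext_iff, val_succAbove, if_neg (by simp)]
    simp only
    omega

/-- The sum over the shuffle permutations is the sum over the shuffles of words. -/
lemma sum_shuffles (p : ℕ) (hp : p ≤ k) (F : List L → K) (X : Fin k → L) :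
    ∑ σ ∈ shuffles p k, (koszulSign (fun i => par (X i)) σ : K) *
      F (List.ofFn fun i => X (σ.symm i)) = sh F ((List.ofFn X).take p) ((List.ofFn X).drop p) := by
  induction k generalizing p F with
  | zero =>
    obtain rfl : p = 0 := by omega
    have : shuffles 0 0 = {1} := by
      refine Finset.eq_singleton_iff_unique_mem.2 ⟨mem_shuffles.2 fun i => i.elim0, ?_⟩
      exact fun σ _ => Subsingleton.elim _ _
    rw [this]
    simp [koszulSign]
  | succ k ih =>
    set T : Fin (k + 1) → K := fun a => ∑ τ : Equiv.Perm (Fin k),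
      if insertPerm a τ ∈ shuffles p (k + 1) then
        (koszulSign (fun i => par (X i)) (insertPerm a τ) : K) *
          F (List.ofFn fun i => X ((insertPerm a τ).symm i)) else 0 with hT
    have hsum : ∑ σ ∈ shuffles p (k + 1), (koszulSign (fun i => par (X i)) σ : K) *
        F (List.ofFn fun i => X (σ.symm i)) = ∑ a, T a := by
      have := insertPerm_bijective.sum_comp fun σ => if σ ∈ shuffles p (k + 1) then
        (koszulSign (fun i => par (X i)) σ : K) * F (List.ofFn fun i => X (σ.symm i)) else 0
      rw [Fintype.sum_prod_type, Finset.sum_ite_mem, Finset.univ_inter] at this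
      exact this.symm
    have h0 (p' : ℕ) (h : p = p' + 1) : T 0 = sh (fun w => F (X 0 :: w))
        ((List.ofFn fun i : Fin k => X i.succ).take p')
        ((List.ofFn fun i : Fin k => X i.succ).drop p') := by
      subst h
      rw [← ih p' (by omega)]
      simp only [hT, insertPerm_zero_mem_shuffles]
      rw [← Finset.sum_filter]
      refine Finset.sum_congr (by ext; simp) fun τ _ => ?_
      rw [koszulSign_insertPerm, ofFn_insertPerm_symm]
      simp [sgn]
    have h1 (a : Fin (k + 1)) (h : p = a) (ha : p ≤ k) : T a =
        eps K (par (X a) * wpar ((List.ofFn X).take p)) * sh (fun w => F (X a :: w))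
        ((List.ofFn X).take p) ((List.ofFn fun i => X (a.succAbove i)).drop p) := by
      subst h
      rw [← take_ofFn_succAbove X a, ← ih a ha]
      simp only [hT, insertPerm_mem_shuffles]
      rw [← Finset.sum_filter, Finset.mul_sum]
      refine Finset.sum_congr (by ext; simp) fun τ _ => ?_
      rw [koszulSign_insertPerm, ofFn_insertPerm_symm, wpar_take_ofFn, eps, Int.cast_mul, mul_assoc]
    have h2 (a : Fin (k + 1)) (ha : a ≠ 0) (ha' : (a : ℕ) ≠ p) : T a = 0 := by
      refine Finset.sum_eq_zero fun τ _ => if_neg fun h => ?_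
      rcases eq_of_insertPerm_mem_shuffles h with h | h
      exacts [ha h, ha' h]
    rw [hsum]
    rcases Nat.eq_zero_or_pos p with rfl | hp0
    -- For `p = 0` the left word is empty and both possible first indices are `0`.
    · rw [Finset.sum_eq_single 0 (fun a _ ha => h2 a ha (Fin.val_ne_zero_iff.2 ha)) (by simp),
        h1 0 rfl (Nat.zero_le k)]
      simp [List.ofFn_succ]
    · obtain ⟨p, rfl⟩ := Nat.exists_eq_succ_of_ne_zero hp0.ne'
      -- If `p` equals the full length, the right word is empty and there is no index `p`; otherwise
      -- both first letters occur.
      rcases Nat.eq_or_lt_of_le hp with hpk | hpk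
      · obtain rfl : p = k := by omega
        rw [Finset.sum_eq_single 0 (fun a _ ha => h2 a ha (by have := a.2; omega)) (by simp),
          h0 p rfl]
        rw [List.take_of_length_le (by simp), List.take_of_length_le (by simp),
          List.drop_of_length_le (by simp), List.drop_of_length_le (by simp), List.ofFn_succ]
        simp
      · set a : Fin (k + 1) := ⟨p + 1, hpk⟩ with ha
        rw [Finset.sum_eq_add 0 a (by simp [Fin.ext_iff, ha])
          (fun c _ hc => h2 c hc.1 fun h => hc.2 (Fin.ext h)) (by simp) (by simp),
          h0 p rfl, h1 a rfl (by omega)]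
        have e := drop_ofFn_succAbove X a
        have e' : (List.ofFn X).take (p + 1) =
            X 0 :: (List.ofFn fun i : Fin k => X i.succ).take p := by
          rw [List.ofFn_succ, List.take_succ_cons]
        have e'' : (List.ofFn X).drop (p + 1) =
            (List.ofFn fun i : Fin k => X i.succ).drop p := by
          rw [List.ofFn_succ, List.drop_succ_cons]
        simp only [Nat.succ_eq_add_one, ha] at e ⊢
        rw [e', ← e'', e, sh_cons_cons]

end ShufflePerms

/-! ### Vanishing on shuffles -/

lemma ev_contractLast {K E : Type*} [Field K] [AddCommGroup E] [Module K E]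
    {ℰ : ℤ → Submodule K E} {k : ℕ} (Ω : MultilinearMap K (fun _ : Fin (k + 1) => E) K) (y : Letter ℰ)
    (w : List (Letter ℰ)) : ev (contractLast y.val Ω) w = ev Ω (w ++ [y]) := by
  rw [ev_concat, contractLast, ev_comp]
  rfl

section Vanishing

variable {K E A : Type*} [Field K] [AddCommGroup E] [Module K E] [AddCommGroup A] [Module K A]
  {ℰ : ℤ → Submodule K E} [DirectSum.Decomposition ℰ] {k : ℕ}

lemma sum_permAct_apply (p : ℕ) (hp : p ≤ k) (f : MultilinearMap K (fun _ : Fin k => E) K)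
    (X : Fin k → Letter ℰ) : (∑ σ ∈ shuffles p k, permAct ℰ σ f) (fun i => (X i).val) =
      sh (ev f) ((List.ofFn X).take p) ((List.ofFn X).drop p) := by
  rw [← sum_shuffles p hp, _root_.sum_apply]
  refine Finset.sum_congr rfl fun σ _ => ?_
  rw [permAct_apply, zsmul_eq_mul, ev_ofFn]

lemma VanishesOnShuffles.shVanish {f : MultilinearMap K (fun _ : Fin k => E) K}
    (h : VanishesOnShuffles ℰ f) : ShVanish (ev f : List (Letter ℰ) → K) := by
  intro u v hu hv
  by_cases hk : (u ++ v).length = k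
  · obtain ⟨X, hX⟩ := exists_ofFn_eq hk
    rw [List.length_append] at hk
    have hu' := List.length_pos_iff.2 hu
    have hv' := List.length_pos_iff.2 hv
    have := sum_permAct_apply u.length (by omega) f X
    rw [h _ hu' (by omega), hX, List.take_left, List.drop_left] at this
    exact this.symm
  · refine sh_eq_zero fun w hw => ev_of_length_ne _ ?_
    rwa [hw.length_eq]

/-- A spanning set smaller than all homogeneous elements is allowed, so that letters can later be
assumed to have no component in `V` or none in the dual of `M`. -/
lemma vanishesOnShuffles_of_span {S : Set E} (hS : Submodule.span K S = ⊤)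
    (hhom : ∀ x ∈ S, ∃ n, x ∈ ℰ n) {f : MultilinearMap K (fun _ : Fin k => E) K}
    (h : ∀ u v : List (Letter ℰ), u ≠ [] → v ≠ [] → (∀ a ∈ u ++ v, a.val ∈ S) →
      sh (ev f) u v = 0) : VanishesOnShuffles ℰ f := by
  intro p hp hpk
  refine multilinear_eq_zero_of_span hS fun x hx => ?_
  choose d hd using fun i => hhom (x i) (hx i)
  have := sum_permAct_apply p hpk.le f fun i => (⟨d i, x i, hd i⟩ : Letter ℰ)
  rw [this]
  refine h _ _ ?_ ?_ ?_
  · rw [← List.length_pos_iff, List.length_take, List.length_ofFn]; omega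
  · rw [← List.length_pos_iff, List.length_drop, List.length_ofFn]; omega
  · rw [List.take_append_drop]
    intro a ha
    obtain ⟨i, rfl⟩ := List.mem_ofFn.1 ha
    exact hx i

lemma ShVanish.vanishesOnShuffles {f : MultilinearMap K (fun _ : Fin k => E) K}
    (h : ShVanish (ev f : List (Letter ℰ) → K)) : VanishesOnShuffles ℰ f :=
  vanishesOnShuffles_of_span (span_homogeneous (ℰ := ℰ)) (fun _ h => h)
    fun u v hu hv _ => h u v hu hv

lemma VanishesOnShuffles.comp {f : MultilinearMap K (fun _ : Fin k => E) A}
    (hf : VanishesOnShuffles ℰ f) {B : Type*} [AddCommGroup B] [Module K B] (h : A →ₗ[K] B) :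
    VanishesOnShuffles ℰ (h.compMultilinearMap f) := by
  intro p hp hpk
  ext x
  have := congrArg h (congrArg (· x) (hf p hp hpk))
  simpa [permAct_comp] using this

/-- Composition with a separating family of functionals reduces vector-valued maps to scalar forms.
-/
lemma vanishesOnShuffles_of_comp {f : MultilinearMap K (fun _ : Fin k => E) A}
    {ι : Type*} (T : ι → A →ₗ[K] K) (hT : ∀ a, (∀ i, T i a = 0) → a = 0)
    (h : ∀ i, VanishesOnShuffles ℰ ((T i).compMultilinearMap f)) : VanishesOnShuffles ℰ f := by
  intro p hp hpk
  ext x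
  refine hT _ fun i => ?_
  have := congrArg (· x) (h i p hp hpk)
  simpa [permAct_comp] using this

lemma vanishesOnShuffles_contractLast_of_span {S : Set E} (hS : Submodule.span K S = ⊤)
    (hhom : ∀ x ∈ S, ∃ n, x ∈ ℰ n) {Ω : MultilinearMap K (fun _ : Fin (k + 1) => E) K}
    (h : ∀ (y : Letter ℰ) (u v : List (Letter ℰ)), y.val ∈ S → u ≠ [] → v ≠ [] →
      (∀ a ∈ u ++ v, a.val ∈ S) → sh (fun w => ev Ω (w ++ [y])) u v = 0) (y : E) :
    VanishesOnShuffles ℰ (contractLast y Ω) := by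
  have hy : y ∈ Submodule.span K S := hS ▸ Submodule.mem_top
  induction hy using Submodule.span_induction with
  | mem y hy =>
    obtain ⟨n, hn⟩ := hhom y hy
    refine vanishesOnShuffles_of_span hS hhom fun u v hu hv huv => ?_
    have := h ⟨n, y, hn⟩ u v hy hu hv huv
    simpa only [← ev_contractLast] using this
  | zero =>
    have : contractLast (0 : E) Ω = 0 := by ext x; simp [contractLast]
    rw [this]
    exact vanishesOnShuffles_zero
  | add y z _ _ hy hz =>
    have : contractLast (y + z) Ω = contractLast y Ω + contractLast z Ω := by
      ext x; simp [contractLast]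
    rw [this]
    exact hy.add hz
  | smul r y _ hy =>
    have : contractLast (r • y) Ω = r • contractLast y Ω := by ext x; simp [contractLast]
    rw [this]
    exact hy.smul r

lemma contractLast_shVanish_iff {Ω : MultilinearMap K (fun _ : Fin (k + 1) => E) K} :
    (∀ y, VanishesOnShuffles ℰ (contractLast y Ω)) ↔
      ∀ y : Letter ℰ, ShVanish fun w : List (Letter ℰ) => ev Ω (w ++ [y]) := by
  constructor
  · intro h y
    rw [← funext (ev_contractLast Ω y)]
    exact (h y.val).shVanish
  · intro h
    exact vanishesOnShuffles_contractLast_of_span (span_homogeneous (ℰ := ℰ)) (fun _ h => h)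
      fun y u v _ hu hv _ => h y u v hu hv

end Vanishing

/-! ### Skew shuffles and the shift -/

section Skew

variable {k : ℕ}

lemma val_eq_sum_lt (j : Fin k) : ((j : ℕ) : ZMod 2) = ∑ i : Fin k, if i < j then 1 else 0 := by
  rw [Finset.sum_boole, Finset.filter_gt_eq_Iio, Fin.card_Iio]

lemma prod_prod_inversions_eq_sign (σ : Equiv.Perm (Fin k)) :
    ∏ i, ∏ j, (if i < j ∧ σ j < σ i then (-1 : ℤ) else 1) = (Equiv.Perm.sign σ : ℤ) := by
  rw [Equiv.Perm.sign_eq_prod_prod_Ioi]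
  push_cast
  refine Finset.prod_congr rfl fun i _ => ?_
  rw [← Finset.prod_subset (Finset.subset_univ (Finset.Ioi i))]
  · refine Finset.prod_congr rfl fun j hj => ?_
    rw [Finset.mem_Ioi] at hj
    have hne : σ i ≠ σ j := fun h => hj.ne (σ.injective h)
    rcases lt_or_gt_of_ne hne with h | h
    · simp [h, h.not_gt]
    · simp [h, hj, h.not_gt]
  · intro j _ hj
    rw [Finset.mem_Ioi] at hj
    rw [if_neg fun h => hj h.1]

/-- The sign rule of the shift. For one inversion, the factors for parities `d` and `d + 1` and the
signature multiply to `(-1) ^ (d i + d j)`, so only the total of `d i + d j` over the inversions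
matters. -/
lemma koszulSign_add_one (d : Fin k → ZMod 2) (σ : Equiv.Perm (Fin k)) :
    koszulSign d σ * sgn (∑ j : Fin k, (j : ℕ) * d (σ.symm j)) =
      sgn (∑ j : Fin k, (j : ℕ) * d j) * ((Equiv.Perm.sign σ : ℤ) *
        koszulSign (fun i => d i + 1) σ) := by
  have e1 : ∑ j : Fin k, ((j : ℕ) : ZMod 2) * d (σ.symm j) =
      ∑ j : Fin k, ((σ j : ℕ) : ZMod 2) * d j := by
    rw [← Equiv.sum_comp σ]
    simp
  have e2 : koszulSign d σ * (Equiv.Perm.sign σ : ℤ) * koszulSign (fun i => d i + 1) σ =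
      sgn (∑ i, ∑ j, if i < j ∧ σ j < σ i then d i + d j else 0) := by
    rw [← prod_prod_inversions_eq_sign, koszulSign, koszulSign, sgn_sum, ← Finset.prod_mul_distrib,
      ← Finset.prod_mul_distrib]
    refine Finset.prod_congr rfl fun i _ => ?_
    rw [sgn_sum, ← Finset.prod_mul_distrib, ← Finset.prod_mul_distrib]
    refine Finset.prod_congr rfl fun j _ => ?_
    split_ifs
    · generalize d i = x
      generalize d j = y
      revert x y
      decide
    · rfl
  -- The number of inversions involving `j` has the parity of `σ j + j`, because `j` counts the
  -- indices below `j` and `σ j` those sent below `σ j`.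
  have e3 : ∑ i, ∑ j, (if i < j ∧ σ j < σ i then d i + d j else 0) =
      ∑ j : Fin k, ((σ j : ℕ) : ZMod 2) * d j + ∑ j : Fin k, ((j : ℕ) : ZMod 2) * d j := by
    have h1 : ∑ i, ∑ j, (if i < j ∧ σ j < σ i then d i + d j else 0) =
        ∑ j, ∑ i, ((if i < j ∧ σ j < σ i then d j else 0) +
          if j < i ∧ σ i < σ j then d j else 0) := by
      simp only [Finset.sum_add_distrib]
      rw [Finset.sum_comm (γ := Fin k) (f := fun j i => if i < j ∧ σ j < σ i then d j else 0),
        ← Finset.sum_add_distrib]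
      refine Finset.sum_congr rfl fun i _ => ?_
      rw [← Finset.sum_add_distrib]
      refine Finset.sum_congr rfl fun j _ => ?_
      split_ifs <;> ring
    rw [h1, ← Finset.sum_add_distrib]
    refine Finset.sum_congr rfl fun j _ => ?_
    have h2 : ((σ j : ℕ) : ZMod 2) = ∑ i : Fin k, if σ i < σ j then 1 else 0 := by
      rw [val_eq_sum_lt, ← Equiv.sum_comp σ]
    rw [h2, val_eq_sum_lt, ← add_mul, ← Finset.sum_add_distrib, Finset.sum_mul]
    refine Finset.sum_congr rfl fun i _ => ?_
    have h2 : (1 : ZMod 2) + 1 = 0 := rfl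
    rcases lt_trichotomy i j with h | rfl | h
    · have hne : σ i ≠ σ j := fun h' => h.ne (σ.injective h')
      rcases lt_or_gt_of_ne hne with h' | h' <;> simp [h, h', h.not_gt, h'.not_gt, h2]
    · simp
    · have hne : σ i ≠ σ j := fun h' => h.ne' (σ.injective h')
      rcases lt_or_gt_of_ne hne with h' | h' <;> simp [h, h', h.not_gt, h'.not_gt]
  rw [e1]
  have e4 := e2.trans (congrArg sgn e3)
  rw [sgn_add] at e4
  have s1 := sgn_mul_self (∑ j : Fin k, ((σ j : ℕ) : ZMod 2) * d j)
  have s2 := sgn_mul_self (∑ j : Fin k, ((j : ℕ) : ZMod 2) * d j)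
  have s3 : koszulSign (fun i => d i + 1) σ * koszulSign (fun i => d i + 1) σ = 1 := by
    rw [koszulSign, ← Finset.prod_mul_distrib]
    refine Finset.prod_eq_one fun i _ => ?_
    rw [← Finset.prod_mul_distrib]
    refine Finset.prod_eq_one fun j _ => ?_
    split_ifs
    · exact sgn_mul_self _
    · rfl
  have s4 : (Equiv.Perm.sign σ : ℤ) * (Equiv.Perm.sign σ : ℤ) = 1 := by
    rw [← Units.val_mul, Int.units_mul_self, Units.val_one]
  generalize koszulSign d σ = a at *
  generalize koszulSign (fun i => d i + 1) σ = b at *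
  generalize (Equiv.Perm.sign σ : ℤ) = c at *
  generalize sgn (∑ j : Fin k, ((σ j : ℕ) : ZMod 2) * d j) = x at *
  generalize sgn (∑ j : Fin k, ((j : ℕ) : ZMod 2) * d j) = y at *
  linear_combination (c * b * x) * e4 - (a * x) * (b * b * s4 + s3) + (c * b * y) * s1

variable {K V W : Type*} [Field K] [AddCommGroup V] [Module K V] [AddCommGroup W] [Module K W]
  {𝒱 : ℤ → Submodule K V} [DirectSum.Decomposition 𝒱]

lemma parityInv_pow_of_mem (m : ℕ) {n : ℤ} {x : V} (hx : x ∈ 𝒱 n) :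
    (parityInv 𝒱 ^ m) x = eps K (m * n) • x := by
  induction m with
  | zero => simp
  | succ m ih =>
    rw [pow_succ', Module.End.mul_apply, ih, map_smul, parityInv_of_mem 𝒱 hx, Nat.cast_succ,
      add_mul, one_mul, eps_add, mul_smul]
    congr 1
    rw [eps, Int.cast_smul_eq_zsmul]

lemma shiftMap_apply (c : MultilinearMap K (fun _ : Fin k => V) W) (X : Fin k → Letter (shift 𝒱)) :
    shiftMap 𝒱 c (fun i => (X i).val) =
      eps K (∑ j : Fin k, ((k - (j + 1) : ℕ) : ZMod 2) * par (X j)) • c fun i => (X i).val := by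
  rw [shiftMap, MultilinearMap.compLinearMap_apply]
  simp only [parityInv_pow_of_mem _ (X _).mem]
  rw [MultilinearMap.map_smul_univ, eps, sgn_sum, Int.cast_prod]
  rfl

/-- The letter of `V` with the same value. -/
def Letter.unshift (a : Letter (shift 𝒱)) : Letter 𝒱 := ⟨a.deg + 1, a.val, a.mem⟩

lemma permAct_shiftMap (c : MultilinearMap K (fun _ : Fin k => V) W) (σ : Equiv.Perm (Fin k))
    (X : Fin k → Letter (shift 𝒱)) :
    permAct (shift 𝒱) σ (shiftMap 𝒱 c) (fun i => (X i).val) =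
      eps K (∑ j : Fin k, ((k - (j + 1) : ℕ) : ZMod 2) * par (X j)) •
        ((Equiv.Perm.sign σ : ℤ) • permAct 𝒱 σ c) (fun i => (X i).val) := by
  rw [permAct_apply, shiftMap_apply c fun i => X (σ.symm i), _root_.smul_apply]
  have h := permAct_apply (ℰ := 𝒱) σ c fun i => (X i).unshift
  simp only [Letter.unshift] at h
  rw [h]
  -- Modulo `2` the weight `k - (j + 1)` is `(k + 1) + j`. The constant part is insensitive to
  -- permutation, so only the weights `j` of `koszulSign_add_one` are affected.
  have hk (y : Fin k → ZMod 2) : ∑ j : Fin k, ((k - (j + 1) : ℕ) : ZMod 2) * y j =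
      (k + 1) * ∑ j, y j + ∑ j : Fin k, ((j : ℕ) : ZMod 2) * y j := by
    rw [Finset.mul_sum, ← Finset.sum_add_distrib]
    refine Finset.sum_congr rfl fun j _ => ?_
    have hj := j.2
    rw [Nat.cast_sub (by omega), ← add_mul, CharTwo.sub_eq_add]
    push_cast
    ring
  rw [hk, hk, Equiv.sum_comp σ.symm (fun j => par (X j)), eps_add, eps_add]
  have e := koszulSign_add_one (fun i => par (X i)) σ
  have e' : (fun i => par (X i) + 1) = fun i => par (⟨(X i).deg + 1, (X i).val, (X i).mem⟩ : Letter 𝒱) := by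
    funext i
    simp [par_def]
  rw [e'] at e
  simp only [← Int.cast_smul_eq_zsmul K, smul_smul]
  congr 1
  simp only [eps]
  have e2 := congrArg (Int.cast (R := K)) e
  push_cast at e2
  linear_combination ((sgn ((↑k + 1) * ∑ j, par (X j)) : ℤ) : K) * e2

/-- The sign that compares the two sums does not depend on the shuffle, so it factors out and is
invertible. -/
lemma vanishesOnShuffles_shiftMap {c : MultilinearMap K (fun _ : Fin k => V) W} :
    VanishesOnShuffles (shift 𝒱) (shiftMap 𝒱 c) ↔ VanishesOnSkewShuffles 𝒱 c := by
  have key (p : ℕ) (X : Fin k → Letter (shift 𝒱)) :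
      (∑ σ ∈ shuffles p k, permAct (shift 𝒱) σ (shiftMap 𝒱 c)) (fun i => (X i).val) =
        eps K (∑ j : Fin k, ((k - (j + 1) : ℕ) : ZMod 2) * par (X j)) •
        (∑ σ ∈ shuffles p k, (Equiv.Perm.sign σ : ℤ) • permAct 𝒱 σ c) (fun i => (X i).val) := by
    rw [_root_.sum_apply, _root_.sum_apply, Finset.smul_sum]
    exact Finset.sum_congr rfl fun σ _ => permAct_shiftMap c σ X
  refine forall_congr' fun p => forall_congr' fun _ => forall_congr' fun _ => ?_
  constructor
  · intro h
    refine multilinear_eq_zero_of_span (span_homogeneous (ℰ := shift 𝒱)) fun x hx => ?_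
    choose d hd using hx
    have := key p fun i => ⟨d i, x i, hd i⟩
    rw [h, _root_.zero_apply] at this
    have h2 := congrArg (eps K (∑ j : Fin k, ((k - (j + 1) : ℕ) : ZMod 2) *
      par (⟨d j, x j, hd j⟩ : Letter (shift 𝒱))) • ·) this
    simp only [smul_smul, eps_mul_self, one_smul, smul_zero] at h2
    exact h2.symm
  · intro h
    refine multilinear_eq_zero_of_span (span_homogeneous (ℰ := shift 𝒱)) fun x hx => ?_
    choose d hd using hx
    have := key p fun i => ⟨d i, x i, hd i⟩
    rwa [h, _root_.zero_apply, smul_zero] at this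

end Skew

/-! ### The semidirect product and its double -/

section Algebra

variable {K V M : Type*} [Field K] [AddCommGroup V] [Module K V] [AddCommGroup M] [Module K M]
  {𝒱 : ℤ → Submodule K V} [DirectSum.Decomposition 𝒱]
  {ℳ : ℤ → Submodule K M} [DirectSum.Decomposition ℳ]
  {q : V →ₗ[K] V →ₗ[K] V} {lact : V →ₗ[K] M →ₗ[K] M}

lemma rightAct_of_mem {i j : ℤ} {a : M} {x : V} (ha : a ∈ ℳ j) (hx : x ∈ 𝒱 i) :
    rightAct 𝒱 ℳ lact a x = sgn ((j : ZMod 2) * i) • lact x a := by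
  have e : rightAct 𝒱 ℳ lact a x =
      lact (parityProj 𝒱 0 x) a + lact (parityProj 𝒱 1 x) (parityInv ℳ a) := rfl
  rw [e, parityProj_of_mem 𝒱 _ hx, parityProj_of_mem 𝒱 _ hx, parityInv_of_mem ℳ ha]
  obtain h | h : (i : ZMod 2) = 0 ∨ (i : ZMod 2) = 1 := by
    generalize (i : ZMod 2) = ε
    revert ε
    decide
  · simp [h, sgn]
  · simp [h]

/-- The right action is defined from the left one, so the bimodule axiom reduces to graded
commutativity of `V` and to the associativity of the left action. -/
lemma rightAct_lact (hq : IsCommAlgebra 𝒱 q) (hM : IsAlgebraModule 𝒱 ℳ q lact) (x z : V) (b : M) :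
    rightAct 𝒱 ℳ lact (lact x b) z = lact x (rightAct 𝒱 ℳ lact b z) := by
  induction x using DirectSum.Decomposition.inductionOn 𝒱 with
  | zero => simp
  | add x x' h h' => simp only [map_add, LinearMap.add_apply, h, h']
  | @homogeneous i x =>
  induction z using DirectSum.Decomposition.inductionOn 𝒱 with
  | zero => simp
  | add z z' h h' => simp only [map_add, h, h']
  | @homogeneous j z =>
  induction b using DirectSum.Decomposition.inductionOn ℳ with
  | zero => simp
  | add b b' h h' => simp only [map_add, LinearMap.add_apply, h, h']
  | @homogeneous l b =>
  rw [rightAct_of_mem (hM.degree _ _ _ x.2 _ b.2) z.2, rightAct_of_mem b.2 z.2, map_zsmul,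
    ← hM.assoc, ← hM.assoc, hq.comm _ _ _ x.2 _ z.2, map_zsmul, LinearMap.smul_apply, smul_smul]
  congr 1
  push_cast
  generalize (i : ZMod 2) = a
  generalize (j : ZMod 2) = b
  generalize (l : ZMod 2) = c
  revert a b c
  decide

lemma rightAct_rightAct (hq : IsCommAlgebra 𝒱 q) (hM : IsAlgebraModule 𝒱 ℳ q lact) (y z : V)
    (a : M) : rightAct 𝒱 ℳ lact (rightAct 𝒱 ℳ lact a y) z = rightAct 𝒱 ℳ lact a (q y z) := by
  induction y using DirectSum.Decomposition.inductionOn 𝒱 with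
  | zero => simp
  | add x x' h h' => simp only [map_add, LinearMap.add_apply, h, h']
  | @homogeneous i y =>
  induction z using DirectSum.Decomposition.inductionOn 𝒱 with
  | zero => simp
  | add z z' h h' => simp only [map_add, h, h']
  | @homogeneous j z =>
  induction a using DirectSum.Decomposition.inductionOn ℳ with
  | zero => simp
  | add b b' h h' => simp only [map_add, LinearMap.add_apply, h, h']
  | @homogeneous l a =>
  rw [rightAct_of_mem a.2 y.2, map_zsmul, LinearMap.smul_apply,
    rightAct_of_mem (hM.degree _ _ _ y.2 _ a.2) z.2, rightAct_of_mem a.2 (hq.degree _ _ _ y.2 _ z.2),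
    ← hM.assoc, hq.comm _ _ _ y.2 _ z.2, map_zsmul, LinearMap.smul_apply, smul_smul, smul_smul]
  congr 1
  push_cast
  generalize (i : ZMod 2) = a
  generalize (j : ZMod 2) = b
  generalize (l : ZMod 2) = c
  revert a b c
  decide

lemma isCommAlgebra_semidirectMul (hq : IsCommAlgebra 𝒱 q) (hM : IsAlgebraModule 𝒱 ℳ q lact) :
    IsCommAlgebra (prodGrading 𝒱 ℳ) (semidirectMul 𝒱 ℳ q lact) where
  degree i j x hx y hy := by
    refine ⟨hq.degree _ _ _ hx.1 _ hy.1, Submodule.add_mem _ (hM.degree _ _ _ hx.1 _ hy.2) ?_⟩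
    rw [rightAct_of_mem hx.2 hy.1]
    refine zsmul_mem ?_ _
    rw [add_comm i j]
    exact hM.degree _ _ _ hy.1 _ hx.2
  assoc x y z := by
    refine Prod.ext (hq.assoc _ _ _) ?_
    simp only [semidirectMul, LinearMap.mk₂_apply, map_add, LinearMap.add_apply,
      rightAct_lact hq hM, rightAct_rightAct hq hM, hM.assoc]
    abel
  comm i j x hx y hy := by
    refine Prod.ext (hq.comm _ _ _ hx.1 _ hy.1) ?_
    simp only [semidirectMul, LinearMap.mk₂_apply, Prod.smul_snd]
    rw [rightAct_of_mem hx.2 hy.1, rightAct_of_mem hy.2 hx.1, smul_add, smul_smul,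
      mul_comm (j : ZMod 2) i, sgn_mul_self, one_smul, add_comm]

end Algebra

/-! ### The algebra `W × W*` and its symplectic form -/

section DoubleAlgebra

variable {K W : Type*} [Field K] [AddCommGroup W] [Module K W]
  {𝒲 : ℤ → Submodule K W} [DirectSum.Decomposition 𝒲] {qW : W →ₗ[K] W →ₗ[K] W}

lemma parityInv_mul (hq : IsCommAlgebra 𝒲 qW) (x y : W) :
    parityInv 𝒲 (qW x y) = qW (parityInv 𝒲 x) (parityInv 𝒲 y) := by
  induction x using DirectSum.Decomposition.inductionOn 𝒲 with
  | zero => simp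
  | add x x' h h' => simp only [map_add, LinearMap.add_apply, h, h']
  | @homogeneous i x =>
  induction y using DirectSum.Decomposition.inductionOn 𝒲 with
  | zero => simp
  | add x x' h h' => simp only [map_add, h, h']
  | @homogeneous j y =>
  rw [parityInv_of_mem _ (hq.degree _ _ _ x.2 _ y.2), parityInv_of_mem _ x.2,
    parityInv_of_mem _ y.2, map_zsmul, map_zsmul, LinearMap.smul_apply, smul_smul, Int.cast_add,
    sgn_add, mul_comm]

lemma dualLeft_apply (w : W) (f : Module.Dual K W) (z : W) :
    dualLeft 𝒲 qW w f z = f (qW z (parityInv 𝒲 w)) := rfl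

lemma dualRight_apply (w : W) (f : Module.Dual K W) (z : W) :
    dualRight qW f w z = f (qW w z) := rfl

/-- The dual of a graded commutative algebra is a symmetric bimodule. On `z` of degree other than
`-j - i` both sides vanish; otherwise the sign can be written without the degree of `z`. -/
lemma dualLeft_of_mem (hq : IsCommAlgebra 𝒲 qW) {i j : ℤ} {w : W} (hw : w ∈ 𝒲 i)
    {f : Module.Dual K W} (hf : f ∈ dualGrading 𝒲 j) :
    dualLeft 𝒲 qW w f = sgn ((i : ZMod 2) * j) • dualRight qW f w := by
  ext z
  induction z using DirectSum.Decomposition.inductionOn 𝒲 with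
  | zero => simp
  | add z z' h h' => simp only [map_add, h, h']
  | @homogeneous m z =>
  rw [dualLeft_apply, parityInv_of_mem _ hw, map_zsmul, hq.comm _ _ _ z.2 _ hw, map_zsmul,
    map_zsmul, LinearMap.smul_apply, dualRight_apply, smul_smul]
  by_cases h : i + m = -j
  · congr 1
    obtain rfl : m = -j - i := by omega
    push_cast
    generalize (i : ZMod 2) = a
    generalize (j : ZMod 2) = b
    revert a b
    decide
  · rw [hf _ h _ (hq.degree _ _ _ hw _ z.2), smul_zero, smul_zero]

lemma isCommAlgebra_doubleMul (hq : IsCommAlgebra 𝒲 qW) :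
    IsCommAlgebra (doubleGrading 𝒲) (doubleMul 𝒲 qW) := by
  have hdeg {i j : ℤ} {w : W} (hw : w ∈ 𝒲 i) {f : Module.Dual K W} (hf : f ∈ dualGrading 𝒲 j) :
      dualRight qW f w ∈ dualGrading 𝒲 (i + j) := fun m hm z hz =>
    hf _ (by omega) _ (hq.degree _ _ _ hw _ hz)
  refine ⟨fun i j x hx y hy => ⟨hq.degree _ _ _ hx.1 _ hy.1, Submodule.add_mem _ ?_ ?_⟩,
    fun x y z => Prod.ext (hq.assoc _ _ _) ?_, fun i j x hx y hy =>
      Prod.ext (hq.comm _ _ _ hx.1 _ hy.1) ?_⟩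
  · rw [dualLeft_of_mem hq hx.1 hy.2]
    exact zsmul_mem (hdeg hx.1 hy.2) _
  · rw [add_comm i j]
    exact hdeg hy.1 hx.2
  · ext u
    simp only [doubleMul, LinearMap.mk₂_apply, map_add, LinearMap.add_apply, dualLeft_apply,
      dualRight_apply, parityInv_mul hq, hq.assoc]
    abel
  · simp only [doubleMul, LinearMap.mk₂_apply, Prod.smul_snd]
    rw [dualLeft_of_mem hq hx.1 hy.2, dualLeft_of_mem hq hy.1 hx.2, smul_add, smul_smul,
      mul_comm (j : ZMod 2) i, sgn_mul_self, one_smul, add_comm]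

variable [FiniteDimensional K W]

lemma doubleSymp_of_mem {n : ℤ} {X : W × Module.Dual K W} (hX : X ∈ shift (doubleGrading 𝒲) n)
    (Y : W × Module.Dual K W) :
    doubleSymp 𝒲 X Y = eps K n * (X.2 Y.1 + eps K (n + 1) * Y.2 X.1) := by
  have e : doubleSymp 𝒲 X Y = doubleForm 𝒲 (parityInv (shift (doubleGrading 𝒲)) X) Y := rfl
  rw [e, parityInv_of_mem _ hX, map_zsmul, LinearMap.smul_apply, zsmul_eq_mul]
  congr 1
  have e' : doubleForm 𝒲 X Y = X.2 Y.1 + Y.2 (parityInv 𝒲 X.1) := rfl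
  rw [e', parityInv_of_mem _ hX.1, map_zsmul, zsmul_eq_mul]
  simp [eps]

/-- The pairing on `W × W*` has degree `0`, hence the sum `-2` after both arguments are shifted. -/
lemma doubleSymp_eq_zero {m n : ℤ} {X Y : W × Module.Dual K W}
    (hX : X ∈ shift (doubleGrading 𝒲) m) (hY : Y ∈ shift (doubleGrading 𝒲) n)
    (h : m + n ≠ -2) : doubleSymp 𝒲 X Y = 0 := by
  rw [doubleSymp_of_mem hX, hX.2 _ (by omega) _ hY.1, hY.2 _ (by omega) _ hX.1]
  simp

/-- The sign is that of graded antisymmetry: if the pairing is nonzero, `deg Y = -2 - deg X` has the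
parity of `deg X`. -/
lemma doubleSymp_comm {n : ℤ} {X : W × Module.Dual K W} (hX : X ∈ shift (doubleGrading 𝒲) n)
    (Y : W × Module.Dual K W) : doubleSymp 𝒲 X Y = -(eps K n * doubleSymp 𝒲 Y X) := by
  induction Y using DirectSum.Decomposition.inductionOn (shift (doubleGrading 𝒲)) with
  | zero => simp
  | add z z' h h' => rw [map_add, map_add, LinearMap.add_apply, h, h']; ring
  | @homogeneous m Y =>
  by_cases h : n + m = -2
  · rw [doubleSymp_of_mem hX, doubleSymp_of_mem Y.2]
    obtain rfl : m = -2 - n := by omega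
    have e : ((-2 - n : ℤ) : ZMod 2) = n := by
      push_cast
      generalize (n : ZMod 2) = a
      revert a
      decide
    rw [e, eps_add, eps_one]
    linear_combination (-(eps K n * X.2 (Y : W × Module.Dual K W).1)) *
      eps_mul_self (K := K) (n : ZMod 2)
  · rw [doubleSymp_eq_zero hX Y.2 h, doubleSymp_eq_zero Y.2 hX (by omega)]
    simp

/-- An element orthogonal to the homogeneous elements of all degrees but one is homogeneous. -/
lemma mem_of_doubleSymp_eq_zero {m : ℤ} {X : W × Module.Dual K W}
    (h : ∀ n, m + n ≠ -2 → ∀ Y ∈ shift (doubleGrading 𝒲) n, doubleSymp 𝒲 X Y = 0) :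
    X ∈ shift (doubleGrading 𝒲) m := by
  set p := homProj (shift (doubleGrading 𝒲)) m with hp
  -- The difference between `X` and its component of degree `m` is orthogonal to everything: in
  -- degree `-2 - m` because its other components pair to zero there, elsewhere by `h`.
  -- Nondegeneracy concludes.
  have hX : X - p X = 0 := by
    refine (doubleSymp_nondegenerate 𝒲).1 _ fun Y => ?_
    induction Y using DirectSum.Decomposition.inductionOn (shift (doubleGrading 𝒲)) with
    | zero => simp
    | add z z' h h' => rw [map_add, h, h', add_zero]
    | @homogeneous n Y =>
    by_cases hmn : m + n = -2
    · have key : ∀ Z : W × Module.Dual K W, doubleSymp 𝒲 (Z - p Z) Y = 0 := by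
        intro Z
        induction Z using DirectSum.Decomposition.inductionOn (shift (doubleGrading 𝒲)) with
        | zero => simp
        | add z z' h h' =>
          rw [map_add, add_sub_add_comm, map_add, LinearMap.add_apply, h, h', add_zero]
        | @homogeneous l Z =>
        by_cases hl : l = m
        · subst hl
          rw [hp, homProj_same _ Z.2]
          simp
        · rw [hp, homProj_ne _ Z.2 hl, sub_zero]
          exact doubleSymp_eq_zero Z.2 Y.2 (by omega)
      exact key X
    · rw [map_sub, LinearMap.sub_apply, h n hmn _ Y.2,
        doubleSymp_eq_zero (homProj_mem _ m X) Y.2 hmn, sub_zero]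
  rw [sub_eq_zero.1 hX]
  exact homProj_mem _ m X

end DoubleAlgebra

/-! ### Degrees of words -/

section Degree

variable {K E : Type*} [Field K] [AddCommGroup E] [Module K E] {ℰ : ℤ → Submodule K E}

/-- The degree of a word. -/
def wdeg (w : List (Letter ℰ)) : ℤ := (w.map Letter.deg).sum

@[simp] lemma wdeg_nil : wdeg ([] : List (Letter ℰ)) = 0 := rfl

@[simp] lemma wdeg_cons (a : Letter ℰ) (w : List (Letter ℰ)) : wdeg (a :: w) = a.deg + wdeg w := by
  simp [wdeg]

@[simp] lemma wdeg_append (u v : List (Letter ℰ)) : wdeg (u ++ v) = wdeg u + wdeg v := by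
  simp [wdeg]

lemma wdeg_ofFn {k : ℕ} (X : Fin k → Letter ℰ) : wdeg (List.ofFn X) = ∑ i, (X i).deg := by
  simp [wdeg, List.map_ofFn, List.sum_ofFn]

lemma intCast_wdeg (w : List (Letter ℰ)) : (wdeg w : ZMod 2) = wpar w := by
  induction w with
  | nil => simp
  | cons a w ih => simp [ih, par_def]

/-- `F` vanishes on the words that are not of degree `-f`. -/
def DegSupp (f : ℤ) (F : List (Letter ℰ) → K) : Prop := ∀ w, F w ≠ 0 → wdeg w + f = 0

lemma hasDegree_scalar_iff {k : ℕ} {f : ℤ} {Ω : MultilinearMap K (fun _ : Fin k => E) K} :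
    HasDegree ℰ (scalarGrading K) f Ω ↔ DegSupp f (ev Ω : List (Letter ℰ) → K) := by
  constructor
  · intro h w hw
    by_cases hk : w.length = k
    · obtain ⟨X, rfl⟩ := exists_ofFn_eq hk
      rw [ev_ofFn] at hw
      have := h (fun i => (X i).deg) (fun i => (X i).val) fun i => (X i).mem
      rw [scalarGrading] at this
      rw [wdeg_ofFn]
      by_contra hc
      rw [if_neg hc] at this
      exact hw (by simpa using this)
    · exact absurd (ev_of_length_ne _ hk) hw
  · intro h d x hx
    have := h (List.ofFn fun i => ⟨d i, x i, hx i⟩)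
    rw [ev_ofFn, wdeg_ofFn] at this
    rw [scalarGrading]
    split_ifs with hc
    · trivial
    · by_contra hne
      exact hc (this hne)

variable {f : ℤ} {F : List (Letter ℰ) → K}

lemma DegSupp.mul_left (h : DegSupp f F) (c : K) : DegSupp f (c • F) :=
  fun w hw => h w (right_ne_zero_of_mul hw)

lemma DegSupp.rot (h : DegSupp f F) : DegSupp f (rot F) := by
  intro w hw
  induction w using List.reverseRecOn with
  | nil => exact h _ hw
  | append_singleton w c =>
    rw [rot_concat] at hw
    have := h _ (right_ne_zero_of_mul hw)
    rw [wdeg_cons] at this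
    rw [wdeg_append, wdeg_cons, wdeg_nil]
    linarith

lemma DegSupp.cyc (h : DegSupp f F) (n : ℕ) : DegSupp f (cyc n F) := by
  intro w hw
  rw [cyc_apply, Finset.sum_apply] at hw
  obtain ⟨i, _, hi⟩ := Finset.exists_ne_zero_of_sum_ne_zero hw
  have (j : ℕ) : DegSupp f ((Pinczon.rot ^ j : Module.End K (List (Letter ℰ) → K)) F) := by
    induction j with
    | zero => exact h
    | succ j ih => rw [pow_succ', Module.End.mul_apply]; exact ih.rot
  exact this i w hi

end Degree

/-! ### The product on the shifted space of a graded commutative algebra -/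

section ShiftedProduct

variable {K V : Type*} [Field K] [AddCommGroup V] [Module K V]
  {𝒱 : ℤ → Submodule K V} {q : V →ₗ[K] V →ₗ[K] V}

/-- The product `Q (x, y) = (-1) ^ (deg x) x y` of letters of `V[1]`. -/
def letterMul (hq : IsCommAlgebra 𝒱 q) (a b : Letter (shift 𝒱)) : Letter (shift 𝒱) where
  deg := a.deg + b.deg + 1
  val := eps K (par a) • q a.val b.val
  mem := by
    refine Submodule.smul_mem _ _ ?_
    have := hq.degree _ _ _ a.mem _ b.mem
    rwa [show a.deg + 1 + (b.deg + 1) = a.deg + b.deg + 1 + 1 by ring] at this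

variable (hq : IsCommAlgebra 𝒱 q)

lemma oddMul_letterMul : OddMul (letterMul hq) := by
  intro a b
  simp [par_def, letterMul]

/-- Parities in `V` are those of the letters plus one, so graded commutativity acquires a minus
sign. The comparison is on values because the two letters are only proportional. -/
lemma letterMul_comm_val (a b : Letter (shift 𝒱)) : (letterMul hq a b).val =
    (-eps K (par a * par b)) • (letterMul hq b a).val := by
  simp only [letterMul]
  rw [hq.comm _ _ _ a.mem _ b.mem, ← Int.cast_smul_eq_zsmul K, smul_smul, smul_smul]
  congr 1
  rw [Int.cast_add, Int.cast_add, Int.cast_one, ← par_def, ← par_def]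
  change eps K (par a) * eps K ((par a + 1) * (par b + 1)) = _
  simp only [mul_add, add_mul, eps_add, one_mul, eps_one, mul_one]
  linear_combination (-(eps K (par a * par b) * eps K (par b))) * eps_mul_self (K := K) (par a)

lemma letterMul_assoc_val (a b c : Letter (shift 𝒱)) :
    (letterMul hq (letterMul hq a b) c).val =
      (-eps K (par a)) • (letterMul hq a (letterMul hq b c)).val := by
  have h1 : (letterMul hq (letterMul hq a b) c).val =
      eps K (par (letterMul hq a b)) • q (eps K (par a) • q a.val b.val) c.val := rfl
  have h2 : (letterMul hq a (letterMul hq b c)).val =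
      eps K (par a) • q a.val (eps K (par b) • q b.val c.val) := rfl
  rw [h1, h2, oddMul_letterMul hq a b, map_smul, map_smul, LinearMap.smul_apply, hq.assoc,
    smul_smul, smul_smul, smul_smul]
  congr 1
  simp only [eps_add, eps_one]
  ring

lemma commOn_ev {k : ℕ} (f : MultilinearMap K (fun _ : Fin k => V) K) :
    CommOn (letterMul hq) (ev f : List (Letter (shift 𝒱)) → K) := by
  intro s t a b
  rw [ev_replace f _ (letterMul_comm_val hq a b), smul_eq_mul, neg_mul]

lemma assocOn_ev {k : ℕ} (f : MultilinearMap K (fun _ : Fin k => V) K) :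
    AssocOn (letterMul hq) (ev f : List (Letter (shift 𝒱)) → K) := by
  intro s t a b c
  rw [ev_replace f _ (letterMul_assoc_val hq a b c), smul_eq_mul, neg_mul]

lemma DegSupp.mulHead {f : ℤ} {F : List (Letter (shift 𝒱)) → K} (h : DegSupp f F) :
    DegSupp (f + 1) (mulHead (letterMul hq) F) := by
  rintro (_ | ⟨a, _ | ⟨b, w⟩⟩) hw
  · simp at hw
  · simp at hw
  · have := h _ hw
    rw [wdeg_cons, wdeg_cons, ← this, wdeg_cons]
    simp only [letterMul]
    ring

end ShiftedProduct

/-! ### The Pinczon bracket in terms of words -/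

section Bracket

variable {K E : Type*} [Field K] [AddCommGroup E] [Module K E]

lemma tensorForm_apply {k k' n : ℕ} (h : k + k' = n)
    (α : MultilinearMap K (fun _ : Fin k => E) K) (β : MultilinearMap K (fun _ : Fin k' => E) K)
    (x : Fin n → E) : tensorForm h α β x =
      α (fun i => x (finCongr h (Fin.castAdd k' i))) *
        β (fun i => x (finCongr h (Fin.natAdd k i))) := rfl

/-- This eliminates the dual bases from the bracket: the sum over `i` reconstitutes the vector that
is substituted into the second form. -/
lemma sum_dualBasis_smul {ι : Type*} [Fintype ι] [DecidableEq ι] (B : LinearMap.BilinForm K E)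
    (hB : B.Nondegenerate) (b : Module.Basis ι K E) (y : E) :
    ∑ i, B (B.dualBasis hB b i) y • b i = y := by
  conv_rhs => rw [← b.sum_repr y]
  refine Finset.sum_congr rfl fun i _ => ?_
  congr 1
  conv_lhs => rw [← b.sum_repr y, map_sum]
  simp [LinearMap.BilinForm.apply_dualBasis_left]

lemma contractLast_formOf (B : LinearMap.BilinForm K E) {k : ℕ}
    (Q : MultilinearMap K (fun _ : Fin k => E) E) (y : E) :
    contractLast y (formOf B Q) = (B.flip y).compMultilinearMap Q := by
  ext x
  simp [contractLast, formOf]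

lemma ev_formOf {ℰ : ℤ → Submodule K E} (B : LinearMap.BilinForm K E) {k : ℕ}
    (Q : MultilinearMap K (fun _ : Fin k => E) E) (w : List (Letter ℰ)) (y : Letter ℰ) :
    ev (formOf B Q) (w ++ [y]) = B (ev Q w) y.val := by
  rw [ev_concat, formOf, MultilinearMap.curry_uncurryRight, ev_comp]

variable {K V M : Type*} [Field K] [AddCommGroup V] [Module K V] [AddCommGroup M] [Module K M]
  {𝒱 : ℤ → Submodule K V} [DirectSum.Decomposition 𝒱]
  {ℳ : ℤ → Submodule K M} [DirectSum.Decomposition ℳ]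
  {q : V →ₗ[K] V →ₗ[K] V} {lact : V →ₗ[K] M →ₗ[K] M}

lemma isCommAlgebra_tilde (hq : IsCommAlgebra 𝒱 q) (hM : IsAlgebraModule 𝒱 ℳ q lact) :
    IsCommAlgebra (doubleGrading (prodGrading 𝒱 ℳ))
      (doubleMul (prodGrading 𝒱 ℳ) (semidirectMul 𝒱 ℳ q lact)) :=
  isCommAlgebra_doubleMul (isCommAlgebra_semidirectMul hq hM)

/-- The product of letters of `Ṽ[1]`. -/
abbrev tildeMul (hq : IsCommAlgebra 𝒱 q) (hM : IsAlgebraModule 𝒱 ℳ q lact) :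
    Letter (tildeGrading 𝒱 ℳ) → Letter (tildeGrading 𝒱 ℳ) → Letter (tildeGrading 𝒱 ℳ) :=
  letterMul (isCommAlgebra_tilde hq hM)

variable [FiniteDimensional K V] [FiniteDimensional K M]
  (hq : IsCommAlgebra 𝒱 q) (hM : IsAlgebraModule 𝒱 ℳ q lact)

lemma tildeQ_apply (a b : Letter (tildeGrading 𝒱 ℳ)) (x : Fin 2 → Tilde K V M)
    (h0 : x 0 = a.val) (h1 : x 1 = b.val) :
    tildeQ 𝒱 ℳ q lact x = (tildeMul hq hM a b).val := by
  have h := shiftMap_apply (𝒱 := doubleGrading (prodGrading 𝒱 ℳ))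
    (bilinear (doubleMul (prodGrading 𝒱 ℳ) (semidirectMul 𝒱 ℳ q lact))) ![a, b]
  have hx : x = fun i => ((![a, b] : Fin 2 → Letter (tildeGrading 𝒱 ℳ)) i).val := by
    funext i
    fin_cases i
    exacts [h0, h1]
  rw [hx, tildeQ]
  refine h.trans ?_
  simp [letterMul, bilinear]

/-- Before the cyclic sum, the bracket substitutes `Q (a, b)` for the last argument of `Λ`;
cyclicity of `Λ` moves it to the front. The degree of `Λ` makes the resulting sign independent of
the letters. -/
lemma ev_pinczonD {f : ℤ} {k : ℕ} {Λ : MultilinearMap K (fun _ : Fin (k + 1) => Tilde K V M) K}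
    (hΛ : HasDegree (tildeGrading 𝒱 ℳ) (scalarGrading K) f Λ)
    (hc : IsCyclic (tildeGrading 𝒱 ℳ) Λ) :
    (ev (pinczonD 𝒱 ℳ q lact f Λ) : List (Letter (tildeGrading 𝒱 ℳ)) → K) =
      (-eps K f) • cyc (k + 2) (mulHead (tildeMul hq hM) (ev Λ)) := by
  rw [pinczonD, pinczonBracket, ev_cyclicSum, ← map_smul]
  congr 1
  refine (suppLen_ev _).ext ?_ fun w hw => ?_
  · intro w hw
    rcases w with _ | ⟨a, _ | ⟨b, w⟩⟩
    · simp
    · simp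
    · rw [Pi.smul_apply, mulHead_cons, ev_of_length_ne _ (by simpa using hw), smul_zero]
  obtain ⟨a, b, w, rfl⟩ : ∃ a b w', w = a :: b :: w' := by
    rcases w with _ | ⟨a, _ | ⟨b, w⟩⟩
    · simp at hw
    · simp at hw
    · exact ⟨_, _, _, rfl⟩
  have hwk : w.length = k := by simpa using hw
  obtain ⟨X, rfl⟩ := exists_ofFn_eq hwk
  set w := List.ofFn X with hwX
  set c := tildeMul hq hM a b with hcdef
  have key : ev (signed (tildeGrading 𝒱 ℳ)
      (fun d => sgn ((f : ZMod 2) * ∑ j : Fin (k + 1 + 1), if (j : ℕ) < 2 then d j else 0))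
      (∑ i, tensorForm (show 2 + k = (k + 1) + 1 by omega)
        (contractLast ((tildeSymp 𝒱 ℳ).dualBasis (doubleSymp_nondegenerate _)
          (Module.finBasis K (Tilde K V M)) i)
          (formOf (tildeSymp 𝒱 ℳ) (tildeQ 𝒱 ℳ q lact)))
        (contractLast (Module.finBasis K (Tilde K V M) i) Λ))) (a :: b :: w) =
      eps K (f * (par a + par b)) * (-(eps K (par c) * ev Λ (w ++ [c]))) := by
    set Y : Fin (k + 1 + 1) → Letter (tildeGrading 𝒱 ℳ) :=
      Fin.cons a (Fin.cons b X : Fin (k + 1) → Letter (tildeGrading 𝒱 ℳ)) with hY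
    have hl : a :: b :: w = List.ofFn Y := by rw [hY, List.ofFn_cons, List.ofFn_cons]
    have hs : (∑ j : Fin (k + 1 + 1), if (j : ℕ) < 2 then par (Y j) else 0) = par a + par b := by
      rw [Fin.sum_univ_succ, Fin.sum_univ_succ]
      simp [hY]
    set φ : Tilde K V M →ₗ[K] K := Λ.curryRight fun i => (X i).val with hφ
    have hw' : ev Λ (w ++ [c]) = φ c.val := by rw [ev_concat, hwX, ev_ofFn]
    rw [hl, ev_ofFn, signed_apply, hs, zsmul_eq_mul, ← eps, _root_.sum_apply, hw']
    congr 1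
    rw [← smul_eq_mul, ← map_smul, ← map_neg]
    conv_rhs => rw [← sum_dualBasis_smul (tildeSymp 𝒱 ℳ) (doubleSymp_nondegenerate _)
      (Module.finBasis K (Tilde K V M)) c.val]
    rw [Finset.smul_sum, ← Finset.sum_neg_distrib, map_sum]
    refine Finset.sum_congr rfl fun i _ => ?_
    -- The bracket contains `B (c, e i)`, whereas the expansion in dual bases uses `B (e i, c)`.
    have hB := doubleSymp_comm c.mem (((tildeSymp 𝒱 ℳ).dualBasis (doubleSymp_nondegenerate _)
      (Module.finBasis K (Tilde K V M))) i)
    rw [tensorForm_apply, smul_smul, map_neg, map_smul, smul_eq_mul, par_def, ← neg_mul,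
      ← hB, hcdef, ← tildeQ_apply hq hM a b
        (fun j : Fin 2 => (Y (finCongr (by omega) (Fin.castAdd k j))).val) rfl rfl]
    have hX : (fun j : Fin k => (Y (finCongr (by omega) (Fin.natAdd 2 j))).val) =
        fun j => (X j).val := by
      funext j
      have : finCongr (show 2 + k = k + 1 + 1 by omega) (Fin.natAdd 2 j) = j.succ.succ := by
        ext
        simp
      rw [this]
      rfl
    rw [contractLast_formOf, hX]
    rfl
  rw [key, Pi.smul_apply, mulHead_cons, ← hcdef, rot_eq_concat ((isCyclic_iff Λ).1 hc), smul_eq_mul]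
  -- When the value is not zero, the degree of `Λ` determines the parity of `w`, and all signs that
  -- depend on `a` and `b` cancel.
  by_cases h0 : ev Λ (c :: w) = 0
  · rw [h0]; simp
  · have hd := (hasDegree_scalar_iff.1 hΛ) _ h0
    have hp : wpar w = par a + par b + 1 + f := by
      have := congrArg (Int.cast (R := ZMod 2)) hd
      rw [Int.cast_add, intCast_wdeg, wpar_cons, oddMul_letterMul _ a b, Int.cast_zero] at this
      rw [← sub_eq_zero, CharTwo.sub_eq_add, ← this]
      ring
    rw [hp, oddMul_letterMul _ a b]
    have : eps K (f * (par a + par b)) * (-(eps K (par a + par b + 1) *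
        (eps K ((par a + par b + 1) * (par a + par b + 1 + f)) * ev Λ (c :: w)))) =
        -eps K (f * (par a + par b) + (par a + par b + 1) +
          (par a + par b + 1) * (par a + par b + 1 + f)) * ev Λ (c :: w) := by
      simp only [eps_add]
      ring
    rw [this]
    congr 3
    generalize (f : ZMod 2) = x
    generalize par a = y
    generalize par b = z
    revert x y z
    decide

end Bracket

/-! ### The Pinczon differential -/

section PinczonD

variable {K V M : Type*} [Field K] [AddCommGroup V] [Module K V] [AddCommGroup M] [Module K M]
  {𝒱 : ℤ → Submodule K V} [DirectSum.Decomposition 𝒱]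
  {ℳ : ℤ → Submodule K M} [DirectSum.Decomposition ℳ]
  {q : V →ₗ[K] V →ₗ[K] V} {lact : V →ₗ[K] M →ₗ[K] M}
  [FiniteDimensional K V] [FiniteDimensional K M]
  (hq : IsCommAlgebra 𝒱 q) (hM : IsAlgebraModule 𝒱 ℳ q lact)
  {f : ℤ} {k : ℕ} {Λ Λ' : MultilinearMap K (fun _ : Fin (k + 1) => Tilde K V M) K}

lemma ShVanish.smul {L : Type*} [HasParity L] {F : List L → K} (h : ShVanish F) (c : K) :
    ShVanish fun w => c * F w :=
  fun u v hu hv => by rw [sh_mul_left, h u v hu hv, mul_zero]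

-- Cyclicity comes from the cyclic sum. Vanishing on shuffles comes from writing that sum as `bar`
-- plus the wrap-around term, to which `shVanish_bar_add_rot` applies.
include hq hM in
lemma pinczonD_mem (hΛ : Λ ∈ cyclicVsp (tildeGrading 𝒱 ℳ) f k) :
    pinczonD 𝒱 ℳ q lact f Λ ∈ cyclicVsp (tildeGrading 𝒱 ℳ) (f + 1) (k + 1) := by
  have e := ev_pinczonD hq hM hΛ.1 hΛ.2.1
  have hr := (isCyclic_iff Λ).1 hΛ.2.1
  have hs := suppLen_ev (ℰ := tildeGrading 𝒱 ℳ) Λ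
  have ho := oddMul_letterMul (isCommAlgebra_tilde hq hM)
  refine ⟨?_, ?_, ?_⟩
  · rw [hasDegree_scalar_iff, e]
    exact (((hasDegree_scalar_iff.1 hΛ.1).mulHead _).cyc _).mul_left _
  · rw [isCyclic_iff, e, map_smul]
    congr 1
    refine SuppLen.rot_cyc ?_
    rw [← mulAt_zero]
    exact hs.mulAt 0
  · rw [contractLast_shVanish_iff]
    intro y
    rw [e, hs.cyc_mulHead_of_rot_eq ho (Nat.succ_ne_zero k) hr]
    exact (shVanish_bar_add_rot ho (commOn_ev _ Λ) hr
      (contractLast_shVanish_iff.1 hΛ.2.2) y).smul _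

include hq hM in
lemma pinczonD_add (hΛ : Λ ∈ cyclicVsp (tildeGrading 𝒱 ℳ) f k)
    (hΛ' : Λ' ∈ cyclicVsp (tildeGrading 𝒱 ℳ) f k) :
    pinczonD 𝒱 ℳ q lact f (Λ + Λ') = pinczonD 𝒱 ℳ q lact f Λ + pinczonD 𝒱 ℳ q lact f Λ' := by
  have h := Submodule.add_mem _ hΛ hΛ'
  refine ev_injective (ℰ := tildeGrading 𝒱 ℳ) fun w => ?_
  have e : (ev (Λ + Λ') : List (Letter (tildeGrading 𝒱 ℳ)) → K) = ev Λ + ev Λ' :=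
    funext fun w => ev_add _ _ w
  rw [ev_add, ev_pinczonD hq hM hΛ.1 hΛ.2.1, ev_pinczonD hq hM hΛ'.1 hΛ'.2.1,
    ev_pinczonD hq hM h.1 h.2.1, e, ← mulAt_zero, ← mulAt_zero, ← mulAt_zero, map_add, map_add,
    smul_add, Pi.add_apply]

include hq hM in
lemma pinczonD_smul (hΛ : Λ ∈ cyclicVsp (tildeGrading 𝒱 ℳ) f k) (r : K) :
    pinczonD 𝒱 ℳ q lact f (r • Λ) = r • pinczonD 𝒱 ℳ q lact f Λ := by
  have h := Submodule.smul_mem _ r hΛ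
  refine ev_injective (ℰ := tildeGrading 𝒱 ℳ) fun w => ?_
  have e : (ev (r • Λ) : List (Letter (tildeGrading 𝒱 ℳ)) → K) = r • ev Λ :=
    funext fun w => ev_smul _ _ w
  rw [ev_smul, ev_pinczonD hq hM hΛ.1 hΛ.2.1, ev_pinczonD hq hM h.1 h.2.1, e, ← mulAt_zero,
    ← mulAt_zero, map_smul, map_smul, smul_comm, Pi.smul_apply]

-- Applied to a cyclic sum, `d_P` is the cyclic sum of `bar`; its square is thus governed by `bar² =
-- 0`.
include hq hM in
lemma pinczonD_pinczonD [CharZero K] (hΛ : Λ ∈ cyclicVsp (tildeGrading 𝒱 ℳ) f k) :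
    pinczonD 𝒱 ℳ q lact (f + 1) (pinczonD 𝒱 ℳ q lact f Λ) = 0 := by
  have h := pinczonD_mem hq hM hΛ
  have hs := suppLen_ev (ℰ := tildeGrading 𝒱 ℳ) Λ
  have ho := oddMul_letterMul (isCommAlgebra_tilde hq hM)
  set D : (List (Letter (tildeGrading 𝒱 ℳ)) → K) →ₗ[K] (List (Letter (tildeGrading 𝒱 ℳ)) → K) :=
    mulAt (tildeMul hq hM) 0 with hD
  have e1 : (ev (pinczonD 𝒱 ℳ q lact f Λ) : List (Letter (tildeGrading 𝒱 ℳ)) → K) =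
      (-eps K f) • cyc (k + 2) (D (ev Λ)) := by
    rw [ev_pinczonD hq hM hΛ.1 hΛ.2.1, hD, mulAt_zero]
  have e2 : (ev (pinczonD 𝒱 ℳ q lact (f + 1) (pinczonD 𝒱 ℳ q lact f Λ)) :
      List (Letter (tildeGrading 𝒱 ℳ)) → K) = (-eps K (f + 1 : ℤ)) • cyc (k + 1 + 2)
        (D (ev (pinczonD 𝒱 ℳ q lact f Λ))) := by
    rw [ev_pinczonD hq hM h.1 h.2.1, hD, mulAt_zero]
  have hn : ((k + 1 : ℕ) : K) ≠ 0 := Nat.cast_ne_zero.2 (Nat.succ_ne_zero k)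
  -- Division by `k + 1`, the order of the cyclic group, is where characteristic `0` is used.
  have e3 : (ev Λ : List (Letter (tildeGrading 𝒱 ℳ)) → K) =
      ((k + 1 : ℕ) : K)⁻¹ • cyc (k + 1) (ev Λ) := by
    rw [cyc_of_rot_eq ((isCyclic_iff Λ).1 hΛ.2.1), smul_smul, inv_mul_cancel₀ hn, one_smul]
  have a1 : cyc (k + 2) (D (cyc (k + 1) (ev Λ))) = cyc (k + 2) (bar (tildeMul hq hM) (ev Λ)) := by
    rw [hD, mulAt_zero]
    exact hs.cyc_mulHead_cyc ho
  have a2 : cyc (k + 1 + 2) (D (cyc (k + 2) (bar (tildeMul hq hM) (ev Λ)))) =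
      cyc (k + 1 + 2) (bar (tildeMul hq hM) (bar (tildeMul hq hM) (ev Λ))) := by
    rw [hD, mulAt_zero]
    exact hs.bar.cyc_mulHead_cyc ho
  refine eq_zero_of_ev (ℰ := tildeGrading 𝒱 ℳ) fun w => ?_
  rw [e2, e1, e3]
  simp only [map_smul]
  rw [a1, a2]
  have : bar (tildeMul hq hM) (bar (tildeMul hq hM) (ev Λ)) = 0 :=
    funext fun w => bar_bar ho (assocOn_ev _ Λ) w
  rw [this, map_zero, smul_zero, smul_zero, smul_zero]
  rfl

end PinczonD

/-! ### Cochains as cyclic forms -/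

section CochainForm

variable {K V M : Type*} [Field K] [AddCommGroup V] [Module K V] [AddCommGroup M] [Module K M]
  {𝒱 : ℤ → Submodule K V} [DirectSum.Decomposition 𝒱]
  {ℳ : ℤ → Submodule K M} [DirectSum.Decomposition ℳ]

lemma wpar_map {L L' : Type*} [HasParity L] [HasParity L'] {g : L → L'}
    (hg : ∀ a, par (g a) = par a) (w : List L) : wpar (w.map g) = wpar w := by
  induction w with
  | nil => rfl
  | cons a w ih => rw [List.map_cons, wpar_cons, wpar_cons, ih, hg]

lemma sh_map {L L' : Type*} [HasParity L] [HasParity L'] (g : L → L')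
    (hg : ∀ a, par (g a) = par a) (F : List L' → K) (u v : List L) :
    sh (fun w => F (w.map g)) u v = sh F (u.map g) (v.map g) := by
  refine word_induction (K := K) (P := fun _ u v => ∀ F : List L' → K,
    sh (fun w => F (w.map g)) u v = sh F (u.map g) (v.map g)) ?_ ?_ ?_ 0 u v F
  · simp
  · simp
  · intro _ a u b v h1 h2 F
    rw [sh_cons_cons, List.map_cons, List.map_cons, sh_cons_cons, hg, wpar_cons, wpar_cons,
      hg, wpar_map hg]
    simp only [List.map_cons]
    rw [h1 0 (fun w => F (g a :: w)), h2 0 (fun w => F (g b :: w)), List.map_cons, List.map_cons]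

lemma bar_map {L L' : Type*} [HasParity L] [HasParity L'] {Q : L → L → L} {Q' : L' → L' → L'}
    (g : L → L') (hg : ∀ a, par (g a) = par a) (hQ : ∀ a b, g (Q a b) = Q' (g a) (g b))
    (F : List L' → K) (w : List L) :
    bar Q (fun w => F (w.map g)) w = bar Q' F (w.map g) := by
  induction w generalizing F with
  | nil => rfl
  | cons a w ih =>
    rw [bar_cons, List.map_cons, bar_cons, hg]
    simp only [List.map_cons]
    rw [ih (fun w => F (g a :: w))]
    rcases w with _ | ⟨b, w⟩ <;> simp [hQ]

/-- The component in `V[1]` of a letter of `Ṽ[1]`. -/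
def Letter.fstV (a : Letter (tildeGrading 𝒱 ℳ)) : Letter (shift 𝒱) := ⟨a.deg, a.val.1.1, a.mem.1.1⟩

/-- The component in the dual of `M` of an element of `Ṽ`. -/
def dualM : Tilde K V M →ₗ[K] Module.Dual K M :=
  (LinearMap.lcomp K K (LinearMap.inr K V M)) ∘ₗ LinearMap.snd K _ _

lemma dualM_apply (x : Tilde K V M) (m : M) : dualM x m = x.2 (0, m) := rfl

/-- An element of `V` as a letter of `Ṽ[1]`. -/
def Letter.inlV (a : Letter (shift 𝒱)) : Letter (tildeGrading 𝒱 ℳ) where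
  deg := a.deg
  val := ((a.val, 0), 0)
  mem := ⟨⟨a.mem, Submodule.zero_mem _⟩, Submodule.zero_mem _⟩

/-- A homogeneous form on `M` as a letter of `Ṽ[1]`. -/
def dualLetter {n : ℤ} {h : Module.Dual K M} (hh : h ∈ dualGrading ℳ (n + 1)) :
    Letter (tildeGrading 𝒱 ℳ) where
  deg := n
  val := (0, h ∘ₗ LinearMap.snd K V M)
  mem := ⟨Submodule.zero_mem _, fun m hm _ hx => hh m hm _ hx.2⟩

variable [FiniteDimensional K V] [FiniteDimensional K M]

/-- The signs from `deg v` and from `|w|` differ by one in the exponent, so their product is `-1` in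
every degree and the formula holds for inhomogeneous `m` as well. -/
lemma tildeSymp_inr (m : M) (y : Tilde K V M) :
    tildeSymp 𝒱 ℳ ((0, m), 0) y = -dualM y m := by
  induction m using DirectSum.Decomposition.inductionOn ℳ with
  | zero =>
    have : (((0 : V), (0 : M)), (0 : Module.Dual K (V × M))) = 0 := rfl
    simp [this]
  | add m m' h h' =>
    have : (((0 : V), m + m'), (0 : Module.Dual K (V × M))) =
      (((0 : V), m), (0 : Module.Dual K (V × M))) + ((0, m'), 0) := by simp
    rw [this, map_add, LinearMap.add_apply, h, h', map_add]
    ring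
  | @homogeneous i m =>
    have hm : (((0 : V), (m : M)), (0 : Module.Dual K (V × M))) ∈ tildeGrading 𝒱 ℳ (i - 1) := by
      refine ⟨⟨Submodule.zero_mem _, ?_⟩, Submodule.zero_mem _⟩
      rw [sub_add_cancel]
      exact m.2
    rw [tildeSymp, doubleSymp_of_mem hm, eps_add, eps_one, dualM_apply]
    simp only [LinearMap.zero_apply, zero_add]
    linear_combination (-(y.2 (0, (m : M)))) * eps_mul_self (K := K) ((i - 1 : ℤ) : ZMod 2)

variable {k : ℕ} (c : MultilinearMap K (fun _ : Fin k => V) M)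

variable (𝒱 ℳ) in
/-- The function on words given by the form `Ω_C'`. -/
def preForm : List (Letter (tildeGrading 𝒱 ℳ)) → K := ev (formOf (tildeSymp 𝒱 ℳ) (tildePre 𝒱 c))

lemma preForm_concat (w : List (Letter (tildeGrading 𝒱 ℳ))) (y : Letter (tildeGrading 𝒱 ℳ)) :
    preForm 𝒱 ℳ c (w ++ [y]) = -dualM y.val (ev (shiftMap 𝒱 c) (w.map Letter.fstV)) := by
  rw [preForm, ev_formOf, ← tildeSymp_inr (𝒱 := 𝒱) (ℳ := ℳ)]
  congr 2
  by_cases hw : w.length = k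
  · obtain ⟨X, rfl⟩ := exists_ofFn_eq hw
    rw [ev_ofFn, List.map_ofFn, ev_ofFn]
    rfl
  · rw [ev_of_length_ne _ hw, ev_of_length_ne _ (by simpa using hw)]
    rfl

lemma preForm_nil : preForm 𝒱 ℳ c [] = 0 := ev_of_length_ne _ (by simp)

lemma suppLen_preForm : SuppLen (k + 1) (preForm 𝒱 ℳ c) := suppLen_ev _

lemma preForm_concat_of_dualM {w : List (Letter (tildeGrading 𝒱 ℳ))}
    {y : Letter (tildeGrading 𝒱 ℳ)} (h : dualM y.val = 0) : preForm 𝒱 ℳ c (w ++ [y]) = 0 := by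
  rw [preForm_concat, h, LinearMap.zero_apply, neg_zero]

lemma preForm_concat_of_fst {w : List (Letter (tildeGrading 𝒱 ℳ))}
    {a y : Letter (tildeGrading 𝒱 ℳ)} (ha : a ∈ w) (h : a.val.1.1 = 0) :
    preForm 𝒱 ℳ c (w ++ [y]) = 0 := by
  obtain ⟨s, t, rfl⟩ := List.append_of_mem ha
  rw [preForm_concat, List.map_append, List.map_cons,
    ev_replace (b := a.fstV) _ (0 : K) (by rw [zero_smul]; exact h), zero_smul, map_zero, neg_zero]

variable (𝒱 ℳ) in
/-- The cyclic form `Ω_C̃` of a cochain. -/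
def cochainForm : MultilinearMap K (fun _ : Fin (k + 1) => Tilde K V M) K :=
  formOf (tildeSymp 𝒱 ℳ) (tildeC 𝒱 ℳ c)

lemma ev_cochainForm : (ev (cochainForm 𝒱 ℳ c) : List (Letter (tildeGrading 𝒱 ℳ)) → K) =
    cyc (k + 1) (preForm 𝒱 ℳ c) := by
  rw [cochainForm, tildeC, formOf_mapOf, ev_cyclicSum, preForm]

lemma rot_ev_cochainForm : rot (ev (cochainForm 𝒱 ℳ c) : List (Letter (tildeGrading 𝒱 ℳ)) → K) =
    ev (cochainForm 𝒱 ℳ c) := by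
  rw [ev_cochainForm]
  exact (suppLen_preForm c).rot_cyc

/-- On words that end with a letter without component in `V`, there is only one term in the cyclic
sum. -/
lemma ev_cochainForm_concat (w : List (Letter (tildeGrading 𝒱 ℳ)))
    {y : Letter (tildeGrading 𝒱 ℳ)} (hy : y.val.1.1 = 0) :
    ev (cochainForm 𝒱 ℳ c) (w ++ [y]) =
      -dualM y.val (ev (shiftMap 𝒱 c) (w.map Letter.fstV)) := by
  rw [← preForm_concat, ev_cochainForm]
  by_cases hw : w.length = k
  · rw [cyc_apply, Finset.sum_apply, Finset.sum_eq_single 0]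
    · rfl
    -- In any other rotation `y` becomes an argument of `C`, which only sees its component in `V`,
    -- and this is zero.
    · intro i hi hi0
      have hik : i < k + 1 := by simpa using hi
      obtain ⟨j, rfl⟩ := Nat.exists_eq_succ_of_ne_zero hi0
      obtain ⟨u, a, v, rfl, hv⟩ : ∃ u a v, w = u ++ [a] ++ v ∧ v.length = j := by
        refine ⟨(w.take (k - j)).dropLast, (w.take (k - j)).getLast ?_, w.drop (k - j), ?_, ?_⟩
        · rw [← List.length_pos_iff, List.length_take]; omega
        · rw [List.dropLast_append_getLast, List.take_append_drop]
        · rw [List.length_drop]; omega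
      have := rot_pow_append (preForm 𝒱 ℳ c) (u ++ [a]) (v ++ [y])
      rw [List.length_append, List.length_singleton, hv] at this
      rw [← List.append_assoc] at this
      rw [this, ← List.append_assoc, preForm_concat_of_fst c (a := y) (by simp) hy, mul_zero]
    · simp
  · rw [(suppLen_preForm c) _ (by simpa using hw),
      ((suppLen_preForm c).cyc _) _ (by simpa using hw)]

/-- Every term of the cyclic sum evaluates the `M*` component of some letter of the word. -/
lemma ev_cochainForm_eq_zero {w : List (Letter (tildeGrading 𝒱 ℳ))}
    (h : ∀ a ∈ w, dualM a.val = 0) : ev (cochainForm 𝒱 ℳ c) w = 0 := by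
  rw [ev_cochainForm, cyc_apply, Finset.sum_apply]
  have key (F : List (Letter (tildeGrading 𝒱 ℳ)) → K)
      (hF : ∀ w, (∀ a ∈ w, dualM a.val = 0) → F w = 0) (w : List (Letter (tildeGrading 𝒱 ℳ)))
      (h : ∀ a ∈ w, dualM a.val = 0) : rot F w = 0 := by
    induction w using List.reverseRecOn with
    | nil => exact hF [] (by simp)
    | append_singleton w c =>
      rw [rot_concat, hF _ (fun a ha => h a (by simpa [or_comm] using ha)), mul_zero]
  refine Finset.sum_eq_zero fun i hi => ?_
  clear hi
  induction i generalizing w with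
  | zero =>
    rw [pow_zero, Module.End.one_apply]
    induction w using List.reverseRecOn with
    | nil => exact preForm_nil c
    | append_singleton w y => exact preForm_concat_of_dualM c (h y (by simp))
  | succ i ih =>
    rw [pow_succ', Module.End.mul_apply]
    exact key _ (fun w hw => ih hw) w h

/-- The homogeneous elements that are either in the dual of `M` or have no component there. -/
lemma span_pure : Submodule.span K {x : Tilde K V M | (∃ n, x ∈ tildeGrading 𝒱 ℳ n) ∧
    (x.1.1 = 0 ∨ dualM x = 0)} = ⊤ := by
  rw [← top_le_iff, ← span_homogeneous (ℰ := tildeGrading 𝒱 ℳ), Submodule.span_le]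
  rintro x ⟨n, hx⟩
  have hy : (((0 : V × M), dualM x ∘ₗ LinearMap.snd K V M) : Tilde K V M) ∈
      tildeGrading 𝒱 ℳ n :=
    ⟨Submodule.zero_mem _, fun m hm z hz => hx.2 m hm (0, z.2) ⟨Submodule.zero_mem _, hz.2⟩⟩
  rw [← sub_add_cancel x ((0 : V × M), dualM x ∘ₗ LinearMap.snd K V M)]
  refine Submodule.add_mem _ (Submodule.subset_span ⟨⟨n, Submodule.sub_mem _ hx hy⟩, Or.inr ?_⟩)
    (Submodule.subset_span ⟨⟨n, hy⟩, Or.inl rfl⟩)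
  rw [map_sub, sub_eq_zero]
  ext m
  simp [dualM_apply]

variable {c} {e : ℤ}

/-- Only one term of the cyclic sum remains, and it is a functional applied to `C`; skew shuffles
for `c` are shuffles for `C`. -/
lemma shVanish_cochainForm (hc : c ∈ harrisonCochains 𝒱 ℳ e k) {a : Letter (tildeGrading 𝒱 ℳ)}
    (ha : a.val.1.1 = 0) : ShVanish fun w => ev (cochainForm 𝒱 ℳ c) (w ++ [a]) := by
  intro u v hu hv
  simp only [ev_cochainForm_concat c _ ha]
  have h1 := ((vanishesOnShuffles_shiftMap.2 hc.2).comp (-dualM a.val)).shVanish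
  have h2 := h1 (u.map Letter.fstV) (v.map Letter.fstV) (by simpa using hu) (by simpa using hv)
  rw [← sh_map Letter.fstV fun _ => rfl] at h2
  simpa only [ev_comp, LinearMap.neg_apply] using h2

lemma cochainForm_mem (hc : c ∈ harrisonCochains 𝒱 ℳ e k) :
    cochainForm 𝒱 ℳ c ∈ cyclicVsp (tildeGrading 𝒱 ℳ) (e + k + 1) k := by
  refine ⟨?_, (isCyclic_iff _).2 (rot_ev_cochainForm c), ?_⟩
  · rw [hasDegree_scalar_iff, ev_cochainForm]
    refine DegSupp.cyc ?_ _
    intro w hw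
    induction w using List.reverseRecOn with
    | nil => exact absurd (preForm_nil c) hw
    | append_singleton w y =>
      have hwk : w.length = k := by
        by_contra hne
        exact hw (suppLen_preForm c _ (by simpa using hne))
      rw [preForm_concat, neg_ne_zero] at hw
      obtain ⟨X, rfl⟩ := exists_ofFn_eq hwk
      rw [List.map_ofFn, ev_ofFn, shiftMap_apply, map_smul] at hw
      have hm := hc.1 (fun i => (X i).deg + 1) (fun i => (X i).val.1.1) fun i => (X i).mem.1.1
      by_contra hne
      refine right_ne_zero_of_mul hw (y.mem.2 _ ?_ _ ⟨Submodule.zero_mem _, hm⟩)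
      intro h
      refine hne ?_
      rw [wdeg_append, wdeg_ofFn, wdeg_cons, wdeg_nil]
      rw [Finset.sum_add_distrib] at h
      simp at h
      linarith
  -- Each letter may be assumed to have no component in `V` or none in `M*`. If some letter has no
  -- component in `V`, it is the last one or can be rotated to the end.
  · refine vanishesOnShuffles_contractLast_of_span (span_pure (𝒱 := 𝒱) (ℳ := ℳ))
      (fun x hx => hx.1) fun y u v hy hu hv huv => ?_
    have hr := rot_ev_cochainForm (𝒱 := 𝒱) (ℳ := ℳ) c
    by_cases hy1 : y.val.1.1 = 0
    · exact shVanish_cochainForm hc hy1 u v hu hv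
    by_cases h1 : ∃ a ∈ u, a.val.1.1 = 0
    · obtain ⟨a, ha, ha0⟩ := h1
      obtain ⟨s, t, rfl⟩ := List.append_of_mem ha
      exact sh_eq_zero_of_rot_eq hr (shVanish_cochainForm hc ha0) s t v hv y
    by_cases h2 : ∃ a ∈ v, a.val.1.1 = 0
    · obtain ⟨a, ha, ha0⟩ := h2
      obtain ⟨s, t, rfl⟩ := List.append_of_mem ha
      rw [sh_comm, sh_eq_zero_of_rot_eq hr (shVanish_cochainForm hc ha0) s t u hu y, mul_zero]
    -- Now every letter has a component in `V`, hence none in `M*`, and the form vanishes term by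
    -- term.
    refine sh_eq_zero fun w hw => ev_cochainForm_eq_zero c fun a ha => ?_
    rw [List.mem_append, List.mem_singleton] at ha
    rcases ha with ha | rfl
    · have ha' := hw.mem_iff.1 ha
      refine (huv a ha').2.resolve_left fun h => ?_
      rcases List.mem_append.1 ha' with h' | h'
      exacts [h1 ⟨a, h', h⟩, h2 ⟨a, h', h⟩]
    · exact hy.2.resolve_left hy1

end CochainForm

/-! ### The Harrison coboundary on words -/

section HarrisonWords

variable {K V M W : Type*} [Field K] [AddCommGroup V] [Module K V] [AddCommGroup M] [Module K M]
  [AddCommGroup W] [Module K W]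
  {𝒱 : ℤ → Submodule K V} {ℳ : ℤ → Submodule K M}
  {q : V →ₗ[K] V →ₗ[K] V} {lact : V →ₗ[K] M →ₗ[K] M} {k : ℕ} {e : ℤ}

/-- The exponent of the sign relating a map on `V` to the corresponding map on `V[1]`. -/
def shiftExp {L : Type*} [HasParity L] : List L → ZMod 2
  | [] => 0
  | a :: w => w.length * par a + shiftExp w

@[simp] lemma shiftExp_cons {L : Type*} [HasParity L] (a : L) (w : List L) :
    shiftExp (a :: w) = w.length * par a + shiftExp w := rfl

lemma shiftExp_concat {L : Type*} [HasParity L] (w : List L) (z : L) :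
    shiftExp (w ++ [z]) = shiftExp w + wpar w := by
  induction w with
  | nil => simp
  | cons a w ih =>
    rw [List.cons_append, shiftExp_cons, ih, shiftExp_cons, wpar_cons, List.length_append]
    push_cast [List.length_singleton]
    ring

lemma shiftExp_ofFn {L : Type*} [HasParity L] (X : Fin k → L) :
    shiftExp (List.ofFn X) = ∑ j : Fin k, ((k - (j + 1) : ℕ) : ZMod 2) * par (X j) := by
  induction k with
  | zero => rfl
  | succ k ih =>
    rw [List.ofFn_succ, shiftExp_cons, ih, Fin.sum_univ_succ, List.length_ofFn]
    simp

lemma ev_contractAt_zero (c : MultilinearMap K (fun _ : Fin (k + 1) => V) W)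
    (a b : Letter (shift 𝒱)) (t : List (Letter (shift 𝒱))) :
    ev (contractAt q 0 c) (a :: b :: t) = ev (c.curryLeft (q a.val b.val)) t := by
  by_cases ht : t.length = k
  · obtain ⟨X, rfl⟩ := exists_ofFn_eq ht
    rw [← List.ofFn_cons, ← List.ofFn_cons, ev_ofFn, ev_ofFn, MultilinearMap.curryLeft_apply]
    change c _ = _
    congr 1
    funext i
    refine Fin.cases ?_ (fun i => ?_) i
    · simp [Fin.contractNth]
    · simp [Fin.contractNth]
  · rw [ev_of_length_ne _ ht, ev_of_length_ne _ (by simpa using ht)]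

lemma curryLeft_contractAt_succ (c : MultilinearMap K (fun _ : Fin (k + 1) => V) W) (r : Fin k)
    (x : V) : (contractAt q r.succ c).curryLeft x = contractAt q r (c.curryLeft x) := by
  ext v
  rw [MultilinearMap.curryLeft_apply]
  change c _ = c _
  congr 1
  funext i
  refine Fin.cases ?_ (fun i => ?_) i
  · simp [Fin.contractNth]
  · simp only [Fin.contractNth, Fin.cons_succ, Fin.val_succ, Fin.val_castSucc,
      Nat.add_lt_add_iff_right, Nat.add_right_cancel_iff]
    rfl

lemma ev_rightActOn (ract : M →ₗ[K] V →ₗ[K] M) (c : MultilinearMap K (fun _ : Fin k => V) M)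
    (w : List (Letter (shift 𝒱))) (z : Letter (shift 𝒱)) :
    ev (rightActOn ract c) (w ++ [z]) = ract (ev c w) z.val := by
  by_cases hw : w.length = k
  · obtain ⟨X, rfl⟩ := exists_ofFn_eq hw
    rw [← ofFn_snoc, ev_ofFn, ev_ofFn, rightActOn, MultilinearMap.uncurryRight_apply]
    simp only [Fin.snoc_last]
    change ract (c _) z.val = _
    congr 3
    funext i
    simp [Fin.init]
  · rw [ev_of_length_ne _ hw, ev_of_length_ne _ (by simpa using hw), map_zero,
      LinearMap.zero_apply]

/-- The signs depending on the letters agree on both sides: those of the shift, of the product on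
`V[1]` and of the odd product passing the preceding letters. Only a sign depending on the position
is left. -/
lemma ev_contractAt (hq : IsCommAlgebra 𝒱 q) (r : Fin k)
    (c : MultilinearMap K (fun _ : Fin k => V) K) (w : List (Letter (shift 𝒱))) :
    eps K (shiftExp w) * ev (contractAt q r c) w =
      eps K (k + r + 1) * mulAt (letterMul hq) r (fun t => eps K (shiftExp t) * ev c t) w := by
  by_cases hw : w.length = k + 1
  swap
  · have h : SuppLen k fun t : List (Letter (shift 𝒱)) => eps K (shiftExp t) * ev c t :=
      fun t ht => mul_eq_zero_of_right _ (ev_of_length_ne _ ht)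
    rw [ev_of_length_ne _ hw, h.mulAt _ _ hw, mul_zero, mul_zero]
  induction k generalizing w with
  | zero => exact r.elim0
  | succ k ih =>
    rcases w with _ | ⟨a, w⟩
    · simp at hw
    refine Fin.cases ?_ (fun r => ?_) r
    · rcases w with _ | ⟨b, t⟩
      · simp at hw
      have ht : t.length = k := by simpa using hw
      rw [ev_contractAt_zero, Fin.val_zero, mulAt_zero, mulHead_cons, ev_cons]
      have h1 : (letterMul hq a b).val = eps K (par a) • q a.val b.val := rfl
      rw [h1, map_smul, ev_smul, smul_eq_mul, ← mul_assoc, ← mul_assoc, ← eps_add, ← eps_add]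
      congr 2
      rw [shiftExp_cons, shiftExp_cons, shiftExp_cons, oddMul_letterMul hq a b, List.length_cons,
        ht]
      push_cast
      generalize par a = x
      generalize par b = y
      generalize shiftExp t = s
      generalize (k : ZMod 2) = k
      revert x y s k
      decide
    · have hw' : w.length = k + 1 := by simpa using hw
      rw [ev_cons, curryLeft_contractAt_succ, shiftExp_cons, eps_add, mul_assoc, ih _ _ _ hw',
        Fin.val_succ, mulAt_succ_cons]
      -- On words of length `k`, prefixing `a` changes the shift exponent by the constant `k * par
      -- a`; on other lengths both sides are zero.
      have e1 : (fun t : List (Letter (shift 𝒱)) => eps K (shiftExp (a :: t)) * ev c (a :: t)) =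
          eps K (k * par a) • fun t => eps K (shiftExp t) * ev (c.curryLeft a.val) t := by
        funext t
        rw [ev_cons, Pi.smul_apply, smul_eq_mul, shiftExp_cons]
        by_cases ht : t.length = k
        · rw [ht, eps_add, mul_assoc]
        · rw [ev_of_length_ne _ ht, mul_zero, mul_zero, mul_zero]
      rw [e1, map_smul, Pi.smul_apply, smul_eq_mul, hw', ← mul_assoc, ← mul_assoc, ← mul_assoc,
        ← eps_add, ← eps_add, ← eps_add]
      congr 2
      push_cast
      generalize par a = x
      generalize ((r : ℕ) : ZMod 2) = s
      generalize (k : ZMod 2) = k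
      revert x s k
      decide

variable [DirectSum.Decomposition 𝒱] [DirectSum.Decomposition ℳ]

lemma ev_shiftMap (c : MultilinearMap K (fun _ : Fin k => V) W) (w : List (Letter (shift 𝒱))) :
    ev (shiftMap 𝒱 c) w = eps K (shiftExp w) • ev c w := by
  by_cases hw : w.length = k
  · obtain ⟨X, rfl⟩ := exists_ofFn_eq hw
    rw [ev_ofFn, ev_ofFn, shiftMap_apply, shiftExp_ofFn]
  · rw [ev_of_length_ne _ hw, ev_of_length_ne _ hw, smul_zero]

variable (𝒱) in
/-- The term `x₁ · c (x₂, …, x_{k+1})` of the Harrison coboundary, with its sign. -/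
def leftPart (lact : V →ₗ[K] M →ₗ[K] M) (e : ℤ) (c : MultilinearMap K (fun _ : Fin k => V) M) :
    MultilinearMap K (fun _ : Fin (k + 1) => V) M :=
  sgn e • signed 𝒱 (fun d => sgn ((e : ZMod 2) * d 0)) (leftActOn lact c)

/-- The degree of `x` in `V` is one more than in `V[1]`. The resulting additional sign `(-1) ^ e` is
cancelled by the global sign of the coboundary. -/
lemma ev_shiftMap_leftPart (c : MultilinearMap K (fun _ : Fin k => V) M) (x : Letter (shift 𝒱))
    (w : List (Letter (shift 𝒱))) :
    ev (shiftMap 𝒱 (leftPart 𝒱 lact e c)) (x :: w) =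
      eps K ((e + k) * par x) • lact x.val (ev (shiftMap 𝒱 c) w) := by
  by_cases hw : w.length = k
  · rw [ev_shiftMap, ev_shiftMap]
    obtain ⟨X, rfl⟩ := exists_ofFn_eq hw
    have h := signed_apply (ℰ := 𝒱) (fun d => sgn ((e : ZMod 2) * d 0)) (leftActOn lact c)
      (fun i => (Fin.cons x X : Fin (k + 1) → Letter (shift 𝒱)) i |>.unshift)
    have h2 : leftActOn lact c (fun i => (Fin.cons x X : Fin (k + 1) → Letter (shift 𝒱)) i
        |>.unshift.val) = lact x.val (c fun i => (X i).val) := rfl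
    rw [h2] at h
    rw [ev_ofFn, ← List.ofFn_cons, ev_ofFn, leftPart, _root_.smul_apply]
    refine Eq.trans (congrArg (fun t => _ • sgn e • t) h) ?_
    rw [map_smul, List.ofFn_cons, shiftExp_cons, List.length_ofFn, ← Int.cast_smul_eq_zsmul K,
      ← Int.cast_smul_eq_zsmul K, smul_smul, smul_smul, smul_smul]
    congr 1
    change eps K (k * par x + shiftExp (List.ofFn X)) *
      eps K (e : ZMod 2) * eps K (e * ((x.deg + 1 : ℤ) : ZMod 2)) = _
    rw [← eps_add, ← eps_add, ← eps_add, Int.cast_add, ← par_def]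
    congr 1
    push_cast
    generalize par x = x
    generalize (e : ZMod 2) = e
    generalize (k : ZMod 2) = k
    generalize shiftExp (List.ofFn X) = s
    revert x e k s
    decide
  · rw [ev_of_length_ne _ hw, ev_of_length_ne _ (by simpa using hw), map_zero, smul_zero]

/-- The Harrison coboundary in terms of the maps on `V[1]`. -/
lemma comp_ev_shiftMap_harrisonD (hq : IsCommAlgebra 𝒱 q)
    (c : MultilinearMap K (fun _ : Fin k => V) M) (h : M →ₗ[K] K)
    (w : List (Letter (shift 𝒱))) (z : Letter (shift 𝒱)) :
    h (ev (shiftMap 𝒱 (harrisonD 𝒱 ℳ q lact e c)) (w ++ [z])) =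
      h (ev (shiftMap 𝒱 (leftPart 𝒱 lact e c)) (w ++ [z])) +
        eps K (e + k) * bar (letterMul hq) (fun t => h (ev (shiftMap 𝒱 c) t)) (w ++ [z]) -
        eps K (e + k + wpar w) * h (rightAct 𝒱 ℳ lact (ev (shiftMap 𝒱 c) w) z.val) := by
  have e1 : (fun t => h (ev (shiftMap 𝒱 c) t)) =
      fun t : List (Letter (shift 𝒱)) => eps K (shiftExp t) * ev (h.compMultilinearMap c) t :=
    funext fun t => by rw [ev_shiftMap, map_smul, ev_comp, smul_eq_mul]
  have hs : SuppLen k fun t : List (Letter (shift 𝒱)) =>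
      eps K (shiftExp t) * ev (h.compMultilinearMap c) t :=
    fun t ht => mul_eq_zero_of_right _ (ev_of_length_ne _ ht)
  have e2 (r : Fin k) : eps K (shiftExp (w ++ [z])) * h (ev (contractAt q r c) (w ++ [z])) =
      eps K (k + r + 1) * mulAt (letterMul hq) r (fun t => eps K (shiftExp t) *
        ev (h.compMultilinearMap c) t) (w ++ [z]) := by
    rw [← ev_contractAt, ← ev_comp]
    rfl
  have e3 : harrisonD 𝒱 ℳ q lact e c = leftPart 𝒱 lact e c + sgn e • (∑ r : Fin k,
      sgn ((r : ℕ) + 1) • contractAt q r c) + sgn e • sgn (k + 1) •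
        rightActOn (rightAct 𝒱 ℳ lact) c := by
    rw [harrisonD, leftPart, smul_add, smul_add]
  rw [e1, hs.bar_eq, e3, ev_shiftMap, ev_add, ev_add, smul_add, smul_add, ← ev_shiftMap, map_add,
    map_add, ev_zsmul, ev_zsmul, ev_zsmul, ev_sum, ev_rightActOn, sub_eq_add_neg]
  congr 1
  · congr 1
    rw [Finset.sum_apply, Finset.sum_range, Finset.mul_sum, map_smul, map_zsmul, map_sum,
      Finset.smul_sum, Finset.smul_sum]
    refine Finset.sum_congr rfl fun r _ => ?_
    rw [ev_zsmul, map_zsmul, ← Int.cast_smul_eq_zsmul K, ← Int.cast_smul_eq_zsmul K]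
    change eps K _ * (eps K e * (eps K _ * _)) = _
    have := e2 r
    have h4 : eps K (e + k : ZMod 2) = eps K e * eps K ((r : ℕ) + 1) * eps K (k + r + 1) := by
      rw [← eps_add, ← eps_add]
      congr 1
      generalize (e : ZMod 2) = e
      generalize (k : ZMod 2) = k
      generalize ((r : ℕ) : ZMod 2) = s
      revert e k s
      decide
    rw [h4]
    linear_combination eps K (e : ZMod 2) * eps K ((r : ℕ) + 1 : ZMod 2) * this
  · rw [ev_shiftMap, map_smul, map_zsmul, map_zsmul, map_smul, LinearMap.smul_apply, map_smul,
      ← Int.cast_smul_eq_zsmul K, ← Int.cast_smul_eq_zsmul K, shiftExp_concat]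
    change eps K _ * (eps K e * (eps K _ * _)) = -(_ * (eps K _ * _))
    simp only [eps_add, eps_one]
    ring

end HarrisonWords

/-! ### Compatibility of the coboundaries -/

section ChainMap

variable {K V M : Type*} [Field K] [AddCommGroup V] [Module K V] [AddCommGroup M] [Module K M]
  {𝒱 : ℤ → Submodule K V} [DirectSum.Decomposition 𝒱]
  {ℳ : ℤ → Submodule K M} {q : V →ₗ[K] V →ₗ[K] V} {lact : V →ₗ[K] M →ₗ[K] M}
  (hq : IsCommAlgebra 𝒱 q) (hM : IsAlgebraModule 𝒱 ℳ q lact)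
  {k : ℕ} {e : ℤ} {c : MultilinearMap K (fun _ : Fin k => V) M}

-- For degree reasons the value vanishes unless the degrees add up to zero; only the parity of this
-- condition is needed for the signs.
include hM in
lemma dualM_lact_ev_eq_zero (hc : HasDegree 𝒱 ℳ e c) (w : List (Letter (tildeGrading 𝒱 ℳ)))
    (a y : Letter (tildeGrading 𝒱 ℳ)) (h : wpar w + par a + par y + k + e ≠ 0) :
    dualM a.val (lact y.val.1.1 (ev (shiftMap 𝒱 c) (w.map Letter.fstV))) = 0 := by
  by_cases hw : w.length = k
  swap
  · rw [ev_of_length_ne _ (by simpa using hw), map_zero, map_zero]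
  obtain ⟨X, rfl⟩ := exists_ofFn_eq hw
  rw [List.map_ofFn, ev_ofFn, shiftMap_apply, map_smul, map_smul]
  refine smul_eq_zero_of_right _ (a.mem.2 _ ?_ _ ⟨Submodule.zero_mem _, hM.degree _ _ _ y.mem.1.1 _
    (hc (fun i => (X i).deg + 1) (fun i => (X i).val.1.1) fun i => (X i).mem.1.1)⟩)
  intro h'
  refine h ?_
  rw [Finset.sum_add_distrib, ← wdeg_ofFn] at h'
  have := congrArg (fun n : ℤ => (n : ZMod 2)) h'
  simp only [Int.cast_add, Int.cast_neg, intCast_wdeg, ← par_def] at this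
  simp only [Finset.sum_const, Finset.card_univ, Fintype.card_fin, nsmul_eq_mul, mul_one,
    Int.cast_natCast, Int.cast_one] at this
  revert this
  generalize wpar (List.ofFn X) = w
  generalize par a = a
  generalize par y = y
  generalize (e : ZMod 2) = e
  generalize (k : ZMod 2) = k
  revert w a y e k
  decide

variable [DirectSum.Decomposition ℳ]

lemma fstV_tildeMul (a b : Letter (tildeGrading 𝒱 ℳ)) :
    (tildeMul hq hM a b).fstV = letterMul hq a.fstV b.fstV := rfl

/-- The product of `W × W*` is dual to that of `W`: one term transposes the left action and the
other the right action. These give the two outer terms of the Harrison coboundary. -/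
lemma dualM_tildeMul (a b : Letter (tildeGrading 𝒱 ℳ)) (m : M) :
    dualM (tildeMul hq hM a b).val m = eps K (par a) * dualM a.val (lact b.val.1.1 m) -
      dualM b.val (rightAct 𝒱 ℳ lact m a.val.1.1) := by
  have e1 : dualM (tildeMul hq hM a b).val m = eps K (par a) *
      (dualLeft (prodGrading 𝒱 ℳ) (semidirectMul 𝒱 ℳ q lact) a.val.1 b.val.2 (0, m) +
        dualRight (semidirectMul 𝒱 ℳ q lact) a.val.2 b.val.1 (0, m)) := rfl
  have e2 (x : V × M) : semidirectMul 𝒱 ℳ q lact (0, m) x = (0, rightAct 𝒱 ℳ lact m x.1) := by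
    simp [semidirectMul]
  have e3 (x : V × M) : semidirectMul 𝒱 ℳ q lact x (0, m) = (0, lact x.1 m) := by
    simp [semidirectMul]
  rw [e1, dualLeft_apply, dualRight_apply, parityInv_of_mem _ a.mem.1, map_zsmul, e2, e3, map_zsmul,
    ← Int.cast_smul_eq_zsmul K, dualM_apply, dualM_apply, Int.cast_add, ← par_def]
  change eps K _ * (eps K (par a + 1) * _ + _) = _
  rw [eps_add, eps_one]
  linear_combination (-b.val.2 (0, rightAct 𝒱 ℳ lact m a.val.1.1)) * eps_mul_self (K := K) (par a)

variable [FiniteDimensional K V] [FiniteDimensional K M]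

lemma preForm_leftPart (x : Letter (tildeGrading 𝒱 ℳ)) (w : List (Letter (tildeGrading 𝒱 ℳ)))
    (y : Letter (tildeGrading 𝒱 ℳ)) : preForm 𝒱 ℳ (leftPart 𝒱 lact e c) (x :: w ++ [y]) =
      -(eps K ((e + k) * par x) *
        dualM y.val (lact x.val.1.1 (ev (shiftMap 𝒱 c) (w.map Letter.fstV)))) := by
  rw [preForm_concat, List.map_cons, ev_shiftMap_leftPart, map_smul, smul_eq_mul]
  rfl

/-- On `w a y`, products inside `w a` give the inner terms of the coboundary. The product of `a` and
`y` gives the right action term and a term in which `y` acts on `C (w)`; the latter is the rotated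
left action term `rot L`. The coboundary contains `L` itself, whence the correction `L - rot L`. -/
lemma preForm_harrisonD (hc : HasDegree 𝒱 ℳ e c) :
    preForm 𝒱 ℳ (harrisonD 𝒱 ℳ q lact e c) =
      eps K (e + k) • bar (tildeMul hq hM) (preForm 𝒱 ℳ c) +
        (preForm 𝒱 ℳ (leftPart 𝒱 lact e c) - rot (preForm 𝒱 ℳ (leftPart 𝒱 lact e c))) := by
  have hl := suppLen_preForm (𝒱 := 𝒱) (ℳ := ℳ) (leftPart 𝒱 lact e c)
  refine (suppLen_preForm _).ext (fun w hw => ?_) fun w hw => ?_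
  · rw [Pi.add_apply, Pi.smul_apply, Pi.sub_apply, (suppLen_preForm c).bar _ hw, hl _ hw,
      hl.rot _ hw, smul_zero, sub_zero, add_zero]
  induction w using List.reverseRecOn with
  | nil => simp at hw
  | append_singleton u y =>
  induction u using List.reverseRecOn with
  | nil => simp at hw
  | append_singleton w a =>
  rw [Pi.add_apply, Pi.smul_apply, Pi.sub_apply, rot_concat, bar_concat_concat, ← List.cons_append,
    preForm_leftPart,
    preForm_concat, List.map_append, List.map_cons, List.map_nil,
    comp_ev_shiftMap_harrisonD hq c (dualM y.val), preForm_concat, preForm_concat, dualM_tildeMul,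
    List.map_append, List.map_cons, List.map_nil, smul_eq_mul]
  have e1 : bar (tildeMul hq hM) (fun t => preForm 𝒱 ℳ c (t ++ [y])) (w ++ [a]) =
      -bar (letterMul hq) (fun t => dualM y.val (ev (shiftMap 𝒱 c) t))
        (w.map Letter.fstV ++ [a.fstV]) := by
    have h := bar_map (Q := tildeMul hq hM) (Q' := letterMul hq) Letter.fstV (fun _ => rfl)
      (fun a b => fstV_tildeMul hq hM a b) (fun t => dualM y.val (ev (shiftMap 𝒱 c) t)) (w ++ [a])
    rw [List.map_append, List.map_cons, List.map_nil] at h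
    rw [← h, ← neg_one_mul, ← bar_mul_left]
    simp only [preForm_concat, neg_one_mul]
  have e2 : wpar (w.map Letter.fstV) = wpar w :=
    wpar_map (g := Letter.fstV) (fun _ => rfl) w
  have e3 : a.fstV.val = a.val.1.1 := rfl
  rw [e1, e2, e3, wpar_append, wpar_cons, wpar_nil, add_zero]
  -- When the parities add up to zero, the sign of the rotation agrees with that of the product;
  -- otherwise both terms vanish.
  by_cases h : wpar w + par a + par y + k + e = 0
  · have h1 : eps K (par y * (wpar w + par a)) * eps K ((e + k) * par y) =
        eps K (e + k + wpar w + par a) := by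
      rw [← eps_add]
      congr 1
      revert h
      generalize wpar w = w
      generalize par a = a
      generalize par y = y
      generalize (e : ZMod 2) = e
      generalize (k : ZMod 2) = k
      revert w a y e k
      decide
    simp only [eps_add] at h1 ⊢
    linear_combination (-dualM a.val (lact y.val.1.1 (ev (shiftMap 𝒱 c) (w.map Letter.fstV)))) * h1
  · rw [dualM_lact_ev_eq_zero hM hc w a y h]
    simp only [eps_add]
    ring

include hq hM in
/-- The map from cochains to cyclic forms is compatible with the coboundaries. -/
lemma pinczonD_cochainForm (hc : c ∈ harrisonCochains 𝒱 ℳ e k) :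
    pinczonD 𝒱 ℳ q lact (e + k + 1) (cochainForm 𝒱 ℳ c) =
      cochainForm 𝒱 ℳ (harrisonD 𝒱 ℳ q lact e c) := by
  have hm := cochainForm_mem hc
  have hl := suppLen_preForm (𝒱 := 𝒱) (ℳ := ℳ) (leftPart 𝒱 lact e c)
  refine ev_injective (ℰ := tildeGrading 𝒱 ℳ) (congrFun ?_)
  have h := (suppLen_preForm (𝒱 := 𝒱) (ℳ := ℳ) c).cyc_mulHead_cyc
    (oddMul_letterMul (isCommAlgebra_tilde hq hM))
  -- The cyclic sum is insensitive to `rot`, so it annihilates the correction `L - rot L` and leaves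
  -- `cyc (bar …)` on both sides.
  rw [ev_pinczonD hq hM hm.1 hm.2.1, ev_cochainForm, ev_cochainForm, h, preForm_harrisonD hq hM hc.1,
    map_add, map_sub, hl.cyc_rot, sub_self, add_zero, map_smul]
  congr 1
  push_cast
  rw [eps_add, eps_one]
  ring

end ChainMap

/-! ### Recovering a cochain from its cyclic form -/

section Recover

variable {K V M : Type*} [Field K] [AddCommGroup V] [Module K V] [AddCommGroup M] [Module K M]
  {𝒱 : ℤ → Submodule K V} [DirectSum.Decomposition 𝒱]
  {ℳ : ℤ → Submodule K M} [DirectSum.Decomposition ℳ]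
  {q : V →ₗ[K] V →ₗ[K] V} {lact : V →ₗ[K] M →ₗ[K] M} {k : ℕ} {e : ℤ}

/-- Precomposition with the projection turns an arbitrary form on `M` into a homogeneous one. -/
lemma homProj_eq_zero_of_dual {n : ℤ} {m : M} (h : ∀ f ∈ dualGrading ℳ (-n), f m = 0) :
    homProj ℳ n m = 0 := by
  refine (Module.forall_dual_apply_eq_zero_iff K _).1 fun f => ?_
  refine h (f ∘ₗ homProj ℳ n) fun l hl x hx => ?_
  rw [LinearMap.comp_apply, homProj_ne ℳ hx (by simpa using hl), map_zero]

lemma mem_of_dual {n : ℤ} {m : M} (h : ∀ l ≠ -n, ∀ f ∈ dualGrading ℳ l, f m = 0) : m ∈ ℳ n := by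
  classical
  rw [← DirectSum.sum_support_decompose ℳ m]
  refine Submodule.sum_mem _ fun i _ => ?_
  by_cases hi : i = n
  · rw [← hi]
    exact Subtype.prop _
  · have : (DirectSum.decompose ℳ m i : M) = 0 :=
      homProj_eq_zero_of_dual (h _ fun h => hi (neg_injective h))
    rw [this]
    exact Submodule.zero_mem _

lemma eq_zero_of_dual {m : M} (h : ∀ n, ∀ f ∈ dualGrading ℳ n, f m = 0) : m = 0 := by
  classical
  rw [← DirectSum.sum_support_decompose ℳ m]
  exact Finset.sum_eq_zero fun i _ => homProj_eq_zero_of_dual (h _)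

variable [FiniteDimensional K V] [FiniteDimensional K M]
  {c c' : MultilinearMap K (fun _ : Fin k => V) M}

/-- With letters of `V` followed by a single form on `M`, the cyclic form returns the values of `C`.
Everything about `c` can therefore be read off `Ω_C̃`. -/
lemma ev_cochainForm_dualLetter {n : ℤ} {h : Module.Dual K M} (hh : h ∈ dualGrading ℳ (n + 1))
    (w : List (Letter (shift 𝒱))) :
    ev (cochainForm 𝒱 ℳ c) (w.map Letter.inlV ++ [dualLetter hh]) =
      -h (ev (shiftMap 𝒱 c) w) := by
  rw [ev_cochainForm_concat c _ rfl, List.map_map]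
  change -h (ev _ (w.map id)) = _
  rw [List.map_id]

lemma cochainForm_add : cochainForm 𝒱 ℳ (c + c') = cochainForm 𝒱 ℳ c + cochainForm 𝒱 ℳ c' := by
  have h : preForm 𝒱 ℳ (c + c') = preForm 𝒱 ℳ c + preForm 𝒱 ℳ c' := by
    funext w
    induction w using List.reverseRecOn with
    | nil => simp [preForm_nil]
    | append_singleton w y =>
      simp only [Pi.add_apply, preForm_concat, ev_shiftMap, ev_add, smul_add, map_add, neg_add]
  refine ev_injective (ℰ := tildeGrading 𝒱 ℳ) fun w => ?_
  rw [ev_add, ev_cochainForm, ev_cochainForm, ev_cochainForm, h, map_add, Pi.add_apply]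

lemma cochainForm_smul (r : K) : cochainForm 𝒱 ℳ (r • c) = r • cochainForm 𝒱 ℳ c := by
  have h : preForm 𝒱 ℳ (r • c) = r • preForm 𝒱 ℳ c := by
    funext w
    induction w using List.reverseRecOn with
    | nil => simp [preForm_nil]
    | append_singleton w y =>
      simp only [Pi.smul_apply, preForm_concat, ev_shiftMap, ev_smul, map_smul, smul_neg,
        smul_comm r]
  refine ev_injective (ℰ := tildeGrading 𝒱 ℳ) fun w => ?_
  rw [ev_smul, ev_cochainForm, ev_cochainForm, h, map_smul, Pi.smul_apply]

lemma eq_zero_of_cochainForm (h : cochainForm 𝒱 ℳ c = 0) : c = 0 := by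
  refine eq_zero_of_ev (ℰ := shift 𝒱) fun w => eq_zero_of_dual (ℳ := ℳ) fun n f hf => ?_
  have hf' : f ∈ dualGrading ℳ (n - 1 + 1) := by rwa [sub_add_cancel]
  have h1 := ev_cochainForm_dualLetter (𝒱 := 𝒱) (c := c) hf' w
  have h2 : ev (cochainForm 𝒱 ℳ c) (w.map Letter.inlV ++ [dualLetter hf']) = 0 := by
    rw [h]
    unfold ev
    split_ifs <;> rfl
  rw [h2, ev_shiftMap, map_smul, smul_eq_mul, eq_comm, neg_eq_zero] at h1
  rw [← one_mul (f _), ← eps_mul_self (shiftExp w), mul_assoc, h1, mul_zero]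

lemma cochainForm_injective (h : cochainForm 𝒱 ℳ c = cochainForm 𝒱 ℳ c') : c = c' := by
  have : cochainForm 𝒱 ℳ (c + (-1 : K) • c') = 0 := by
    rw [cochainForm_add, cochainForm_smul, h]
    module
  have h' := eq_zero_of_cochainForm this
  have e : c - c' = c + (-1 : K) • c' := by module
  rw [← sub_eq_zero, e, h']

/-- The converse of `cochainForm_mem`: degree and skew shuffle vanishing are tested against
homogeneous forms on `M`, which separate points. -/
lemma mem_harrisonCochains_of_cochainForm_mem
    (h : cochainForm 𝒱 ℳ c ∈ cyclicVsp (tildeGrading 𝒱 ℳ) (e + k + 1) k) :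
    c ∈ harrisonCochains 𝒱 ℳ e k := by
  constructor
  · intro d x hx
    refine mem_of_dual fun l hl f hf => ?_
    by_contra hne
    set X : Fin k → Letter (shift 𝒱) := fun i =>
      ⟨d i - 1, x i, by simpa [shift] using hx i⟩ with hX
    have hf' : f ∈ dualGrading ℳ (l - 1 + 1) := by rwa [sub_add_cancel]
    have h1 := hasDegree_scalar_iff.1 h.1 ((List.ofFn X).map Letter.inlV ++ [dualLetter hf'])
    rw [ev_cochainForm_dualLetter, ev_shiftMap, map_smul, ev_ofFn, List.map_ofFn, wdeg_append,
      wdeg_ofFn, wdeg_cons, wdeg_nil, neg_ne_zero] at h1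
    have h2 := h1 fun h0 => hne <| by
      rw [← one_mul (f _), ← eps_mul_self (shiftExp (List.ofFn X)), mul_assoc]
      exact mul_eq_zero_of_right _ h0
    have h3 : ∑ i, ((Letter.inlV ∘ X) i : Letter (tildeGrading 𝒱 ℳ)).deg = ∑ i, d i - k := by
      change ∑ i, (d i - 1) = _
      simp
    rw [h3] at h2
    change _ + (l - 1 + 0) + _ = 0 at h2
    exact hl (by linarith)
  · refine vanishesOnShuffles_shiftMap.1 (vanishesOnShuffles_of_comp
      (ι := {f : Module.Dual K M // ∃ n, f ∈ dualGrading ℳ n}) (fun f => f.1)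
      (fun m hm => eq_zero_of_dual (ℳ := ℳ) fun n f hf => hm ⟨f, n, hf⟩) ?_)
    rintro ⟨f, n, hf⟩
    refine ShVanish.vanishesOnShuffles fun u v hu hv => ?_
    have hf' : f ∈ dualGrading ℳ (n - 1 + 1) := by rwa [sub_add_cancel]
    have h1 := contractLast_shVanish_iff.1 h.2.2 (dualLetter hf') (u.map Letter.inlV)
      (v.map Letter.inlV) (by simpa using hu) (by simpa using hv)
    rw [← sh_map Letter.inlV fun _ => rfl] at h1
    simp only [ev_cochainForm_dualLetter] at h1
    have h2 := sh_mul_left (-1 : K) (fun w => -f (ev (shiftMap 𝒱 c) w)) u v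
    rw [h1, mul_zero] at h2
    rw [show (ev (f.compMultilinearMap (shiftMap 𝒱 c)) : List (Letter (shift 𝒱)) → K) =
      fun w => f (ev (shiftMap 𝒱 c) w) from funext fun w => ev_comp _ _ w]
    simpa using h2

/-! ### The two complexes -/

variable (hq : IsCommAlgebra 𝒱 q) (hM : IsAlgebraModule 𝒱 ℳ q lact)

include hq hM

/-- A direct check on shuffles is avoided: the form of `d_Ha c` is `d_P` of an element of
`cyclicVsp`, and membership is reflected back to cochains. -/
lemma harrisonD_mem (hc : c ∈ harrisonCochains 𝒱 ℳ e k) :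
    harrisonD 𝒱 ℳ q lact e c ∈ harrisonCochains 𝒱 ℳ e (k + 1) := by
  refine mem_harrisonCochains_of_cochainForm_mem ?_
  rw [← pinczonD_cochainForm hq hM hc, Nat.cast_succ, ← add_assoc]
  exact pinczonD_mem hq hM (cochainForm_mem hc)

lemma harrisonD_add (hc : c ∈ harrisonCochains 𝒱 ℳ e k) (hc' : c' ∈ harrisonCochains 𝒱 ℳ e k) :
    harrisonD 𝒱 ℳ q lact e (c + c') =
      harrisonD 𝒱 ℳ q lact e c + harrisonD 𝒱 ℳ q lact e c' := by
  refine cochainForm_injective (𝒱 := 𝒱) (ℳ := ℳ) ?_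
  rw [cochainForm_add, ← pinczonD_cochainForm hq hM hc, ← pinczonD_cochainForm hq hM hc',
    ← pinczonD_cochainForm hq hM (Submodule.add_mem _ hc hc'), cochainForm_add,
    pinczonD_add hq hM (cochainForm_mem hc) (cochainForm_mem hc')]

lemma harrisonD_smul (hc : c ∈ harrisonCochains 𝒱 ℳ e k) (r : K) :
    harrisonD 𝒱 ℳ q lact e (r • c) = r • harrisonD 𝒱 ℳ q lact e c := by
  refine cochainForm_injective (𝒱 := 𝒱) (ℳ := ℳ) ?_
  rw [cochainForm_smul, ← pinczonD_cochainForm hq hM hc,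
    ← pinczonD_cochainForm hq hM (Submodule.smul_mem _ r hc), cochainForm_smul,
    pinczonD_smul hq hM (cochainForm_mem hc)]

lemma harrisonD_harrisonD [CharZero K] (hc : c ∈ harrisonCochains 𝒱 ℳ e k) :
    harrisonD 𝒱 ℳ q lact e (harrisonD 𝒱 ℳ q lact e c) = 0 := by
  refine eq_zero_of_cochainForm (𝒱 := 𝒱) (ℳ := ℳ) ?_
  rw [← pinczonD_cochainForm hq hM (harrisonD_mem hq hM hc), ← pinczonD_cochainForm hq hM hc,
    Nat.cast_succ, ← add_assoc, pinczonD_pinczonD hq hM (cochainForm_mem hc)]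

end Recover

/-! ### The maps associated to cochains -/

section TildeC

variable {K V M : Type*} [Field K] [AddCommGroup V] [Module K V] [AddCommGroup M] [Module K M]
  {𝒱 : ℤ → Submodule K V} [DirectSum.Decomposition 𝒱]
  {ℳ : ℤ → Submodule K M} [DirectSum.Decomposition ℳ] {k : ℕ} {e : ℤ}
  [FiniteDimensional K V] [FiniteDimensional K M]
  {c : MultilinearMap K (fun _ : Fin k => V) M}

lemma vanishesOnShuffles_tildeC (hc : c ∈ harrisonCochains 𝒱 ℳ e k) :
    VanishesOnShuffles (tildeGrading 𝒱 ℳ) (tildeC 𝒱 ℳ c) := by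
  have hB := (doubleSymp_nondegenerate (prodGrading 𝒱 ℳ)).1
  have h (y : Tilde K V M) : VanishesOnShuffles (tildeGrading 𝒱 ℳ)
      (((tildeSymp 𝒱 ℳ).flip y).compMultilinearMap (tildeC 𝒱 ℳ c)) := by
    rw [← contractLast_formOf]
    exact (cochainForm_mem hc).2.2 y
  exact vanishesOnShuffles_of_comp (fun y => (tildeSymp 𝒱 ℳ).flip y) (fun a ha => hB a ha) h

/-- The degree of the form `Ω_C̃` and the pairing degree `-2` force the degree of `C̃`, since a
vector orthogonal to all but one degree is homogeneous. -/
lemma hasDegree_tildeC (hc : c ∈ harrisonCochains 𝒱 ℳ e k) :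
    HasDegree (tildeGrading 𝒱 ℳ) (tildeGrading 𝒱 ℳ) (e + k - 1) (tildeC 𝒱 ℳ c) := by
  intro d x hx
  refine mem_of_doubleSymp_eq_zero fun n hn Y hY => ?_
  by_contra hne
  have h := hasDegree_scalar_iff.1 (cochainForm_mem hc).1
    (List.ofFn (fun i => ⟨d i, x i, hx i⟩) ++ [⟨n, Y, hY⟩])
  rw [cochainForm, ev_formOf, ev_ofFn, wdeg_append, wdeg_ofFn, wdeg_cons, wdeg_nil] at h
  have := h hne
  simp only at this
  exact hn (by linarith)

end TildeC

end Pinczon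
end
theorem mainTheorem6 {K V M : Type*} [Field K] [CharZero K]
    [AddCommGroup V] [Module K V] [FiniteDimensional K V]
    [AddCommGroup M] [Module K M] [FiniteDimensional K M]
    (𝒱 : ℤ → Submodule K V) [DirectSum.Decomposition 𝒱]
    (ℳ : ℤ → Submodule K M) [DirectSum.Decomposition ℳ]
    (q : V →ₗ[K] V →ₗ[K] V) (lact : V →ₗ[K] M →ₗ[K] M)
    (hq : Pinczon.IsCommAlgebra 𝒱 q) (hM : Pinczon.IsAlgebraModule 𝒱 ℳ q lact) (e : ℤ) :
    (∀ k : ℕ, ∀ c ∈ Pinczon.harrisonCochains 𝒱 ℳ e k,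
      Pinczon.IsQuadratic (Pinczon.tildeGrading 𝒱 ℳ) (Pinczon.tildeSymp 𝒱 ℳ)
          (Pinczon.tildeC 𝒱 ℳ c) ∧
        Pinczon.VanishesOnShuffles (Pinczon.tildeGrading 𝒱 ℳ) (Pinczon.tildeC 𝒱 ℳ c) ∧
        Pinczon.HasDegree (Pinczon.tildeGrading 𝒱 ℳ) (Pinczon.tildeGrading 𝒱 ℳ) (e + k - 1)
          (Pinczon.tildeC 𝒱 ℳ c)) ∧
    ∃ (dHa : ∀ k : ℕ, Pinczon.harrisonCochains 𝒱 ℳ e k →ₗ[K]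
          Pinczon.harrisonCochains 𝒱 ℳ e (k + 1))
      (dP : ∀ k : ℕ, Pinczon.cyclicVsp (Pinczon.tildeGrading 𝒱 ℳ) (e + k + 1) k →ₗ[K]
          Pinczon.cyclicVsp (Pinczon.tildeGrading 𝒱 ℳ) (e + (k + 1 : ℕ) + 1) (k + 1))
      (Φ : ∀ k : ℕ, Pinczon.harrisonCochains 𝒱 ℳ e k →ₗ[K]
          Pinczon.cyclicVsp (Pinczon.tildeGrading 𝒱 ℳ) (e + k + 1) k),
      (∀ k c, (dHa k c).1 = Pinczon.harrisonD 𝒱 ℳ q lact e c.1) ∧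
      (∀ k Λ, (dP k Λ).1 = Pinczon.pinczonD 𝒱 ℳ q lact (e + k + 1) Λ.1) ∧
      (∀ k c, (Φ k c).1 = Pinczon.formOf (Pinczon.tildeSymp 𝒱 ℳ) (Pinczon.tildeC 𝒱 ℳ c.1)) ∧
      (∀ k, dHa (k + 1) ∘ₗ dHa k = 0) ∧
      (∀ k, dP (k + 1) ∘ₗ dP k = 0) ∧
      (∀ k, Φ (k + 1) ∘ₗ dHa k = dP k ∘ₗ Φ k) := by
  -- The target of `dP k` is indexed by the cast of `k + 1`, while `pinczonD_mem` raises the degree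
  -- by one; the two integers must be identified by rewriting.
  have hdeg (k : ℕ) : e + (k + 1 : ℕ) + 1 = e + k + 1 + 1 := by push_cast; ring
  refine ⟨fun k c hc => ⟨(Pinczon.cochainForm_mem hc).2.1, Pinczon.vanishesOnShuffles_tildeC hc,
    Pinczon.hasDegree_tildeC hc⟩, ?_⟩
  refine ⟨fun k =>
      { toFun := fun c => ⟨_, Pinczon.harrisonD_mem hq hM c.2⟩
        map_add' := fun c c' => Subtype.ext (Pinczon.harrisonD_add hq hM c.2 c'.2)
        map_smul' := fun r c => Subtype.ext (Pinczon.harrisonD_smul hq hM c.2 r) },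
    fun k =>
      { toFun := fun Λ => ⟨Pinczon.pinczonD 𝒱 ℳ q lact (e + k + 1) Λ.1, by
          rw [hdeg]; exact Pinczon.pinczonD_mem hq hM Λ.2⟩
        map_add' := fun Λ Λ' => Subtype.ext (Pinczon.pinczonD_add hq hM Λ.2 Λ'.2)
        map_smul' := fun r Λ => Subtype.ext (Pinczon.pinczonD_smul hq hM Λ.2 r) },
    fun k =>
      { toFun := fun c => ⟨Pinczon.cochainForm 𝒱 ℳ c.1, Pinczon.cochainForm_mem c.2⟩
        map_add' := fun c c' => Subtype.ext Pinczon.cochainForm_add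
        map_smul' := fun r c => Subtype.ext (Pinczon.cochainForm_smul r) },
    fun _ _ => rfl, fun _ _ => rfl, fun _ _ => rfl, fun k => ?_, fun k => ?_, fun k => ?_⟩
  · exact LinearMap.ext fun c => Subtype.ext (Pinczon.harrisonD_harrisonD hq hM c.2)
  · refine LinearMap.ext fun Λ => Subtype.ext ?_
    change Pinczon.pinczonD 𝒱 ℳ q lact (e + (k + 1 : ℕ) + 1)
      (Pinczon.pinczonD 𝒱 ℳ q lact (e + k + 1) Λ.1) = 0
    rw [hdeg]
    exact Pinczon.pinczonD_pinczonD hq hM Λ.2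
  · exact LinearMap.ext fun c => Subtype.ext (Pinczon.pinczonD_cochainForm hq hM c.2).symm
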